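/- **Setup.** Let $|\psi^\pm\rangle=\tfrac1{\sqrt2}(|01\rangle\pm|10\rangle)$ and $|\phi^+\rangle=\tfrac1{\sqrt2}(|00\rangle+|11\rangle)$. For real $s$ let $$J(s)=-s\,|\psi^-\rangle\langle\psi^-|-|\psi^+\rangle\langle\psi^+| .$$ An instance consists of a simple graph $G=([n],E)$ with positive rational edge weights $w_{ij}$ and two rational thresholds $a,b$; it is encoded as a string, with $n$ and the vertices in unary and the numerators and denominators of the rationals in binary. For a two-qubit operator $K$ put $H_K=\sum_{(i,j)\in E,\ i<j}w_{ij}K_{ij}$, a Hamiltonian on $n$ qubits. For a polynomial $p$ with natural-number coefficients, the promise problem $\mathrm{LH}_p(K)$ is: given an instance with $w_{ij}\le p(n)$ for all edges and $(b-a)\,p(n)\ge 1$, decide whether the ground-state energy (least eigenvalue) of $H_K$ is at most $a$ (yes) or at least $b$ (no), promised that one of these holds. Let $\mathrm{Toy}_p(s)=\mathrm{LH}_p(J(s))$, and let $\mathrm{EPR}_p=\mathrm{LH}_p(-|\phi^+\rangle\langle\phi^+|)$ be the EPR problem of King. The problem $\mathrm{Toy}(s)$ is the family of the problems $\mathrm{Toy}_p(s)$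 over all polynomials $p$. **Claim.** Let $s<0$ be a real number for which some Turing machine computes, given $k$ in unary and in time polynomial in $k$, a rational number within $1/(k+1)$ of $s$ (this holds for instance for every rational or algebraic $s$). Then $\mathrm{Toy}(s)$ is reducible in polynomial time to $\mathrm{Toy}(0)$: for every polynomial $p$ there are a polynomial $q$ and a function $f$ from instances to instances, computable by a Turing machine in time polynomial in the length of the input, that maps yes-instances of $\mathrm{Toy}_p(s)$ to yes-instances of $\mathrm{Toy}_q(0)$ and no-instances of $\mathrm{Toy}_p(s)$ to no-instances of $\mathrm{Toy}_q(0)$. Moreover $\mathrm{Toy}(0)$ is the EPR problem: for every polynomial $p$, the problems $\mathrm{Toy}_p(0)$ and $\mathrm{EPR}_p$ have the same yes-instances and the same no-instances. -/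

import Mathlib

noncomputable section

namespace ToyModel

open Computability Turing

/-! ### Two-qubit interaction terms -/

/-- The computational basis vector `|ab⟩` of two qubits. -/
def ket (a b : Fin 2) : Fin 2 × Fin 2 → ℂ := Pi.single (a, b) 1

/-- The singlet `|ψ⁻⟩ = (|01⟩ - |10⟩)/√2`. -/
def psiMinus : Fin 2 × Fin 2 → ℂ := ((1 / √2 : ℝ) : ℂ) • (ket 0 1 - ket 1 0)

/-- The Bell state `|ψ⁺⟩ = (|01⟩ + |10⟩)/√2`. -/
def psiPlus : Fin 2 × Fin 2 → ℂ := ((1 / √2 : ℝ) : ℂ) • (ket 0 1 + ket 1 0)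

/-- The Bell state `|φ⁺⟩ = (|00⟩ + |11⟩)/√2`, also called the EPR state. -/
def phiPlus : Fin 2 × Fin 2 → ℂ := ((1 / √2 : ℝ) : ℂ) • (ket 0 0 + ket 1 1)

/-- The operators on two qubits, as matrices in the computational basis. -/
abbrev TwoQubitOp : Type := Matrix (Fin 2 × Fin 2) (Fin 2 × Fin 2) ℂ

/-- The rank-one operator `|ψ⟩⟨ψ|`. -/
def proj (ψ : Fin 2 × Fin 2 → ℂ) : TwoQubitOp := Matrix.vecMulVec ψ (star ψ)

/-- The interaction `J(s) = -s |ψ⁻⟩⟨ψ⁻| - |ψ⁺⟩⟨ψ⁺|`. -/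
def J (s : ℝ) : TwoQubitOp := -(s : ℂ) • proj psiMinus - proj psiPlus

/-- The interaction `-|φ⁺⟩⟨φ⁺|` of the EPR problem. -/
def eprTerm : TwoQubitOp := -proj phiPlus

/-- The two-qubit operator `K` acting on the qubits `i ≠ j` of `n` qubits (in this order),
and as the identity on all the other qubits. -/
def onPair {n : ℕ} (i j : Fin n) (K : TwoQubitOp) :
    Matrix (Fin n → Fin 2) (Fin n → Fin 2) ℂ :=
  Matrix.of fun x y =>
    open Classical in
    if ∀ k, k ≠ i → k ≠ j → x k = y k then K (x i, x j) (y i, y j) else 0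

/-- The ground-state energy, i.e. the least eigenvalue, of a Hermitian matrix. -/
def groundEnergy {ι : Type} [Fintype ι] [DecidableEq ι] (H : Matrix ι ι ℂ) : ℝ :=
  sInf {E : ℝ | Module.End.HasEigenvalue (Matrix.toLin' H) (E : ℂ)}

/-! ### Instances -/

/-- A (not necessarily reduced) fraction. -/
structure Frac where
  num : ℤ
  den : ℕ
  den_pos : 0 < den

/-- The rational number that a fraction denotes. -/
def Frac.val (q : Frac) : ℚ := q.num / q.den

/-- An edge `{fst, snd}` with a positive rational weight, on the vertex set `Fin n`. -/
structure Edge (n : ℕ) where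
  fst : Fin n
  snd : Fin n
  fst_lt_snd : fst < snd
  weight : Frac
  weight_pos : 0 < weight.val

/-- An instance: a simple graph on `n` vertices with positive edge weights, given by the list of
its edges, and two thresholds `lo` and `hi`. -/
structure Inst where
  n : ℕ
  edges : List (Edge n)
  simple : edges.Pairwise fun e f => (e.fst, e.snd) ≠ (f.fst, f.snd)
  lo : Frac
  hi : Frac

/-- The Hamiltonian `∑_{(i,j) ∈ E} w_{ij} K_{ij}` on `n` qubits. -/
def Inst.hamiltonian (I : Inst) (K : TwoQubitOp) :
    Matrix (Fin I.n → Fin 2) (Fin I.n → Fin 2) ℂ :=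
  (I.edges.map fun e => (e.weight.val : ℂ) • onPair e.fst e.snd K).sum

/-! ### Encoding of instances as strings -/

/-- A list of bit strings, as one string over the alphabet `{0, 1, #}` (`none` is the symbol `#`,
which ends each bit string). -/
def serialize (l : List (List Bool)) : List (Option Bool) :=
  l.flatMap fun w => w.map some ++ [none]

/-- Sign, numerator and denominator of a fraction, the latter two in binary. -/
def Frac.fields (q : Frac) : List (List Bool) :=
  [[decide (q.num < 0)], encodeNat q.num.natAbs, encodeNat q.den]

/-- The end points in unary, and the weight. -/
def Edge.fields {n : ℕ} (e : Edge n) : List (List Bool) :=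
  unaryEncodeNat e.fst :: unaryEncodeNat e.snd :: e.weight.fields

/-- The number of qubits in unary, the thresholds, and the edges. -/
def Inst.fields (I : Inst) : List (List Bool) :=
  unaryEncodeNat I.n :: (I.lo.fields ++ (I.hi.fields ++ I.edges.flatMap Edge.fields))

def Frac.encode (q : Frac) : List (Option Bool) := serialize q.fields

def Inst.encode (I : Inst) : List (Option Bool) := serialize I.fields

theorem unaryEncodeNat_injective : Function.Injective unaryEncodeNat :=
  unaryEncodingNat.encode_injective

theorem encodeNat_injective : Function.Injective encodeNat :=
  encodingNatBool.encode_injective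

theorem map_some_append_inj {u v : List Bool} {a b : List (Option Bool)}
    (h : u.map some ++ none :: a = v.map some ++ none :: b) : u = v ∧ a = b := by
  induction u generalizing v with
  | nil => cases v <;> simp_all
  | cons x u ih =>
    cases v with
    | nil => simp at h
    | cons y v =>
      simp only [List.map_cons, List.cons_append, List.cons.injEq, Option.some.injEq] at h
      obtain ⟨h1, h2⟩ := ih h.2
      exact ⟨by rw [h.1, h1], h2⟩

theorem serialize_injective : Function.Injective serialize := by
  intro l
  induction l with
  | nil =>
    intro m h
    cases m <;> simp_all [serialize]
  | cons u l ih =>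
    intro m h
    cases m with
    | nil => simp [serialize] at h
    | cons v m =>
      simp only [serialize, List.flatMap_cons, List.append_assoc, List.singleton_append] at h
      obtain ⟨h1, h2⟩ := map_some_append_inj h
      rw [h1, ih h2]

theorem Frac.fields_injective : Function.Injective Frac.fields := by
  rintro ⟨a, b, hb⟩ ⟨c, d, hd⟩ h
  simp only [Frac.fields, List.cons.injEq, and_true, decide_eq_decide] at h
  obtain ⟨h1, h2, h3⟩ := h
  have h2 := encodeNat_injective h2
  have h3 := encodeNat_injective h3
  subst h3
  have : a = c := by omega
  subst this
  rfl

/-- Distinct fractions have distinct encodings. -/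
theorem Frac.encode_injective : Function.Injective Frac.encode :=
  serialize_injective.comp Frac.fields_injective

theorem Frac.fields_append_inj {q r : Frac} {a b : List (List Bool)}
    (h : q.fields ++ a = r.fields ++ b) : q = r ∧ a = b := by
  obtain ⟨h1, h2⟩ := List.append_inj h (by simp [Frac.fields])
  exact ⟨Frac.fields_injective h1, h2⟩

theorem Edge.fields_append_inj {n : ℕ} {e f : Edge n} {a b : List (List Bool)}
    (h : e.fields ++ a = f.fields ++ b) : e = f ∧ a = b := by
  obtain ⟨i, j, hij, w, hw⟩ := e
  obtain ⟨i', j', hij', w', hw'⟩ := f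
  simp only [Edge.fields, List.cons_append, List.cons.injEq] at h
  obtain ⟨h1, h2, h3⟩ := h
  obtain ⟨rfl, h4⟩ := Frac.fields_append_inj h3
  have h1 := Fin.ext (unaryEncodeNat_injective h1)
  have h2 := Fin.ext (unaryEncodeNat_injective h2)
  subst h1 h2
  exact ⟨rfl, h4⟩

theorem edges_fields_injective {n : ℕ} :
    Function.Injective fun l : List (Edge n) => l.flatMap Edge.fields := by
  intro l
  induction l with
  | nil =>
    intro m h
    cases m <;> simp_all [Edge.fields]
  | cons e l ih =>
    intro m h
    cases m with
    | nil => simp [Edge.fields] at h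
    | cons f m =>
      simp only [List.flatMap_cons] at h
      obtain ⟨h1, h2⟩ := Edge.fields_append_inj h
      rw [h1, ih h2]

/-- Distinct instances have distinct encodings. -/
theorem Inst.encode_injective : Function.Injective Inst.encode := by
  refine serialize_injective.comp ?_
  rintro ⟨n, l, hl, a, b⟩ ⟨n', l', hl', a', b'⟩ h
  simp only [Inst.fields, List.cons.injEq] at h
  obtain ⟨h1, h2⟩ := h
  have h1 := unaryEncodeNat_injective h1
  subst h1
  obtain ⟨rfl, h3⟩ := Frac.fields_append_inj h2
  obtain ⟨rfl, h4⟩ := Frac.fields_append_inj h3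
  have h5 := edges_fields_injective h4
  subst h5
  rfl

/-! ### Promise problems and polynomial-time reductions -/

/-- A promise problem on instances; the instances that are in neither set break the promise. -/
@[ext]
structure PromiseProblem where
  yes : Set Inst
  no : Set Inst

/-- Polynomial-time many-one reducibility: some function that a Turing machine computes in time
polynomial in the length of the input maps yes-instances to yes-instances and no-instances to
no-instances. -/
def PolyTimeReducible (A B : PromiseProblem) : Prop :=
  ∃ f : Inst → Inst, Nonempty (TM2ComputableInPolyTime Inst.encode Inst.encode f) ∧
    (∀ I ∈ A.yes, f I ∈ B.yes) ∧ (∀ I ∈ A.no, f I ∈ B.no)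

/-- The promise that all weights are at most `p(n)` and that `hi - lo ≥ 1 / p(n)`. -/
def Inst.Promise (p : Polynomial ℕ) (I : Inst) : Prop :=
  (∀ e ∈ I.edges, e.weight.val ≤ ((p.eval I.n : ℕ) : ℚ)) ∧
    1 ≤ (I.hi.val - I.lo.val) * ((p.eval I.n : ℕ) : ℚ)

/-- The local Hamiltonian problem for positively weighted sums of the interaction `K`, where the
polynomial `p` bounds the weights and the inverse of the promise gap: is the ground-state energy
at most `lo`, or is it at least `hi`? -/
def localHamiltonianProblem (K : TwoQubitOp) (p : Polynomial ℕ) : PromiseProblem where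
  yes := {I | I.Promise p ∧ groundEnergy (I.hamiltonian K) ≤ (I.lo.val : ℝ)}
  no := {I | I.Promise p ∧ (I.hi.val : ℝ) ≤ groundEnergy (I.hamiltonian K)}

/-- The problem `Toy(s)`. -/
def Toy (s : ℝ) (p : Polynomial ℕ) : PromiseProblem := localHamiltonianProblem (J s) p

/-- The EPR problem. -/
def EPR (p : Polynomial ℕ) : PromiseProblem := localHamiltonianProblem eprTerm p

/-- Some Turing machine computes, from `k` in unary and in time polynomial in `k`, a fraction
within `1 / (k + 1)` of the real number `s`. -/
def PolyTimeApproximable (s : ℝ) : Prop :=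
  ∃ r : ℕ → Frac, Nonempty (TM2ComputableInPolyTime unaryEncodeNat Frac.encode r) ∧
    ∀ k : ℕ, |s - ((r k).val : ℝ)| ≤ 1 / ((k : ℝ) + 1)

end ToyModel

end

/-! The task is to manufacture the repulsive term $-s|\psi^-\rangle\langle\psi^-|$ (with $-s>0$)
from interactions $-|\psi^+\rangle\langle\psi^+|$ alone. Every edge $(i,j)$ receives two fresh
ancillas $a,b$, and $N=T^4$ is large. A strong term $-2N^2P$, with $P$ the projection to $\psi^+$ of
$ab$, freezes the ancillas; a weaker term $-2N(A_1+A_2)$, with $A_1,A_2$ the $\psi^+$ projections of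
$ia$ and $ja$, couples them to the qubits. Each half of a Bell pair is maximally mixed, so first
order gives only the constant $-N$. Second order gives $-2\|(1-P)(A_1+A_2)u\|^2$. Compressing
$A_1A_2+A_2A_1$ by $P$ yields a quarter of the swap of $i,j$, that is
$\frac14(1-2|\psi^-\rangle\langle\psi^-|)$ (`triplet_compress_mul`), so the second-order energy is
the expectation of $|\psi^-\rangle\langle\psi^-|-1$. The gadget therefore mediates a positive
singlet term, up to the constant $-(2N^2+N+1)$, and a direct edge supplies the triplet term.

This is proved without general perturbation theory. From below, each gadget satisfies an operator
inequality obtained by completing a square (`IsGadget.lower_bound`), and such inequalities add up.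
From above, a trial state with its first-order correction is inserted (`exists_trial_state`); the
corrections of different gadgets are orthogonal. The results are `gadget_lower_bound` and
`gadget_upper_bound`.

To have integral weights, $w$ is rounded to $u\approx T^2w$ and $-s$ to $t\approx -T^2s$, which
scales energies by $T^4$. With $T$ a large enough polynomial quantity, all errors together are at
most $T^3$ (`energy_error`), whereas the scaled promise gap is at least $T^4/p\ge 4T^3$.
Ground-state energies are never positive, so only negative thresholds matter.

For the running time, structured stack programs are compiled to Turing machines (`Exec.reach`,
`Prog.computable`); one instruction runs the given machine that approximates $s$. The functions
computed in polynomial time by such programs (`PT`) are closed under composition, pairing, case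
distinction and size-bounded iteration, and the reduction on strings is assembled from these
(`PT.reductionStr`). Intermediate integers are polynomially bounded and kept in unary; only the
fractions that are read in are binary, and their quotients are clamped at $T^4$ so that repeated
subtraction suffices.

For the EPR problem, one rotation applied to every qubit fixes $X$ and exchanges $Y$ and $Z$ up to
sign. It turns $\psi^+=\frac14(1+XX+YY-ZZ)$ into $\phi^+=\frac14(1+XX-YY+ZZ)$ on all pairs at once
(`groundEnergy_epr`). -/

noncomputable section

/-! ### From structured stack programs to Turing machines -/

namespace ToyModel

open Computability Turing

/-! ### Structured stack programs -/

/-- Stack symbols. -/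
abbrev Sym : Type := Option Bool

/-- Structured programs over stacks indexed by `ι`. The program `loop k b` pops symbols from the
stack `k` until it is empty and runs `b a` for each symbol `a`; `cases k p b` pops one symbol;
`call i o` runs an external machine on the unary number on stack `i`. -/
inductive Prog (ι : Type) : Type
  | skip : Prog ι
  | push : ι → Sym → Prog ι
  | seq : Prog ι → Prog ι → Prog ι
  | loop : ι → (Sym → Prog ι) → Prog ι
  | cases : ι → Prog ι → (Sym → Prog ι) → Prog ι
  | call : ι → ι → Prog ι

/-- The external function: its values on unary numbers, and the time it takes. -/
structure Oracle where
  out : ℕ → List Sym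
  time : Polynomial ℕ
  length_out_le : ∀ n, (out n).length ≤ time.eval n

/-- `Exec O p S t S'`: the program `p` takes the stacks `S` to `S'` in `t` steps. -/
inductive Exec {ι : Type} [DecidableEq ι] (O : Oracle) :
    Prog ι → (ι → List Sym) → ℕ → (ι → List Sym) → Prop
  | skip (S) : Exec O .skip S 1 S
  | push (k a S) : Exec O (.push k a) S 1 (Function.update S k (a :: S k))
  | seq {p q S S' S'' t t'} : Exec O p S t S' → Exec O q S' t' S'' →
      Exec O (.seq p q) S (t + t') S''
  | loopNil {k b S} : S k = [] → Exec O (.loop k b) S 1 S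
  | loopCons {k b a l S S' S'' t t'} : S k = a :: l → Exec O (b a) (Function.update S k l) t S' →
      Exec O (.loop k b) S' t' S'' → Exec O (.loop k b) S (1 + t + t') S''
  | casesNil {k p b S S' t} : S k = [] → Exec O p S t S' → Exec O (.cases k p b) S (1 + t) S'
  | casesCons {k p b a l S S' t} : S k = a :: l → Exec O (b a) (Function.update S k l) t S' →
      Exec O (.cases k p b) S (1 + t) S'
  | call {i o : ι} {n : ℕ} {S S' : ι → List Sym} : S i = List.replicate n (some true) →
      S' = Function.update (Function.update S i []) o
        ((O.out n).reverse ++ Function.update S i [] o) →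
      Exec O (.call i o) S (O.time.eval n) S'

/-! ### Runs of a machine -/

/-- The machine `m` gets from `c` to `c'` in at most `t` steps. -/
def Reach {K : Type} [DecidableEq K] {Γ : K → Type} {L σ : Type} (m : L → TM2.Stmt Γ L σ)
    (c : TM2.Cfg Γ L σ) (t : ℕ) (c' : TM2.Cfg Γ L σ) : Prop :=
  ∃ n ≤ t, (flip bind (TM2.step m))^[n] (some c) = some c'

section Reach

variable {K : Type} [DecidableEq K] {Γ : K → Type} {L σ : Type} {m : L → TM2.Stmt Γ L σ}

theorem Reach.refl (c : TM2.Cfg Γ L σ) : Reach m c 0 c := ⟨0, le_rfl, rfl⟩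

theorem Reach.trans {c c' c'' : TM2.Cfg Γ L σ} {t t' : ℕ} (h : Reach m c t c')
    (h' : Reach m c' t' c'') : Reach m c (t + t') c'' := by
  obtain ⟨n, hn, h⟩ := h
  obtain ⟨n', hn', h'⟩ := h'
  refine ⟨n' + n, by omega, ?_⟩
  rw [Function.iterate_add_apply, h, h']

theorem Reach.mono {c c' : TM2.Cfg Γ L σ} {t t' : ℕ} (h : Reach m c t c') (ht : t ≤ t') :
    Reach m c t' c' :=
  let ⟨n, hn, h⟩ := h
  ⟨n, hn.trans ht, h⟩

theorem Reach.single {l : L} {v : σ} {S : ∀ k, List (Γ k)} {c' : TM2.Cfg Γ L σ}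
    (h : TM2.stepAux (m l) v S = c') : Reach m ⟨some l, v, S⟩ 1 c' :=
  ⟨1, le_rfl, by simp [flip, h]⟩

end Reach

/-! ### Compilation of programs -/

section Compile

set_option linter.unusedSectionVars false

variable {ι : Type} [DecidableEq ι] (M : TM2ComputableAux Bool Sym)

/-- Stack alphabets of the compiled machine: those of the program and those of the external
machine. -/
abbrev Alph (ι : Type) : ι ⊕ M.tm.K → Type
  | .inl _ => Sym
  | .inr k => M.tm.Γ k

/-- The internal state of the compiled machine: that of the external machine, and the symbol
popped last. -/
abbrev Store : Type := M.tm.σ × Option Sym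

variable {M}

/-- The stacks of the compiled machine. -/
def regs (S : ι → List Sym) (R : ∀ k, List (M.tm.Γ k)) : ∀ k, List (Alph M ι k)
  | .inl k => S k
  | .inr k => R k

@[simp] theorem regs_inl (S : ι → List Sym) (R : ∀ k, List (M.tm.Γ k)) (k : ι) :
    regs S R (.inl k) = S k := rfl

@[simp] theorem regs_inr (S : ι → List Sym) (R : ∀ k, List (M.tm.Γ k)) (k : M.tm.K) :
    regs S R (.inr k) = R k := rfl

@[simp] theorem update_regs_inl (S : ι → List Sym) (R : ∀ k, List (M.tm.Γ k)) (k : ι)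
    (l : List Sym) :
    Function.update (regs S R) (.inl k) l = regs (Function.update S k l) R := by
  funext j
  rcases j with j | j
  · by_cases h : j = k
    · subst h; simp
    · rw [Function.update_of_ne (by simpa using h)]
      simp [Function.update_of_ne h]
  · rw [Function.update_of_ne (by simp)]; rfl

@[simp] theorem update_regs_inr (S : ι → List Sym) (R : ∀ k, List (M.tm.Γ k)) (k : M.tm.K)
    (l : List (M.tm.Γ k)) :
    Function.update (regs S R) (.inr k) l = regs S (Function.update R k l) := by
  funext j
  rcases j with j | j
  · rw [Function.update_of_ne (by simp)]; rfl
  · by_cases h : j = k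
    · subst h; simp
    · rw [Function.update_of_ne (by simpa using h)]
      simp [Function.update_of_ne h]

variable (M)

/-- Labels of the compiled program. -/
def Prog.Label : Prog ι → Type
  | .skip => Unit
  | .push _ _ => Unit
  | .seq p q => p.Label ⊕ q.Label
  | .loop _ b => Option (Σ a, (b a).Label)
  | .cases _ p b => Option (p.Label ⊕ Σ a, (b a).Label)
  | .call _ _ => Bool ⊕ M.tm.Λ

theorem Prog.finite_label (p : Prog ι) : Finite (p.Label M) := by
  have := M.tm.ΛFin
  induction p with
  | skip | push => exact inferInstanceAs (Finite Unit)
  | seq p q hp hq => exact inferInstanceAs (Finite (p.Label M ⊕ q.Label M))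
  | loop k b hb => exact inferInstanceAs (Finite (Option (Σ a, (b a).Label M)))
  | cases k p b hp hb =>
    exact inferInstanceAs (Finite (Option (p.Label M ⊕ Σ a, (b a).Label M)))
  | call => exact inferInstanceAs (Finite (Bool ⊕ M.tm.Λ))

/-- The label at which the compiled program starts. -/
def Prog.entry : (p : Prog ι) → p.Label M
  | .skip => ()
  | .push _ _ => ()
  | .seq p _ => .inl p.entry
  | .loop _ _ => none
  | .cases _ _ _ => none
  | .call _ _ => .inl false

variable {M}

/-- A statement of the external machine as a statement of the compiled machine. -/
def liftStmt {L : Type} (e : M.tm.Λ → L) (x : L) :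
    TM2.Stmt M.tm.Γ M.tm.Λ M.tm.σ → TM2.Stmt (Alph M ι) L (Store M)
  | .push k f q => .push (.inr k) (fun s => f s.1) (liftStmt e x q)
  | .peek k f q => .peek (.inr k) (fun s o => (f s.1 o, s.2)) (liftStmt e x q)
  | .pop k f q => .pop (.inr k) (fun s o => (f s.1 o, s.2)) (liftStmt e x q)
  | .load f q => .load (fun s => (f s.1, s.2)) (liftStmt e x q)
  | .branch f q q' => .branch (fun s => f s.1) (liftStmt e x q) (liftStmt e x q')
  | .goto f => .goto fun s => e (f s.1)
  | .halt => .goto fun _ => x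

/-- The code of the compiled program, for labels embedded by `e` and exit label `x`. -/
def Prog.code {L : Type} : (p : Prog ι) → (p.Label M → L) → L → p.Label M →
    TM2.Stmt (Alph M ι) L (Store M)
  | .skip, _, x, _ => .goto fun _ => x
  | .push k a, _, x, _ => .push (.inl k) (fun _ => a) (.goto fun _ => x)
  | .seq p q, e, _, .inl l => p.code (fun l => e (.inl l)) (e (.inr (q.entry M))) l
  | .seq _ q, e, x, .inr l => q.code (fun l => e (.inr l)) x l
  | .loop k b, e, x, none => .pop (.inl k) (fun s o => (s.1, o))
      (.goto fun s => s.2.elim x fun a => e (some ⟨a, (b a).entry M⟩))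
  | .loop _ b, e, _, some ⟨a, l⟩ => (b a).code (fun l => e (some ⟨a, l⟩)) (e none) l
  | .cases k p b, e, _, none => .pop (.inl k) (fun s o => (s.1, o))
      (.goto fun s => s.2.elim (e (some (.inl (p.entry M))))
        fun a => e (some (.inr ⟨a, (b a).entry M⟩)))
  | .cases _ p _, e, x, some (.inl l) => p.code (fun l => e (some (.inl l))) x l
  | .cases _ _ b, e, x, some (.inr ⟨a, l⟩) => (b a).code (fun l => e (some (.inr ⟨a, l⟩))) x l
  | .call i _, e, _, .inl false => .pop (.inl i) (fun s o => (s.1, o))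
      (.branch (fun s => s.2.isNone) (.goto fun _ => e (.inr M.tm.main))
        (.push (.inr M.tm.k₀) (fun _ => M.inputAlphabet.symm true)
          (.goto fun _ => e (.inl false))))
  | .call _ o, e, x, .inl true => .pop (.inr M.tm.k₁) (fun s a => (s.1, a.map M.outputAlphabet))
      (.branch (fun s => s.2.isNone) (.goto fun _ => x)
        (.push (.inl o) (fun s => s.2.getD none) (.goto fun _ => e (.inl true))))
  | .call _ _, e, _, .inr l => liftStmt (fun l => e (.inr l)) (e (.inl true)) (M.tm.m l)

variable {L : Type} {m : L → TM2.Stmt (Alph M ι) L (Store M)}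

/-- A lifted statement touches only the external stacks and the first component of the store.
Halting becomes a jump to `x`, which is why an absent label is sent to `x` by `Option.elim`. -/
theorem stepAux_liftStmt (e : M.tm.Λ → L) (x : L) (q : TM2.Stmt M.tm.Γ M.tm.Λ M.tm.σ)
    (v : M.tm.σ) (b : Option Sym) (S : ι → List Sym) (R : ∀ k, List (M.tm.Γ k)) :
    TM2.stepAux (liftStmt e x q) (v, b) (regs S R) =
      ⟨some ((TM2.stepAux q v R).l.elim x e), ((TM2.stepAux q v R).var, b),
        regs S (TM2.stepAux q v R).stk⟩ := by
  induction q generalizing v R with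
  | push k f q ih | peek k f q ih | pop k f q ih | load f q ih => simp [liftStmt, ih]
  | branch f q q' ih ih' =>
    simp only [liftStmt, TM2.stepAux, ih, ih']
    cases f v <;> rfl
  | goto f => simp [liftStmt]
  | halt => simp [liftStmt]

/-- The compiled machine simulates the external machine. -/
theorem reach_liftStmt (e : M.tm.Λ → L) (x : L) (hm : ∀ l, m (e l) = liftStmt e x (M.tm.m l))
    (S : ι → List Sym) (b : Option Sym) (n : ℕ) (c c' : TM2.Cfg M.tm.Γ M.tm.Λ M.tm.σ)
    (h : (flip bind (TM2.step M.tm.m))^[n] (some c) = some c') :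
    Reach m ⟨some (c.l.elim x e), (c.var, b), regs S c.stk⟩ n
      ⟨some (c'.l.elim x e), (c'.var, b), regs S c'.stk⟩ := by
  induction n generalizing c with
  | zero =>
    simp only [Function.iterate_zero, id_eq, Option.some.injEq] at h
    subst h
    exact Reach.refl _
  | succ n ih =>
    rw [Function.iterate_succ_apply] at h
    obtain ⟨l, v, R⟩ := c
    cases l with
    | none =>
      have : flip bind (TM2.step M.tm.m) (some ⟨none, v, R⟩) = none := rfl
      rw [this] at h
      have hn : ∀ n, (flip bind (TM2.step M.tm.m))^[n] none = none := fun n =>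
        Function.iterate_fixed rfl n
      rw [hn] at h
      exact absurd h (by simp)
    | some l =>
      have : flip bind (TM2.step M.tm.m) (some ⟨some l, v, R⟩)
        = some (TM2.stepAux (M.tm.m l) v R) := rfl
      rw [this] at h
      rw [add_comm]
      refine Reach.trans (Reach.single ?_) (ih _ h)
      simp only [Option.elim, hm, stepAux_liftStmt]

/-- Moving the output symbol by symbol reverses it; this is the reversal in the rule `Exec.call`. -/
theorem unload_reach (o : ι) (l x : L)
    (hm : m l = .pop (.inr M.tm.k₁) (fun s a => (s.1, a.map M.outputAlphabet))
      (.branch (fun s => s.2.isNone) (.goto fun _ => x)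
        (.push (.inl o) (fun s => s.2.getD none) (.goto fun _ => l))))
    (w : List Sym) (v : M.tm.σ) (b : Option Sym) (S : ι → List Sym) (R : ∀ k, List (M.tm.Γ k))
    (hR : R M.tm.k₁ = w.map M.outputAlphabet.symm) :
    ∃ b', Reach m ⟨some l, (v, b), regs S R⟩ (w.length + 1)
      ⟨some x, (v, b'), regs (Function.update S o (w.reverse ++ S o))
        (Function.update R M.tm.k₁ [])⟩ := by
  induction w generalizing b S R with
  | nil =>
    refine ⟨none, Reach.single ?_⟩
    simp only [List.map_nil] at hR
    simp [hm, hR]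
  | cons a w ih =>
    obtain ⟨b', h⟩ := ih (some a) (Function.update S o (a :: S o))
      (Function.update R M.tm.k₁ (w.map M.outputAlphabet.symm)) (by simp)
    have h1 : Reach m ⟨some l, (v, b), regs S R⟩ 1 ⟨some l, (v, some a),
        regs (Function.update S o (a :: S o))
          (Function.update R M.tm.k₁ (w.map M.outputAlphabet.symm))⟩ :=
      Reach.single (by rw [hm]; simp [hR])
    refine ⟨b', Reach.mono (t := 1 + (w.length + 1)) ?_ (by simp; omega)⟩
    simpa using h1.trans h

/-- The transfer reverses the word as well, but a unary word is its own reversal. -/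
theorem load_reach (i : ι) (l x : L)
    (hm : m l = .pop (.inl i) (fun s o => (s.1, o))
      (.branch (fun s => s.2.isNone) (.goto fun _ => x)
        (.push (.inr M.tm.k₀) (fun _ => M.inputAlphabet.symm true) (.goto fun _ => l))))
    (n : ℕ) (v : M.tm.σ) (b : Option Sym) (S : ι → List Sym) (R : ∀ k, List (M.tm.Γ k))
    (hS : S i = List.replicate n (some true)) :
    ∃ b', Reach m ⟨some l, (v, b), regs S R⟩ (n + 1)
      ⟨some x, (v, b'), regs (Function.update S i []) (Function.update R M.tm.k₀
        (List.replicate n (M.inputAlphabet.symm true) ++ R M.tm.k₀))⟩ := by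
  induction n generalizing b S R with
  | zero =>
    refine ⟨none, Reach.single ?_⟩
    simp only [List.replicate_zero] at hS
    simp [hm, hS]
  | succ n ih =>
    obtain ⟨b', h⟩ := ih (some (some true)) (Function.update S i (List.replicate n (some true)))
      (Function.update R M.tm.k₀ (M.inputAlphabet.symm true :: R M.tm.k₀)) (by simp)
    have h1 : Reach m ⟨some l, (v, b), regs S R⟩ 1 ⟨some l, (v, some (some true)),
        regs (Function.update S i (List.replicate n (some true)))
          (Function.update R M.tm.k₀ (M.inputAlphabet.symm true :: R M.tm.k₀))⟩ :=
      Reach.single (by rw [hm]; simp [hS, List.replicate_succ])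
    refine ⟨b', Reach.mono (t := 1 + (n + 1)) ?_ (by omega)⟩
    · have hr : List.replicate n (M.inputAlphabet.symm true) ++
          M.inputAlphabet.symm true :: R M.tm.k₀ =
          List.replicate (n + 1) (M.inputAlphabet.symm true) ++ R M.tm.k₀ := by
        rw [List.replicate_succ', List.append_assoc]; rfl
      simpa [hr] using h1.trans h

/-- The empty stacks of the external machine. -/
def noStacks (M : TM2ComputableAux Bool Sym) : ∀ k, List (M.tm.Γ k) := fun _ => []

/-- The external machine computes the external function in its time. -/
def Implements (M : TM2ComputableAux Bool Sym) (O : Oracle) : Prop :=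
  ∀ n, ∃ t, Nonempty (TM2OutputsInTime M.tm (List.replicate n (M.inputAlphabet.symm true))
    (some ((O.out n).map M.outputAlphabet.symm)) t) ∧ n + t + (O.out n).length + 2 ≤ O.time.eval n

theorem initList_eq (l : List (M.tm.Γ M.tm.k₀)) : initList M.tm l =
    ⟨some M.tm.main, M.tm.initialState, Function.update (noStacks M) M.tm.k₀ l⟩ := by
  unfold initList
  congr 1
  funext k
  by_cases h : k = M.tm.k₀
  · subst h; simp
  · simp [h, noStacks]

theorem haltList_eq (l : List (M.tm.Γ M.tm.k₁)) : haltList M.tm l =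
    ⟨none, M.tm.initialState, Function.update (noStacks M) M.tm.k₁ l⟩ := by
  unfold haltList
  congr 1
  funext k
  by_cases h : k = M.tm.k₁
  · subst h; simp
  · simp [h, noStacks]

/-- Correctness of compilation, by induction on the execution. The label embedding `e` and the exit
label `x` are arbitrary so that the hypothesis applies to a subprogram inside a larger program. The
external machine has empty stacks and its initial state at both ends, so that it can be called
repeatedly; only the symbol popped last is uncontrolled. -/
theorem Exec.reach {O : Oracle} (hO : Implements M O) {p : Prog ι} {S S' : ι → List Sym} {t : ℕ}
    (h : Exec O p S t S') :
    ∀ (e : p.Label M → L) (x : L), (∀ l, m (e l) = p.code e x l) → ∀ b, ∃ b',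
      Reach m ⟨some (e (p.entry M)), (M.tm.initialState, b), regs S (noStacks M)⟩ t
        ⟨some x, (M.tm.initialState, b'), regs S' (noStacks M)⟩ := by
  induction h with
  | skip S =>
    intro e x hm b
    exact ⟨b, Reach.single (by rw [hm]; simp [Prog.code])⟩
  | push k a S =>
    intro e x hm b
    exact ⟨b, Reach.single (by rw [hm]; simp [Prog.code])⟩
  | @seq p q S S' S'' t t' h h' ih ih' =>
    intro e x hm b
    obtain ⟨b', h1⟩ := ih (fun l => e (.inl l)) (e (.inr (q.entry M))) (fun l => hm (.inl l)) b
    obtain ⟨b'', h2⟩ := ih' (fun l => e (.inr l)) x (fun l => hm (.inr l)) b'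
    exact ⟨b'', h1.trans h2⟩
  | @loopNil k p S hS =>
    intro e x hm b
    have hu : Function.update S k [] = S := by rw [← hS]; exact Function.update_eq_self _ _
    exact ⟨none, Reach.single (by erw [hm none]; simp [Prog.code, hS, hu])⟩
  | @loopCons k p a l S S' S'' t t' hS h h' ih ih' =>
    intro e x hm b
    obtain ⟨b', h1⟩ := ih (fun l => e (some ⟨a, l⟩)) (e none) (fun l => hm (some ⟨a, l⟩)) (some a)
    obtain ⟨b'', h2⟩ := ih' e x hm b'
    refine ⟨b'', ((Reach.single ?_).trans h1).trans h2⟩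
    erw [hm none]
    simp [Prog.code, hS]
  | @casesNil k p q S S' t hS h ih =>
    intro e x hm b
    obtain ⟨b', h1⟩ := ih (fun l => e (some (.inl l))) x (fun l => hm (some (.inl l))) none
    have hu : Function.update S k [] = S := by rw [← hS]; exact Function.update_eq_self _ _
    refine ⟨b', (Reach.single ?_).trans h1⟩
    erw [hm none]
    simp [Prog.code, hS, hu]
  | @casesCons k p q a l S S' t hS h ih =>
    intro e x hm b
    obtain ⟨b', h1⟩ := ih (fun l => e (some (.inr ⟨a, l⟩))) x (fun l => hm (some (.inr ⟨a, l⟩)))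
      (some a)
    refine ⟨b', (Reach.single ?_).trans h1⟩
    erw [hm none]
    simp [Prog.code, hS]
  | @call i o n S S' hS hS' =>
    intro e x hm b
    -- A call has three phases: loading the argument (`n + 1` steps), running the machine (`st`
    -- steps), and unloading the output (its length plus one). `Implements` bounds their sum by the
    -- time of the oracle.
    obtain ⟨t, ⟨⟨⟨st, hrun'⟩, hle⟩⟩, ht⟩ := hO n
    obtain ⟨b1, h1⟩ := load_reach i (e (.inl false)) (e (.inr M.tm.main)) (hm (.inl false)) n
      M.tm.initialState b S (noStacks M) hS
    simp only [Option.map_some] at hrun'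
    erw [initList_eq, haltList_eq] at hrun'
    have h2 := reach_liftStmt (m := m) (fun l => e (.inr l)) (e (.inl true))
      (fun l => hm (.inr l)) (Function.update S i []) b1 _ _ _ hrun'
    obtain ⟨b3, h3⟩ := unload_reach o (e (.inl true)) x (hm (.inl true)) (O.out n)
      M.tm.initialState b1 (Function.update S i []) (Function.update (noStacks M) M.tm.k₁
        ((O.out n).map M.outputAlphabet.symm)) (by simp)
    simp only at hle
    subst hS'
    refine ⟨b3, Reach.mono ((h1.trans (Reach.trans ?_ h2)).trans ?_)
      (show (n + 1 + (0 + st)) + ((O.out n).length + 1) ≤ _ by omega)⟩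
    · simp only [Option.elim, noStacks, List.append_nil]
      exact Reach.refl _
    · have : Function.update (Function.update (noStacks M) M.tm.k₁
        ((O.out n).map M.outputAlphabet.symm)) M.tm.k₁ [] = noStacks M := by
        rw [Function.update_idem]
        exact Function.update_eq_self _ _
      rw [this] at h3
      simpa only [Option.elim] using h3

/-- A function that is computed by a structured program in polynomial time is computed by a Turing
machine in polynomial time. -/
theorem Prog.computable [Fintype ι] {O : Oracle} (hO : Implements M O) {α β : Type}
    (ea : α → List Sym) (eb : β → List Sym) (f : α → β) (p : Prog ι) (i o : ι) (P : Polynomial ℕ)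
    (h : ∀ a, ∃ t ≤ P.eval (ea a).length, Exec O p (Function.update (fun _ => []) i (ea a)) t
      (Function.update (fun _ => []) o (eb (f a)))) :
    Nonempty (TM2ComputableInPolyTime ea eb f) := by
  have hL : Finite (Option (p.Label M)) := by
    have := p.finite_label M
    infer_instance
  have hF := Fintype.ofFinite (Option (p.Label M))
  have hK := M.tm.kFin
  have hs := M.tm.σFin
  -- A halting configuration must carry the initial internal state, so the exit label `none` first
  -- erases the symbol popped last. This accounts for the extra step in the time bound `P + 1`.
  let m : Option (p.Label M) → TM2.Stmt (Alph M ι) (Option (p.Label M)) (Store M) := fun l =>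
    l.elim (.load (fun s => (s.1, none)) .halt) (p.code some none)
  let tm : FinTM2 :=
    { K := ι ⊕ M.tm.K
      k₀ := .inl i
      k₁ := .inl o
      Γ := Alph M ι
      Λ := Option (p.Label M)
      main := some (p.entry M)
      σ := Store M
      initialState := (M.tm.initialState, none)
      Γk₀Fin := (inferInstance : Fintype Sym)
      m := m }
  refine ⟨⟨⟨tm, Equiv.refl Sym, Equiv.refl Sym⟩, P + 1, fun a => ?_⟩⟩
  have hex : ∃ n ≤ P.eval (ea a).length + 1, (flip bind (TM2.step m))^[n]
      (some (initList tm ((ea a).map id))) = some (haltList tm ((eb (f a)).map id)) := by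
    rw [List.map_id, List.map_id]
    obtain ⟨t, ht, hex⟩ := h a
    obtain ⟨b', hr⟩ := hex.reach (m := m) hO some none (fun l => rfl) none
    have hr' := hr.trans (Reach.single (c' := ⟨none, (M.tm.initialState, none),
      regs (Function.update (fun _ => []) o (eb (f a))) (noStacks M)⟩) (by simp [m]))
    have h1 : initList tm (ea a) = ⟨some (some (p.entry M)), (M.tm.initialState, none),
        regs (Function.update (fun _ => []) i (ea a)) (noStacks M)⟩ := by
      unfold initList
      congr 1
      funext k
      rcases k with k | k
      · by_cases hk : k = i
        · subst hk; simp [tm]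
        · simp [tm, hk]
      · simp [tm, noStacks]
    have h2 : haltList tm (eb (f a)) = ⟨none, (M.tm.initialState, none),
        regs (Function.update (fun _ => []) o (eb (f a))) (noStacks M)⟩ := by
      unfold haltList
      congr 1
      funext k
      rcases k with k | k
      · by_cases hk : k = o
        · subst hk; simp [tm]
        · simp [tm, hk]
      · simp [tm, noStacks]
    rw [h1, h2]
    exact hr'.mono (by omega)
  refine ⟨⟨hex.choose, ?_⟩, ?_⟩
  · exact hex.choose_spec.2
  · simpa using hex.choose_spec.1

end Compile

/-! ### The length of the output of a machine -/

/-- The number of pushes in a statement. -/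
def pushes {K : Type} {Γ : K → Type} {L σ : Type} : TM2.Stmt Γ L σ → ℕ
  | .push _ _ q => pushes q + 1
  | .peek _ _ q => pushes q
  | .pop _ _ q => pushes q
  | .load _ q => pushes q
  | .branch _ q q' => pushes q + pushes q'
  | .goto _ => 0
  | .halt => 0

theorem length_stepAux_le {K : Type} [DecidableEq K] {Γ : K → Type} {L σ : Type}
    (q : TM2.Stmt Γ L σ) (v : σ) (S : ∀ k, List (Γ k)) (j : K) :
    ((TM2.stepAux q v S).stk j).length ≤ (S j).length + pushes q := by
  induction q generalizing v S with
  | push k f q ih =>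
    refine (ih _ _).trans ?_
    by_cases h : j = k
    · subst h; simp [pushes]; omega
    · simp [pushes, Function.update_of_ne h]
  | peek k f q ih | load f q ih => exact ih _ _
  | pop k f q ih =>
    refine (ih _ _).trans ?_
    by_cases h : j = k
    · subst h; simp [pushes]
    · simp [pushes, Function.update_of_ne h]
  | branch f q q' ih ih' =>
    simp only [TM2.stepAux, pushes]
    cases f v
    · exact (ih' _ _).trans (by omega)
    · exact (ih _ _).trans (by omega)
  | goto f => simp [pushes]
  | halt => simp [pushes]

/-- The time of a call includes unloading the output. That the output of a polynomial-time machine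
has polynomial length is not part of its definition; it holds because a step makes at most `c`
pushes. -/
theorem length_iterate_step_le {K : Type} [DecidableEq K] {Γ : K → Type} {L σ : Type}
    (m : L → TM2.Stmt Γ L σ) (c : ℕ) (hc : ∀ l, pushes (m l) ≤ c) (n : ℕ)
    (a b : TM2.Cfg Γ L σ) (h : (flip bind (TM2.step m))^[n] (some a) = some b) (j : K) :
    (b.stk j).length ≤ (a.stk j).length + c * n := by
  induction n generalizing a with
  | zero =>
    simp only [Function.iterate_zero, id_eq, Option.some.injEq] at h
    simp [h]
  | succ n ih =>
    rw [Function.iterate_succ_apply] at h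
    obtain ⟨l, v, R⟩ := a
    cases l with
    | none =>
      have hn : ∀ n, (flip bind (TM2.step m))^[n] none = none := fun n =>
        Function.iterate_fixed rfl n
      change (flip bind (TM2.step m))^[n] none = some b at h
      rw [hn] at h
      exact absurd h (by simp)
    | some l =>
      have := ih (TM2.stepAux (m l) v R) h
      refine this.trans ?_
      have h1 := length_stepAux_le (m l) v R j
      have h2 := hc l
      dsimp only
      rw [mul_add]
      omega

/-- The external function of a polynomial-time machine. -/
theorem exists_oracle {β : Type} {eb : β → List Sym} {f : ℕ → β}
    (M : TM2ComputableInPolyTime unaryEncodeNat eb f) :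
    ∃ O : Oracle, Implements M.toTM2ComputableAux O ∧ ∀ n, O.out n = eb (f n) := by
  have hF := M.tm.ΛFin
  obtain ⟨c, hc⟩ : ∃ c, ∀ l, pushes (M.tm.m l) ≤ c :=
    ⟨∑ l, pushes (M.tm.m l), fun l => Finset.single_le_sum (f := fun l => pushes (M.tm.m l))
      (fun _ _ => Nat.zero_le _) (Finset.mem_univ l)⟩
  have key : ∀ n, n + M.time.eval n + (eb (f n)).length + 2 ≤
      (2 * Polynomial.X + M.time + Polynomial.C c * M.time + 2).eval n := fun n => by
    have h := M.outputsFun n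
    have h1 := length_iterate_step_le M.tm.m c hc _ _ _ h.evals_in_steps M.tm.k₁
    have h2 := h.steps_le_m
    have hu : (unaryEncodeNat n).length = n := unary_decode_encode_nat n
    have h2' : h.steps ≤ M.time.eval n := h2.trans_eq (by rw [hu])
    simp only [haltList_eq, initList_eq] at h1
    -- The output stack may coincide with the input stack, so it can hold `n` symbols at the start;
    -- hence the second `n` in the time bound.
    have h3 : (Function.update (noStacks M.toTM2ComputableAux) M.tm.k₀
        (List.map M.inputAlphabet.invFun (unaryEncodeNat n)) M.tm.k₁).length ≤ n := by
      by_cases hk : M.tm.k₁ = M.tm.k₀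
      · have : ∀ (k : M.tm.K) (l : List (M.tm.Γ M.tm.k₀)), (Function.update (noStacks M.toTM2ComputableAux) M.tm.k₀ l k).length ≤ l.length := by
          intro k l
          by_cases hk : k = M.tm.k₀
          · subst hk; simp
          · simp [Function.update_of_ne hk, noStacks]
        refine (this _ _).trans ?_
        rw [List.length_map, hu]
      · simp [Function.update_of_ne hk, noStacks]
    have h4 := Nat.mul_le_mul_left c h2'
    simp only [Function.update_self, List.length_map] at h1
    simp only [Polynomial.eval_add, Polynomial.eval_mul, Polynomial.eval_X, Polynomial.eval_C,
      Polynomial.eval_ofNat]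
    omega
  refine ⟨⟨fun n => eb (f n), 2 * Polynomial.X + M.time + Polynomial.C c * M.time + 2,
    fun n => (key n).trans' (by omega)⟩, fun n => ⟨M.time.eval n, ?_, key n⟩, fun n => rfl⟩
  have hu : unaryEncodeNat n = List.replicate n true := by
    induction n with
    | zero => rfl
    | succ n ih => rw [unaryEncodeNat, ih, List.replicate_succ]
  have := M.outputsFun n
  rw [hu, List.map_replicate, List.length_replicate] at this
  exact ⟨this⟩

end ToyModel

end

/-! ### Polynomial bounds and elementary stack programs -/

noncomputable section

namespace ToyModel

open Computability Turing

/-! ### Polynomial bounds -/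

/-- The function is bounded by a polynomial. -/
def PolyBound (T : ℕ → ℕ) : Prop := ∃ P : Polynomial ℕ, ∀ n, T n ≤ P.eval n

theorem eval_mono (P : Polynomial ℕ) {m n : ℕ} (h : m ≤ n) : P.eval m ≤ P.eval n := by
  induction P using Polynomial.induction_on' with
  | add p q hp hq => simpa using add_le_add hp hq
  | monomial k a => simpa using Nat.mul_le_mul_left a (Nat.pow_le_pow_left h k)

namespace PolyBound

theorem eval (P : Polynomial ℕ) : PolyBound fun n => P.eval n := ⟨P, fun _ => le_rfl⟩

theorem const (c : ℕ) : PolyBound fun _ => c := ⟨Polynomial.C c, fun _ => by simp⟩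

theorem id : PolyBound fun n => n := ⟨Polynomial.X, fun _ => by simp⟩

theorem add {S T : ℕ → ℕ} (hS : PolyBound S) (hT : PolyBound T) : PolyBound fun n => S n + T n :=
  let ⟨P, hP⟩ := hS
  let ⟨Q, hQ⟩ := hT
  ⟨P + Q, fun n => by simpa using add_le_add (hP n) (hQ n)⟩

theorem mul {S T : ℕ → ℕ} (hS : PolyBound S) (hT : PolyBound T) : PolyBound fun n => S n * T n :=
  let ⟨P, hP⟩ := hS
  let ⟨Q, hQ⟩ := hT
  ⟨P * Q, fun n => by simpa using Nat.mul_le_mul (hP n) (hQ n)⟩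

theorem comp (P : Polynomial ℕ) {T : ℕ → ℕ} (hT : PolyBound T) : PolyBound fun n => P.eval (T n) :=
  let ⟨Q, hQ⟩ := hT
  ⟨P.comp Q, fun n => by simpa using eval_mono P (hQ n)⟩

end PolyBound

/-! ### Renaming of stacks, and runs with a time bound -/

section Prog

variable {ι ι' : Type}

/-- The program with stacks renamed. -/
def Prog.map (ρ : ι → ι') : Prog ι → Prog ι'
  | .skip => .skip
  | .push k a => .push (ρ k) a
  | .seq p q => .seq (p.map ρ) (q.map ρ)
  | .loop k b => .loop (ρ k) fun a => (b a).map ρ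
  | .cases k p b => .cases (ρ k) (p.map ρ) fun a => (b a).map ρ
  | .call i o => .call (ρ i) (ρ o)

variable [DecidableEq ι] [DecidableEq ι'] {O : Oracle}

theorem update_extend {ρ : ι → ι'} (hρ : Function.Injective ρ) (S : ι → List Sym)
    (T : ι' → List Sym) (k : ι) (l : List Sym) :
    Function.update (Function.extend ρ S T) (ρ k) l =
      Function.extend ρ (Function.update S k l) T := by
  funext j
  by_cases h : ∃ i, ρ i = j
  · obtain ⟨i, rfl⟩ := h
    rw [hρ.extend_apply]
    by_cases hi : i = k
    · subst hi; simp
    · rw [Function.update_of_ne (fun h => hi (hρ h)), Function.update_of_ne hi, hρ.extend_apply]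
  · rw [Function.extend_apply' _ _ _ h, Function.update_of_ne (fun h' => h ⟨k, h'.symm⟩),
      Function.extend_apply' _ _ _ h]

/-- A renamed program never touches a stack outside the range of `ρ`, so those stacks may hold
anything. This is what allows programs to be combined on disjoint blocks of stacks. -/
theorem Exec.map {ρ : ι → ι'} (hρ : Function.Injective ρ) {p : Prog ι} {S S' : ι → List Sym}
    {t : ℕ} (h : Exec O p S t S') (T : ι' → List Sym) :
    Exec O (p.map ρ) (Function.extend ρ S T) t (Function.extend ρ S' T) := by
  induction h with
  | skip S => exact .skip _
  | push k a S =>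
    rw [← update_extend hρ, ← hρ.extend_apply S T k]
    exact .push _ _ _
  | seq h h' ih ih' => exact .seq ih ih'
  | loopNil hS => exact .loopNil (by rwa [hρ.extend_apply])
  | loopCons hS h h' ih ih' =>
    exact .loopCons (by rwa [hρ.extend_apply]) (by rwa [update_extend hρ]) ih'
  | casesNil hS h ih => exact .casesNil (by rwa [hρ.extend_apply]) ih
  | casesCons hS h ih =>
    exact .casesCons (by rwa [hρ.extend_apply]) (by rwa [update_extend hρ])
  | call hS hS' =>
    exact .call (by rwa [hρ.extend_apply]) (by
      rw [hS', update_extend hρ, update_extend hρ, hρ.extend_apply])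

/-- The program takes the stacks `S` to `S'` in at most `c` steps. -/
def Runs (O : Oracle) (p : Prog ι) (S : ι → List Sym) (c : ℕ) (S' : ι → List Sym) : Prop :=
  ∃ t ≤ c, Exec O p S t S'

theorem Exec.runs {p : Prog ι} {S S' : ι → List Sym} {t : ℕ} (h : Exec O p S t S') :
    Runs O p S t S' := ⟨t, le_rfl, h⟩

theorem Runs.mono {p : Prog ι} {S S' : ι → List Sym} {c c' : ℕ} (h : Runs O p S c S')
    (hc : c ≤ c') : Runs O p S c' S' :=
  let ⟨t, ht, h⟩ := h
  ⟨t, ht.trans hc, h⟩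

theorem Runs.congr {p : Prog ι} {S S' S'' : ι → List Sym} {c c' : ℕ} (h : Runs O p S c S')
    (hc : c ≤ c') (hS : S' = S'') : Runs O p S c' S'' :=
  hS ▸ h.mono hc

theorem Runs.seq {p q : Prog ι} {S S' S'' : ι → List Sym} {c c' : ℕ} (h : Runs O p S c S')
    (h' : Runs O q S' c' S'') : Runs O (.seq p q) S (c + c') S'' :=
  let ⟨_, ht, h⟩ := h
  let ⟨_, ht', h'⟩ := h'
  ⟨_, add_le_add ht ht', .seq h h'⟩

theorem Runs.loopCons {k : ι} {b : Sym → Prog ι} {a : Sym} {l : List Sym} {S S' S'' : ι → List Sym}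
    {c c' : ℕ} (hS : S k = a :: l) (h : Runs O (b a) (Function.update S k l) c S')
    (h' : Runs O (.loop k b) S' c' S'') : Runs O (.loop k b) S (1 + c + c') S'' :=
  let ⟨_, ht, h⟩ := h
  let ⟨_, ht', h'⟩ := h'
  ⟨_, by omega, .loopCons hS h h'⟩

theorem Runs.map {ρ : ι → ι'} (hρ : Function.Injective ρ) {p : Prog ι} {S S' : ι → List Sym}
    {c : ℕ} (h : Runs O p S c S') {T T' : ι' → List Sym} (hS : ∀ i, T (ρ i) = S i)
    (hS' : ∀ i, T' (ρ i) = S' i) (hT : ∀ j, j ∉ Set.range ρ → T' j = T j) :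
    Runs O (p.map ρ) T c T' := by
  obtain ⟨t, ht, h⟩ := h
  have e1 : Function.extend ρ S T = T := by
    funext j
    by_cases hj : ∃ i, ρ i = j
    · obtain ⟨i, rfl⟩ := hj
      rw [hρ.extend_apply, hS]
    · rw [Function.extend_apply' _ _ _ hj]
  have e2 : Function.extend ρ S' T = T' := by
    funext j
    by_cases hj : ∃ i, ρ i = j
    · obtain ⟨i, rfl⟩ := hj
      rw [hρ.extend_apply, hS']
    · rw [Function.extend_apply' _ _ _ hj, hT j hj]
  have := h.map hρ T
  rw [e1, e2] at this
  exact ⟨t, ht, this⟩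

/-- The total length of the stacks grows by at most one per step. -/
theorem Exec.sum_length_le [Fintype ι] {p : Prog ι} {S S' : ι → List Sym} {t : ℕ}
    (h : Exec O p S t S') : ∑ i, (S' i).length ≤ ∑ i, (S i).length + t := by
  have hu : ∀ (S : ι → List Sym) k l, ∑ i, (Function.update S k l i).length + (S k).length =
      ∑ i, (S i).length + l.length := by
    intro S k l
    have h1 := Finset.add_sum_erase Finset.univ (fun i => (Function.update S k l i).length)
      (Finset.mem_univ k)
    have h2 := Finset.add_sum_erase Finset.univ (fun i => (S i).length) (Finset.mem_univ k)
    have h3 : ∑ i ∈ Finset.univ.erase k, (Function.update S k l i).length =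
        ∑ i ∈ Finset.univ.erase k, (S i).length :=
      Finset.sum_congr rfl fun i hi => by rw [Function.update_of_ne (Finset.ne_of_mem_erase hi)]
    simp only [Function.update_self] at h1
    omega
  induction h with
  | skip S => omega
  | push k a S =>
    have := hu S k (a :: S k)
    simp only [List.length_cons] at this
    omega
  | seq h h' ih ih' => omega
  | loopNil hS => omega
  | @loopCons k b a l S S' S'' t t' hS h h' ih ih' =>
    have := hu S k l
    rw [hS, List.length_cons] at this
    omega
  | casesNil hS h ih => omega
  | @casesCons k p b a l S S' t hS h ih =>
    have := hu S k l
    rw [hS, List.length_cons] at this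
    omega
  | @call i o n S S' hS hS' =>
    subst hS'
    have h1 := hu S i []
    have h2 := hu (Function.update S i []) o ((O.out n).reverse ++ Function.update S i [] o)
    have h3 := O.length_out_le n
    simp only [List.length_append, List.length_reverse, List.length_nil] at h1 h2
    omega

/-! ### Clearing, copying and writing stacks -/

/-- Clear the stacks in a list. -/
def Prog.clear : List ι → Prog ι
  | [] => .skip
  | k :: l => .seq (.loop k fun _ => .skip) (Prog.clear l)

theorem runs_clear_one (k : ι) (S : ι → List Sym) :
    Runs O (.loop k fun _ => .skip) S (2 * (S k).length + 1) (Function.update S k []) := by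
  generalize hl : S k = l
  induction l generalizing S with
  | nil =>
    have hu : Function.update S k [] = S := by rw [← hl]; exact Function.update_eq_self _ _
    rw [hu]
    exact (Exec.loopNil hl).runs
  | cons a l ih =>
    have := ih (Function.update S k l) (by simp)
    rw [Function.update_idem] at this
    exact (Runs.loopCons hl (Exec.skip _).runs this).mono (by simp; omega)

theorem runs_clear (l : List ι) (S S' : ι → List Sym) (h : ∀ i ∈ l, S' i = [])
    (h' : ∀ i, i ∉ l → S' i = S i) :
    Runs O (.clear l) S ((l.map fun i => 2 * (S i).length + 1).sum + 1) S' := by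
  induction l generalizing S with
  | nil =>
    have : S' = S := funext fun i => h' i (by simp)
    subst this
    exact (Exec.skip _).runs
  | cons k l ih =>
    have := ih (Function.update S k []) (fun i hi => h i (by simp [hi])) (fun i hi => by
      by_cases hk : i = k
      · subst hk; simp [h]
      · rw [Function.update_of_ne hk, h' i (by simp [hk, hi])])
    refine ((runs_clear_one k S).seq this).mono ?_
    have hle : (l.map fun i => 2 * (Function.update S k [] i).length + 1).sum ≤
        (l.map fun i => 2 * (S i).length + 1).sum := by
      apply List.sum_le_sum
      intro i _
      by_cases hk : i = k
      · subst hk; simp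
      · rw [Function.update_of_ne hk]
    simp only [List.map_cons, List.sum_cons]
    omega

/-- Copy the stack `i` onto the stack `j`, using the stack `t`. -/
def Prog.copy (t i j : ι) : Prog ι :=
  .seq (.loop i fun a => .push t a) (.loop t fun a => .seq (.push i a) (.push j a))

theorem runs_reverse (i t : ι) (hit : i ≠ t) (S : ι → List Sym) (h : Sym → Sym) :
    Runs O (.loop i fun a => .push t (h a)) S (2 * (S i).length + 1)
      (Function.update (Function.update S i []) t (((S i).map h).reverse ++ S t)) := by
  generalize hl : S i = l
  induction l generalizing S with
  | nil =>
    have hu : Function.update S i [] = S := by rw [← hl]; exact Function.update_eq_self _ _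
    rw [hu]
    have hu : Function.update S t ((List.map h []).reverse ++ S t) = S :=
      Function.update_eq_self _ _
    rw [hu]
    exact (Exec.loopNil hl).runs
  | cons a l ih =>
    have := ih (Function.update (Function.update S i l) t (h a :: Function.update S i l t)) (by
      rw [Function.update_of_ne hit]; simp)
    refine (Runs.loopCons hl (Exec.push t (h a) _).runs this).congr (by simp; omega) ?_
    funext j
    by_cases hj : j = t
    · subst hj; simp [hit.symm]
    · by_cases hji : j = i
      · subst hji; simp [hit]
      · simp [hj, hji]

/-- Emptying `i` onto the scratch stack reverses the word; emptying the scratch stack onto both `i`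
and `j` reverses it back. -/
theorem runs_copy (t i j : ι) (hit : i ≠ t) (hjt : j ≠ t) (hij : i ≠ j) (S : ι → List Sym)
    (ht : S t = []) :
    Runs O (.copy t i j) S (5 * (S i).length + 2) (Function.update S j (S i ++ S j)) := by
  have key : ∀ (l : List Sym) (S : ι → List Sym), S t = l →
      Runs O (.loop t fun a => .seq (.push i a) (.push j a)) S (3 * l.length + 1)
        (Function.update (Function.update (Function.update S t []) i (l.reverse ++ S i)) j
          (l.reverse ++ S j)) := by
    intro l
    induction l with
    | nil =>
      intro S hl
      refine (Exec.loopNil hl).runs.congr (by simp) ?_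
      funext k
      by_cases hkj : k = j
      · subst hkj; simp
      · by_cases hki : k = i
        · subst hki; simp [hkj]
        · by_cases hkt : k = t
          · subst hkt; simp [hkj, hki, hl]
          · simp [hkj, hki, hkt]
    | cons a l ih =>
      intro S hl
      refine (Runs.loopCons hl ((Exec.push _ _ _).runs.seq (Exec.push _ _ _).runs)
        (ih _ (by simp [hit.symm, hjt.symm]))).congr (by simp; omega) ?_
      funext k
      by_cases hkj : k = j
      · subst hkj; simp [hij.symm, hjt]
      · by_cases hki : k = i
        · subst hki; simp [hkj, hit]
        · by_cases hkt : k = t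
          · subst hkt; simp [hkj, hki]
          · simp [hkj, hki, hkt]
  refine ((runs_reverse i t hit S id).seq (key _ _ rfl)).congr ?_ ?_
  · simp [ht]; omega
  · funext k
    by_cases hkj : k = j
    · subst hkj; simp [hij.symm, hjt, ht]
    · by_cases hki : k = i
      · subst hki; simp [hkj, hit, ht]
      · by_cases hkt : k = t
        · subst hkt; simp [hkj, hki, ht]
        · simp [hkj, hki, hkt]

/-- Copy the stacks `s i` onto the stacks `d i`, for `i` in a list. -/
def Prog.copyAll (t : ι) {J : Type} (s d : J → ι) : List J → Prog ι
  | [] => .skip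
  | i :: l => .seq (.copy t (s i) (d i)) (Prog.copyAll t s d l)

theorem runs_copyAll (t : ι) {J : Type} (s d : J → ι) (hs : ∀ i, s i ≠ t) (hd : ∀ i, d i ≠ t)
    (hsd : ∀ i j, s i ≠ d j) (hdi : Function.Injective d) (l : List J) (hl : l.Nodup)
    (S S' : ι → List Sym) (ht : S t = []) (h : ∀ i ∈ l, S' (d i) = S (s i) ++ S (d i))
    (h' : ∀ j, (∀ i ∈ l, d i ≠ j) → S' j = S j) :
    Runs O (.copyAll t s d l) S ((l.map fun i => 5 * (S (s i)).length + 2).sum + 1) S' := by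
  induction l generalizing S with
  | nil =>
    have : S' = S := funext fun i => h' i (by simp)
    subst this
    exact (Exec.skip _).runs
  | cons k l ih =>
    rw [List.nodup_cons] at hl
    have := ih hl.2 (Function.update S (d k) (S (s k) ++ S (d k)))
      (by rw [Function.update_of_ne (hd k).symm, ht]) (fun i hi => by
        have hik : i ≠ k := fun h => hl.1 (h ▸ hi)
        rw [Function.update_of_ne (hsd i k), Function.update_of_ne (fun h => hik (hdi h)),
          h i (by simp [hi])]) (fun j hj => by
        by_cases hjk : j = d k
        · subst hjk
          simp [h]
        · rw [Function.update_of_ne hjk]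
          exact h' j (by simpa using ⟨Ne.symm hjk, hj⟩))
    refine ((runs_copy t (s k) (d k) (hs k) (hd k) (hsd k k) S ht).seq this).mono ?_
    simp only [Function.update_of_ne (hsd _ k), List.map_cons, List.sum_cons]
    omega

/-- Push a list onto a stack. -/
def Prog.write (k : ι) : List Sym → Prog ι
  | [] => .skip
  | a :: l => .seq (Prog.write k l) (.push k a)

theorem runs_write (k : ι) (l : List Sym) (S : ι → List Sym) :
    Runs O (.write k l) S (l.length + 1) (Function.update S k (l ++ S k)) := by
  induction l with
  | nil =>
    have hu : Function.update S k ([] ++ S k) = S := Function.update_eq_self _ _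
    rw [hu]
    exact (Exec.skip _).runs
  | cons a l ih =>
    exact (ih.seq (Exec.push k a _).runs).congr (by simp) (by simp)

/-- Push lists onto the stacks in a list. -/
def Prog.writeAll (v : ι → List Sym) : List ι → Prog ι
  | [] => .skip
  | k :: l => .seq (.write k (v k)) (Prog.writeAll v l)

theorem runs_writeAll (v : ι → List Sym) (l : List ι) (hl : l.Nodup) (S S' : ι → List Sym)
    (h : ∀ i ∈ l, S' i = v i ++ S i) (h' : ∀ i, i ∉ l → S' i = S i) :
    Runs O (.writeAll v l) S ((l.map fun i => (v i).length + 1).sum + 1) S' := by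
  induction l generalizing S with
  | nil =>
    have : S' = S := funext fun i => h' i (by simp)
    subst this
    exact (Exec.skip _).runs
  | cons k l ih =>
    rw [List.nodup_cons] at hl
    have := ih hl.2 (Function.update S k (v k ++ S k)) (fun i hi => by
        have hik : i ≠ k := fun h => hl.1 (h ▸ hi)
        rw [Function.update_of_ne hik, h i (by simp [hi])]) (fun i hi => by
      by_cases hk : i = k
      · subst hk; simp [h]
      · rw [Function.update_of_ne hk, h' i (by simp [hk, hi])])
    refine ((runs_write k _ S).seq this).mono ?_
    simp only [List.map_cons, List.sum_cons]
    omega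

end Prog

end ToyModel

end

noncomputable section

namespace ToyModel

open Computability Turing

/-! ### Polynomial-time functions between types of tuples of strings -/

/-- A type whose elements are represented by finitely many stacks. -/
class Reg (α : Type) where
  Index : Type
  [fintype : Fintype Index]
  [decEq : DecidableEq Index]
  encode : α → Index → List Sym

/-- The stacks that represent the elements of a type. -/
def Ix (α : Type) [Reg α] : Type := Reg.Index α

instance (α : Type) [Reg α] : Fintype (Ix α) := Reg.fintype

instance (α : Type) [Reg α] : DecidableEq (Ix α) := Reg.decEq

/-- The contents of the stacks that represent an element. -/
def enc {α : Type} [Reg α] (a : α) : Ix α → List Sym := Reg.encode a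

instance : Reg (List Sym) where
  Index := Unit
  encode l := fun _ => l

/-- Natural numbers are represented in unary. -/
instance : Reg ℕ where
  Index := Unit
  encode n := fun _ => List.replicate n (some true)

instance {α β : Type} [Reg α] [Reg β] : Reg (α × β) where
  Index := Ix α ⊕ Ix β
  encode x := Sum.elim (enc x.1) (enc x.2)

section PT

variable {α β γ δ : Type} [Reg α] [Reg β] [Reg γ] [Reg δ]

/-- The total length of the stacks that represent an element. -/
def size (a : α) : ℕ := ∑ i, (enc a i).length

@[simp] theorem size_list (l : List Sym) : size l = l.length := by
  change ∑ i : Unit, l.length = _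
  simp

@[simp] theorem size_nat (n : ℕ) : size n = n := by
  change ∑ i : Unit, (List.replicate n (some true)).length = _
  simp

@[simp] theorem size_prod (x : α × β) : size x = size x.1 + size x.2 :=
  Fintype.sum_sum_type _

/-- Stacks for input, output and scratch, with only the input present. -/
abbrev inStk (β κ : Type) [Reg β] (a : α) : Ix α ⊕ Ix β ⊕ κ → List Sym :=
  Sum.elim (enc a) (Sum.elim (fun _ => []) fun _ => [])

/-- Stacks for input, output and scratch, with only the output present. -/
abbrev outStk (α κ : Type) [Reg α] (b : β) : Ix α ⊕ Ix β ⊕ κ → List Sym :=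
  Sum.elim (fun _ => []) (Sum.elim (enc b) fun _ => [])

/-- The function is computed by a structured program in polynomial time, with the help of an
external function. -/
@[fun_prop]
def PT (O : Oracle) (f : α → β) : Prop :=
  ∃ (κ : Type) (_ : Fintype κ) (_ : DecidableEq κ) (p : Prog (Ix α ⊕ Ix β ⊕ κ))
    (P : Polynomial ℕ), ∀ a, Runs O p (inStk β κ a) (P.eval (size a)) (outStk α κ (f a))

variable {O : Oracle}

theorem PT.of_bound {f : α → β} {κ : Type} [Fintype κ] [DecidableEq κ]
    (p : Prog (Ix α ⊕ Ix β ⊕ κ)) {T : ℕ → ℕ} (hT : PolyBound T)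
    (h : ∀ a, Runs O p (inStk β κ a) (T (size a)) (outStk α κ (f a))) : PT O f := by
  obtain ⟨P, hP⟩ := hT
  exact ⟨κ, inferInstance, inferInstance, p, P, fun a => (h a).mono (hP _)⟩

/-- The output of a polynomial-time function has polynomial length. -/
theorem PT.size_le {f : α → β} (hf : PT O f) : ∃ P : Polynomial ℕ, ∀ a, size (f a) ≤ P.eval (size a) := by
  obtain ⟨κ, _, _, p, P, h⟩ := hf
  refine ⟨Polynomial.X + P, fun a => ?_⟩
  obtain ⟨t, ht, h⟩ := h a
  have := h.sum_length_le
  simp only [Fintype.sum_sum_type, Sum.elim_inl, Sum.elim_inr, List.length_nil,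
    Finset.sum_const_zero, add_zero, zero_add] at this
  simp only [Polynomial.eval_add, Polynomial.eval_X]
  exact this.trans (Nat.add_le_add_left ht _)

theorem sum_map_toList {ι : Type} [Fintype ι] (f : ι → ℕ) :
    ((Finset.univ : Finset ι).toList.map f).sum = ∑ i, f i := by
  rw [Finset.sum_map_toList]

/-- Copying an element. -/
theorem runs_copyAll_univ {ι : Type} [DecidableEq ι] (t : ι) (s d : Ix α → ι)
    (hs : ∀ i, s i ≠ t) (hd : ∀ i, d i ≠ t) (hsd : ∀ i j, s i ≠ d j) (hdi : Function.Injective d)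
    (S S' : ι → List Sym) (a : α) (ha : ∀ i, S (s i) = enc a i) (ht : S t = [])
    (h : ∀ i, S' (d i) = enc a i ++ S (d i)) (h' : ∀ j, (∀ i, d i ≠ j) → S' j = S j) :
    Runs O (.copyAll t s d Finset.univ.toList) S
      (5 * size a + 2 * Fintype.card (Ix α) + 1) S' := by
  have := runs_copyAll (O := O) t s d hs hd hsd hdi Finset.univ.toList (Finset.nodup_toList _) S S' ht
    (fun i _ => by rw [h, ha]) (fun j hj => h' j fun i => hj i (by simp))
  refine this.mono ?_
  rw [sum_map_toList]
  simp only [ha, size, Finset.sum_add_distrib, ← Finset.mul_sum, Finset.sum_const, Finset.card_univ,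
    smul_eq_mul]
  omega

/-- Clear the stacks in the range of a map. -/
def Prog.clearAll {ι : Type} (J : Type) [Fintype J] (s : J → ι) : Prog ι :=
  .clear (Finset.univ.toList.map s)

theorem runs_clearAll {ι : Type} [DecidableEq ι] (s : Ix α → ι)
    (S S' : ι → List Sym) (a : α) (ha : ∀ i, S (s i) = enc a i)
    (h : ∀ i, S' (s i) = []) (h' : ∀ j, (∀ i, s i ≠ j) → S' j = S j) :
    Runs O (.clearAll (Ix α) s) S (2 * size a + Fintype.card (Ix α) + 1) S' := by
  have := runs_clear (O := O) (Finset.univ.toList.map s) S S' (by simpa using h) (by simpa using h')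
  refine this.mono ?_
  rw [List.map_map, sum_map_toList]
  simp only [ha, size, Function.comp, Finset.sum_add_distrib, ← Finset.mul_sum, Finset.sum_const,
    Finset.card_univ, smul_eq_mul]
  omega

/-- The intermediate value lives on scratch stacks. The second program is polynomial in the size of
that value, which is polynomial in the size of `a` because a program lengthens its stacks by at most
one symbol per step. -/
theorem PT.comp {g : β → γ} {f : α → β} (hg : PT O g) (hf : PT O f) : PT O fun a => g (f a) := by
  obtain ⟨Q, hQ⟩ := hf.size_le
  obtain ⟨κ, _, _, p, P, h⟩ := hf
  obtain ⟨κ', _, _, p', P', h'⟩ := hg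
  let ρ : Ix α ⊕ Ix β ⊕ κ → Ix α ⊕ Ix γ ⊕ (Ix β ⊕ κ ⊕ κ') :=
    Sum.elim .inl (Sum.elim (fun i => .inr (.inr (.inl i))) fun i => .inr (.inr (.inr (.inl i))))
  let ρ' : Ix β ⊕ Ix γ ⊕ κ' → Ix α ⊕ Ix γ ⊕ (Ix β ⊕ κ ⊕ κ') :=
    Sum.elim (fun i => .inr (.inr (.inl i)))
      (Sum.elim (fun i => .inr (.inl i)) fun i => .inr (.inr (.inr (.inr i))))
  have hρ : Function.Injective ρ := by
    rintro (i | i | i) (j | j | j) hij <;> cases hij <;> rfl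
  have hρ' : Function.Injective ρ' := by
    rintro (i | i | i) (j | j | j) hij <;> cases hij <;> rfl
  refine PT.of_bound (.seq (p.map ρ) (p'.map ρ'))
    ((PolyBound.eval P).add (PolyBound.comp P' (PolyBound.eval Q))) fun a => ?_
  refine Runs.seq (S' := Sum.elim (fun _ => []) (Sum.elim (fun _ => [])
      (Sum.elim (enc (f a)) fun _ => []))) ((h a).map hρ ?_ ?_ ?_)
    (((h' (f a)).mono (eval_mono _ (hQ a))).map hρ' ?_ ?_ ?_)
  · rintro (i | i | i) <;> rfl
  · rintro (i | i | i) <;> rfl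
  · rintro (i | i | i | i | i) hi
    · exact (hi ⟨.inl i, rfl⟩).elim
    · rfl
    · exact (hi ⟨.inr (.inl i), rfl⟩).elim
    · exact (hi ⟨.inr (.inr i), rfl⟩).elim
    · rfl
  · rintro (i | i | i) <;> rfl
  · rintro (i | i | i) <;> rfl
  · rintro (i | i | i | i | i) hi
    · rfl
    · exact (hi ⟨.inr (.inl i), rfl⟩).elim
    · exact (hi ⟨.inl i, rfl⟩).elim
    · rfl
    · exact (hi ⟨.inr (.inr i), rfl⟩).elim

/-- Renaming of stacks, by an injection on each block. -/
theorem PT.prodMk {f : α → β} {g : α → γ} (hf : PT O f) (hg : PT O g) :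
    PT O fun a => (f a, g a) := by
  obtain ⟨κ, _, _, p, P, h⟩ := hf
  obtain ⟨κ', _, _, p', P', h'⟩ := hg
  let I := Ix α ⊕ (Ix β ⊕ Ix γ) ⊕ (κ ⊕ κ' ⊕ Ix α ⊕ Unit)
  let ρ : Ix α ⊕ Ix β ⊕ κ → I :=
    Sum.elim .inl (Sum.elim (fun i => .inr (.inl (.inl i))) fun i => .inr (.inr (.inl i)))
  let ρ' : Ix α ⊕ Ix γ ⊕ κ' → I :=
    Sum.elim (fun i => .inr (.inr (.inr (.inr (.inl i)))))
      (Sum.elim (fun i => .inr (.inl (.inr i))) fun i => .inr (.inr (.inr (.inl i))))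
  have hρ : Function.Injective ρ := by
    rintro (i | i | i) (j | j | j) hij <;> cases hij <;> rfl
  have hρ' : Function.Injective ρ' := by
    rintro (i | i | i) (j | j | j) hij <;> cases hij <;> rfl
  -- Programs consume their input, so a copy is made beforehand for the second component.
  refine PT.of_bound (.seq (.copyAll (.inr (.inr (.inr (.inr (.inr ()))))) .inl
    (fun i => .inr (.inr (.inr (.inr (.inl i))))) Finset.univ.toList)
      (.seq (p.map ρ) (p'.map ρ')))
    ((((PolyBound.const 5).mul PolyBound.id).add
      (PolyBound.const (2 * Fintype.card (Ix α) + 1))).add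
      ((PolyBound.eval P).add (PolyBound.eval P'))) fun a => ?_
  refine Runs.seq (S' := Sum.elim (enc a) (Sum.elim (fun _ => [])
      (Sum.elim (fun _ => []) (Sum.elim (fun _ => []) (Sum.elim (enc a) fun _ => [])))))
    ((runs_copyAll_univ _ _ _ (by simp) (by simp) (by simp) (fun i j => by simp) _ _ a ?_ ?_ ?_
      ?_).mono (by omega)) (Runs.seq (S' := Sum.elim (fun _ => []) (Sum.elim
        (Sum.elim (enc (f a)) fun _ => [])
      (Sum.elim (fun _ => []) (Sum.elim (fun _ => []) (Sum.elim (enc a) fun _ => [])))))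
        ((h a).map hρ ?_ ?_ ?_) ((h' a).map hρ' ?_ ?_ ?_))
  · intro i; rfl
  · rfl
  · intro i; simp
  · rintro (i | (i | i) | i | i | i | i) hi
    all_goals first | rfl | exact (hi _ rfl).elim
  · rintro (i | i | i) <;> rfl
  · rintro (i | i | i) <;> rfl
  · rintro (i | (i | i) | i | i | i | i) hi
    all_goals first | rfl | exact (hi ⟨.inl i, rfl⟩).elim | exact (hi ⟨.inr (.inl i), rfl⟩).elim |
      exact (hi ⟨.inr (.inr i), rfl⟩).elim
  · rintro (i | i | i) <;> rfl
  · rintro (i | i | i) <;> rfl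
  · rintro (i | (i | i) | i | i | i | i) hi
    all_goals first | rfl | exact (hi ⟨.inl i, rfl⟩).elim | exact (hi ⟨.inr (.inl i), rfl⟩).elim |
      exact (hi ⟨.inr (.inr i), rfl⟩).elim

/-- Selecting some of the stacks. -/
theorem PT.select (f : α → β) (e : Ix β → Ix α)
    (h : ∀ a i, enc (f a) i = enc a (e i)) : PT O f := by
  have hsize : ∀ a, size (f a) ≤ Fintype.card (Ix β) * size a := fun a => by
    unfold size
    rw [← smul_eq_mul, ← Finset.card_univ]
    refine Finset.sum_le_card_nsmul _ _ _ fun i _ => ?_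
    rw [h]
    exact Finset.single_le_sum (f := fun i => (enc a i).length) (fun _ _ => Nat.zero_le _)
      (Finset.mem_univ _)
  refine PT.of_bound (κ := Unit) (.seq (.copyAll (.inr (.inr ())) (fun i => .inl (e i))
    (fun i => .inr (.inl i)) Finset.univ.toList) (.clearAll (Ix α) .inl))
    (((PolyBound.const (5 * Fintype.card (Ix β))).mul PolyBound.id).add
      (PolyBound.const (2 * Fintype.card (Ix β) + 1)) |>.add
    (((PolyBound.const 2).mul PolyBound.id).add (PolyBound.const (Fintype.card (Ix α) + 1))))
    fun a => ?_
  refine Runs.seq (S' := Sum.elim (enc a) (Sum.elim (enc (f a)) fun _ => []))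
    ((runs_copyAll_univ _ _ _ (by simp) (by simp) (by simp) (fun i j => by simp) _ _ (f a) ?_ ?_ ?_
      ?_).mono ?_) ((runs_clearAll _ _ _ a ?_ ?_ ?_).mono (by omega))
  · intro i; exact (h a i).symm
  · rfl
  · intro i; simp
  · rintro (i | i | i) hi
    all_goals first | rfl | exact (hi _ rfl).elim
  · have := hsize a
    rw [mul_assoc]
    omega
  · intro i; rfl
  · intro i; rfl
  · rintro (i | i | i) hi
    all_goals first | rfl | exact (hi _ rfl).elim

@[fun_prop] theorem PT.id : PT O fun a : α => a := PT.select _ (fun i => i) fun _ _ => rfl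

theorem PT.fst' : PT O (Prod.fst : α × β → α) := PT.select _ .inl fun _ _ => rfl

theorem PT.snd' : PT O (Prod.snd : α × β → β) := PT.select _ .inr fun _ _ => rfl

@[fun_prop] theorem PT.fst {f : α → β × γ} (hf : PT O f) : PT O fun a => (f a).1 := PT.fst'.comp hf

@[fun_prop] theorem PT.snd {f : α → β × γ} (hf : PT O f) : PT O fun a => (f a).2 := PT.snd'.comp hf

attribute [fun_prop] PT.comp PT.prodMk

@[fun_prop] theorem PT.const (b : β) : PT O fun _ : α => b := by
  refine PT.of_bound (κ := Empty) (.seq (.clearAll (Ix α) .inl)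
    (.writeAll (Sum.elim (fun _ => []) (Sum.elim (enc b) fun _ => [])) Finset.univ.toList))
    ((((PolyBound.const 2).mul PolyBound.id).add (PolyBound.const (Fintype.card (Ix α) + 1))).add
      (PolyBound.const ((Finset.univ.toList.map fun i : Ix α ⊕ Ix β ⊕ Empty =>
        (Sum.elim (fun _ => []) (Sum.elim (enc b) fun _ => []) i : List Sym).length + 1).sum + 1)))
    fun a => ?_
  refine Runs.seq (S' := fun _ => []) ((runs_clearAll _ _ _ a ?_ ?_ ?_).mono (by omega))
    (runs_writeAll _ _ (Finset.nodup_toList _) _ _ ?_ ?_)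
  · intro i; rfl
  · intro i; rfl
  · rintro (i | i | i) hi
    all_goals first | rfl | exact (hi _ rfl).elim
  · intro i _; simp
  · intro i hi; simp at hi

/-- Pushing a symbol. -/
theorem PT.push {f g : α → β} (hf : PT O f) (k : Ix β) (s : Sym)
    (h : ∀ a, enc (g a) = Function.update (enc (f a)) k (s :: enc (f a) k)) :
    PT O g := by
  obtain ⟨κ, _, _, p, P, hp⟩ := hf
  refine PT.of_bound (.seq p (.push (.inr (.inl k)) s))
    ((PolyBound.eval P).add (PolyBound.const 1)) fun a => ?_
  refine (hp a).seq ((Exec.push _ _ _).runs.congr le_rfl ?_)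
  funext i
  rcases i with i | i | i
  · simp
  · simp only [Sum.elim_inr, Sum.elim_inl, h]
    by_cases hk : i = k
    · subst hk; simp
    · simp [hk]
  · simp

@[fun_prop] theorem PT.cons {f : α → List Sym} (s : Sym) (hf : PT O f) :
    PT O fun a => s :: f a :=
  hf.push () s fun _ => funext fun _ => rfl

@[fun_prop] theorem PT.succ {f : α → ℕ} (hf : PT O f) : PT O fun a => f a + 1 :=
  hf.push () (some true) fun _ => funext fun _ => rfl

/-- Mapping the symbols of a string, which is reversed. -/
theorem PT.reverse_map (h : Sym → Sym) (f : α → β) (e : Unique (Ix α)) (e' : Unique (Ix β))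
    (hf : ∀ a, enc (f a) default = ((enc a default).map h).reverse) : PT O f := by
  refine PT.of_bound (κ := Empty) (.loop (.inl default) fun a => .push (.inr (.inl default)) (h a))
    (((PolyBound.const 2).mul PolyBound.id).add (PolyBound.const 1)) fun a => ?_
  refine (runs_reverse (Sum.inl default : Ix α ⊕ Ix β ⊕ Empty) (Sum.inr (Sum.inl default))
    (by simp) _ h).congr ?_ ?_
  · simp [size]
  · funext i
    rcases i with i | i | i
    · rw [Subsingleton.elim i default, Function.update_of_ne (by simp), Function.update_self]
      rfl
    · rw [Subsingleton.elim i default, Function.update_self]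
      simp only [Sum.elim_inl, Sum.elim_inr, hf, List.append_nil]
    · exact i.elim

@[fun_prop] theorem PT.reverse {f : α → List Sym} (hf : PT O f) : PT O fun a => (f a).reverse :=
  PT.comp (g := List.reverse) (PT.reverse_map (fun s => s) _
    (inferInstanceAs (Unique Unit)) (inferInstanceAs (Unique Unit)) fun a => by simp [enc, Reg.encode]) hf

@[fun_prop] theorem PT.length {f : α → List Sym} (hf : PT O f) : PT O fun a => (f a).length :=
  PT.comp (g := List.length) (PT.reverse_map (fun _ => some true) _
    (inferInstanceAs (Unique Unit)) (inferInstanceAs (Unique Unit)) fun a => by simp [enc, Reg.encode]) hf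

@[fun_prop] theorem PT.replicate {f : α → ℕ} (s : Sym) (hf : PT O f) :
    PT O fun a => List.replicate (f a) s :=
  PT.comp (g := fun n => List.replicate n s) (PT.reverse_map (fun _ => s) _
    (inferInstanceAs (Unique Unit)) (inferInstanceAs (Unique Unit)) fun a => by simp [enc, Reg.encode]) hf

/-- Case distinction on a string. -/
def listCase {β : Type} (l : List Sym) (n : β) (c : Sym → List Sym → β) : β :=
  match l with
  | [] => n
  | s :: l => c s l

@[simp] theorem listCase_nil {β : Type} (n : β) (c : Sym → List Sym → β) : listCase [] n c = n := rfl

@[simp] theorem listCase_cons {β : Type} (s : Sym) (l : List Sym) (n : β) (c : Sym → List Sym → β) :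
    listCase (s :: l) n c = c s l := rfl

/-- Each branch receives its own scratch stacks. There are finitely many symbols, so the sum of the
time bounds of the branches is again a polynomial. -/
theorem PT.listCase_aux {n : α → β} {c : Sym → List Sym × α → β} (hn : PT O n)
    (hc : ∀ s, PT O (c s)) :
    PT O fun x : List Sym × α => listCase x.1 (n x.2) fun s l => c s (l, x.2) := by
  obtain ⟨κ, _, _, p, P, h⟩ := hn
  choose κ' _ _ p' P' h' using hc
  let I := (Unit ⊕ Ix α) ⊕ Ix β ⊕ (κ ⊕ Σ s, κ' s)
  let ρ : Ix α ⊕ Ix β ⊕ κ → I :=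
    Sum.elim (fun i => .inl (.inr i)) (Sum.elim (fun i => .inr (.inl i)) fun i => .inr (.inr (.inl i)))
  let ρ' (s : Sym) : (Unit ⊕ Ix α) ⊕ Ix β ⊕ κ' s → I :=
    Sum.elim .inl (Sum.elim (fun i => .inr (.inl i)) fun i => .inr (.inr (.inr ⟨s, i⟩)))
  have hρ : Function.Injective ρ := by
    rintro (i | i | i) (j | j | j) hij <;> cases hij <;> rfl
  have hρ' (s) : Function.Injective (ρ' s) := by
    rintro (i | i | i) (j | j | j) hij <;> cases hij <;> rfl
  have hb : PolyBound fun n => 1 + (P.eval n + ∑ s, (P' s).eval n) := by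
    refine (PolyBound.const 1).add ((PolyBound.eval P).add ⟨∑ s, P' s, fun n => ?_⟩)
    rw [Polynomial.eval_finsetSum]
  refine PT.of_bound (α := List Sym × α) (κ := κ ⊕ Σ s, κ' s)
    (.cases (.inl (.inl ())) (p.map ρ) fun s => (p' s).map (ρ' s)) hb ?_
  rintro ⟨l, a⟩
  cases l with
  | nil =>
    obtain ⟨t, ht, hex⟩ := (h a).map hρ
      (T := inStk β (κ ⊕ Σ s, κ' s) (([] : List Sym), a))
      (T' := outStk (List Sym × α) (κ ⊕ Σ s, κ' s) (n a)) (by rintro (i | i | i) <;> rfl)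
      (by rintro (i | i | i) <;> rfl) (by
        rintro ((i | i) | i | i | i) hi
        all_goals first | rfl | exact (hi ⟨.inl i, rfl⟩).elim |
          exact (hi ⟨.inr (.inl i), rfl⟩).elim | exact (hi ⟨.inr (.inr i), rfl⟩).elim)
    exact ⟨1 + t, by simp at ht ⊢; omega, .casesNil rfl hex⟩
  | cons s l =>
    obtain ⟨t, ht, hex⟩ := (h' s (l, a)).map (hρ' s)
      (T := Function.update (inStk β (κ ⊕ Σ s, κ' s) (s :: l, a)) (.inl (.inl ())) l)
      (T' := outStk (List Sym × α) (κ ⊕ Σ s, κ' s) (c s (l, a)))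
      (by rintro ((i | i) | i | i) <;> first | rfl | simp [ρ'])
      (by rintro ((i | i) | i | i) <;> rfl) (by
        rintro ((i | i) | i | i | i) hi
        all_goals first | rfl | exact (hi ⟨.inl (.inl i), rfl⟩).elim |
          exact (hi ⟨.inl (.inr i), rfl⟩).elim |
          exact (hi ⟨.inr (.inl i), rfl⟩).elim | exact (hi ⟨.inr (.inr i), rfl⟩).elim)
    refine ⟨1 + t, ?_, .casesCons rfl hex⟩
    have h1 : (P' s).eval (size (l, a)) ≤ ∑ s', (P' s').eval (size (s :: l, a)) := by
      refine (eval_mono (P' s) (by simp)).trans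
        (Finset.single_le_sum (f := fun s' => (P' s').eval (size (s :: l, a)))
          (fun _ _ => Nat.zero_le _) (Finset.mem_univ s))
    omega

@[fun_prop] theorem PT.listCase {l : α → List Sym} {n : α → β} {c : α → Sym → List Sym → β}
    (hl : PT O l) (hn : PT O n) (hc : ∀ s, PT O fun x : α × List Sym => c x.1 s x.2) :
    PT O fun a => listCase (l a) (n a) (c a) := by
  have h : ∀ s, PT O fun x : List Sym × α => c x.2 s x.1 := fun s => by
    have := hc s
    have h2 : PT O fun x : List Sym × α => (x.2, x.1) := by fun_prop
    exact PT.comp this h2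
  exact PT.comp (PT.listCase_aux hn h) (hl.prodMk PT.id)

/-- The external function. -/
theorem PT.oracle : PT O O.out := by
  -- A call leaves the output reversed; a further reversal restores it.
  have : PT O fun n => (O.out n).reverse := by
    refine PT.of_bound (κ := Empty) (.call (.inl ()) (.inr (.inl ()))) (PolyBound.eval O.time)
      fun n => ?_
    rw [size_nat]
    refine Exec.runs (.call (n := n) rfl ?_)
    funext i
    rcases i with i | i | i
    · rfl
    · exact (List.append_nil _).symm
    · exact i.elim
  simpa using this.reverse

/-- The stacks of an iteration. -/
abbrev IterStk (α β κ κ' : Type) [Reg α] [Reg β] : Type :=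
  Ix α ⊕ Ix β ⊕ (κ ⊕ κ' ⊕ (Unit ⊕ Ix β) ⊕ Ix β ⊕ Unit)

set_option synthInstance.maxSize 4000 in
set_option synthInstance.maxHeartbeats 400000 in
/-- Iteration, when the size of the intermediate values is polynomially bounded. -/
theorem PT.iterate {n : α → ℕ} {x : α → β} {f : β → β} (hn : PT O n) (hx : PT O x) (hf : PT O f)
    {T : ℕ → ℕ} (hT : PolyBound T) (hs : ∀ a, ∀ i ≤ n a, size (f^[i] (x a)) ≤ T (size a)) :
    PT O fun a => f^[n a] (x a) := by
  obtain ⟨Q, hQ⟩ := hT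
  obtain ⟨R, hR⟩ := hn.size_le
  obtain ⟨κ, _, _, p, P, h⟩ := hn.prodMk hx
  obtain ⟨κ', _, _, p', P', h'⟩ := hf
  let ρ : Ix α ⊕ (Unit ⊕ Ix β) ⊕ κ → IterStk α β κ κ' :=
    Sum.elim .inl (Sum.elim (fun i => .inr (.inr (.inr (.inr (.inl i)))))
      fun i => .inr (.inr (.inl i)))
  let ra : Ix β → IterStk α β κ κ' := fun i => .inr (.inr (.inr (.inr (.inl (.inr i)))))
  let rb : Ix β → IterStk α β κ κ' := fun i => .inr (.inr (.inr (.inr (.inr (.inl i)))))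
  let ρ' : Ix β ⊕ Ix β ⊕ κ' → IterStk α β κ κ' :=
    Sum.elim ra (Sum.elim rb fun i => .inr (.inr (.inr (.inl i))))
  have hρ : Function.Injective ρ := by
    rintro (i | i | i) (j | j | j) hij <;> cases hij <;> rfl
  have hρ' : Function.Injective ρ' := by
    rintro (i | i | i) (j | j | j) hij <;> cases hij <;> rfl
  let t : IterStk α β κ κ' := .inr (.inr (.inr (.inr (.inr (.inr ())))))
  let k : IterStk α β κ κ' := .inr (.inr (.inr (.inr (.inl (.inl ())))))
  let st (o : Ix β → List Sym) (m : ℕ) (u v : Ix β → List Sym) : IterStk α β κ κ' → List Sym :=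
    Sum.elim (fun _ => []) (Sum.elim o (Sum.elim (fun _ => []) (Sum.elim (fun _ => [])
      (Sum.elim (Sum.elim (fun _ => List.replicate m (some true)) u)
        (Sum.elim v fun _ => [])))))
  let Z : Ix β → List Sym := fun _ => []
  let c := Fintype.card (Ix β)
  have body : ∀ (b : β) (m : ℕ), Runs O (.seq (p'.map ρ') (.seq (.copyAll t rb ra Finset.univ.toList)
      (.clearAll (Ix β) rb))) (st Z m (enc b) Z) (P'.eval (size b) +
        ((5 * size (f b) + 2 * c + 1) + (2 * size (f b) + c + 1)))
        (st Z m (enc (f b)) Z) := by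
    intro b m
    refine Runs.seq (S' := st Z m Z (enc (f b))) ((h' b).map hρ' ?_ ?_ ?_)
      (Runs.seq (S' := st Z m (enc (f b)) (enc (f b)))
        (runs_copyAll_univ _ _ _ (by simp [rb, t]) (by simp [ra, t]) (by simp [ra, rb])
          (fun i j => by simp [ra]) _ _ (f b) ?_ ?_ ?_ ?_)
        (runs_clearAll _ _ _ (f b) ?_ ?_ ?_))
    · rintro (i | i | i) <;> rfl
    · rintro (i | i | i) <;> rfl
    · rintro (i | i | i | i | (i | i) | i | i) hi
      all_goals first | rfl | exact (hi ⟨.inl i, rfl⟩).elim |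
          exact (hi ⟨.inr (.inl i), rfl⟩).elim | exact (hi ⟨.inr (.inr i), rfl⟩).elim
    · intro i; rfl
    · rfl
    · intro i; simp [st, ra, Z]
    · rintro (i | i | i | i | (i | i) | i | i) hi
      all_goals first | rfl | exact (hi i rfl).elim
    · intro i; rfl
    · intro i; rfl
    · rintro (i | i | i | i | (i | i) | i | i) hi
      all_goals first | rfl | exact (hi i rfl).elim
  -- The counter `k` holds `m` in unary and loses one symbol per round. A uniform bound `C` on all
  -- intermediate sizes gives all rounds the same cost bound; without it, iterating a
  -- polynomial-time function could blow up exponentially.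
  have loop : ∀ (m : ℕ) (b : β) (C : ℕ), (∀ i ≤ m, size (f^[i] b) ≤ C) →
      Runs O (.loop k fun _ => .seq (p'.map ρ') (.seq (.copyAll t rb ra Finset.univ.toList)
        (.clearAll (Ix β) rb))) (st Z m (enc b) Z)
        (m * (P'.eval C + 7 * C + 3 * c + 3) + 1) (st Z 0 (enc (f^[m] b)) Z) := by
    intro m
    induction m with
    | zero =>
      intro b C _
      exact (Exec.loopNil rfl).runs.mono (by omega)
    | succ m ih =>
      intro b C hC
      have h1 := hC 0 (by omega)
      have h2 := hC 1 (by omega)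
      simp only [Function.iterate_zero, id_eq, Function.iterate_one] at h1 h2
      have h3 := eval_mono P' h1
      have h4 : Function.update (st Z (m + 1) (enc b) Z) k (List.replicate m (some true)) =
          st Z m (enc b) Z := by
        funext j
        rcases j with i | i | i | i | (i | i) | i | i <;> simp [st, k]
      refine (Runs.loopCons (l := List.replicate m (some true)) (a := some true)
        (c := P'.eval C + 7 * C + 3 * c + 2)
        (by simp [st, k, List.replicate_succ]) ?_
        (ih (f b) C fun i hi => by
          rw [← Function.iterate_succ_apply]; exact hC _ (by omega))).mono ?_
      · rw [h4]
        exact (body b m).mono (by omega)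
      · rw [add_mul]
        omega
  refine PT.of_bound (κ := κ ⊕ κ' ⊕ (Unit ⊕ Ix β) ⊕ Ix β ⊕ Unit) (.seq (p.map ρ) (.seq (.loop k fun _ => .seq (p'.map ρ')
    (.seq (.copyAll t rb ra Finset.univ.toList) (.clearAll (Ix β) rb)))
    (.seq (.copyAll t ra (fun i => .inr (.inl i)) Finset.univ.toList) (.clearAll (Ix β) ra))))
    (T := fun s => P.eval s + ((R.eval s * (P'.eval (Q.eval s) + 7 * Q.eval s + (3 * c + 3)) + 1) +
      ((5 * Q.eval s + (2 * c + 1)) + (2 * Q.eval s + (c + 1)))))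
    ((PolyBound.eval P).add ((((PolyBound.eval R).mul
      (((PolyBound.comp P' (PolyBound.eval Q)).add
        ((PolyBound.const 7).mul (PolyBound.eval Q))).add (PolyBound.const _))).add
          (PolyBound.const 1)).add
        ((((PolyBound.const 5).mul (PolyBound.eval Q)).add (PolyBound.const _)).add
          (((PolyBound.const 2).mul (PolyBound.eval Q)).add (PolyBound.const _))))) fun a => ?_
  have hs' : ∀ i ≤ n a, size (f^[i] (x a)) ≤ Q.eval (size a) := fun i hi =>
    (hs a i hi).trans (hQ _)
  have hfin := hs' (n a) le_rfl
  have hR' := hR a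
  rw [size_nat] at hR'
  refine Runs.seq (S' := st Z (n a) (enc (x a)) Z) ((h a).map hρ ?_ ?_ ?_)
    (Runs.seq (S' := st Z 0 (enc (f^[n a] (x a))) Z) ((loop (n a) (x a) _ hs').mono ?_)
    (Runs.seq (S' := st (enc (f^[n a] (x a))) 0 (enc (f^[n a] (x a))) Z)
        ((runs_copyAll_univ _ _ _ (by simp [ra, t]) (by simp [t]) (by simp [ra])
          (fun i j => by simp) _ _ (f^[n a] (x a)) ?_ ?_ ?_ ?_).mono (by omega))
        ((runs_clearAll _ _ _ (f^[n a] (x a)) ?_ ?_ ?_).mono (by omega))))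
  · rintro (i | (i | i) | i) <;> rfl
  · rintro (i | (i | i) | i) <;> rfl
  · rintro (i | i | i | i | (i | i) | i | i) hi
    all_goals first | rfl | exact (hi ⟨.inl i, rfl⟩).elim |
      exact (hi ⟨.inr (.inl (.inl i)), rfl⟩).elim |
      exact (hi ⟨.inr (.inl (.inr i)), rfl⟩).elim | exact (hi ⟨.inr (.inr i), rfl⟩).elim
  · exact Nat.add_le_add_right (Nat.mul_le_mul hR' (by omega)) 1
  · intro i; rfl
  · rfl
  · intro i; simp [st, Z]
  · rintro (i | i | i | i | (i | i) | i | i) hi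
    all_goals first | rfl | exact (hi i rfl).elim
  · intro i; rfl
  · intro i; rfl
  · rintro (i | i | i | i | (i | i) | i | i) hi
    all_goals first | rfl | exact (hi i rfl).elim

/-- Polynomial-time functions on strings are computed by Turing machines in polynomial time. -/
theorem PT.computable {M : TM2ComputableAux Bool Sym} (hO : Implements M O) {f : List Sym → List Sym}
    (hf : PT O f) {γ δ : Type} (ea : γ → List Sym) (eb : δ → List Sym) (g : γ → δ)
    (h : ∀ c, f (ea c) = eb (g c)) : Nonempty (TM2ComputableInPolyTime ea eb g) := by
  obtain ⟨κ, _, _, p, P, hp⟩ := hf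
  refine p.computable (ι := Unit ⊕ Unit ⊕ κ) hO ea eb g (.inl ()) (.inr (.inl ())) P fun c => ?_
  obtain ⟨t, ht, hex⟩ := hp (ea c)
  rw [size_list] at ht
  refine ⟨t, ht, ?_⟩
  have h1 : (Function.update (fun _ => []) (.inl ()) (ea c) : Unit ⊕ Unit ⊕ κ → List Sym) =
      inStk (List Sym) κ (ea c) := by
    funext i
    rcases i with i | i | i <;> rfl
  have h2 : (Function.update (fun _ => []) (.inr (.inl ())) (eb (g c)) :
      Unit ⊕ Unit ⊕ κ → List Sym) = outStk (List Sym) κ (f (ea c)) := by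
    rw [h]
    funext i
    rcases i with i | i | i <;> rfl
  rw [h1, h2]
  exact hex

end PT

end ToyModel

end

/-! ### Unary arithmetic, concatenation and conversion to binary -/

noncomputable section

namespace ToyModel

open Computability Turing

section Arith

variable {α β γ ρ : Type} [Reg α] [Reg β] [Reg γ] [Reg ρ] {O : Oracle}

/-! ### Arithmetic in unary -/

@[fun_prop] theorem PT.add {f g : α → ℕ} (hf : PT O f) (hg : PT O g) : PT O fun a => f a + g a := by
  obtain ⟨P, hP⟩ := hf.size_le
  obtain ⟨Q, hQ⟩ := hg.size_le
  have : PT O fun a => (fun n : ℕ => n + 1)^[g a] (f a) := by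
    refine PT.iterate hg hf (by fun_prop) ((PolyBound.eval P).add (PolyBound.eval Q)) fun a i hi => ?_
    have h1 := hP a
    have h2 := hQ a
    rw [size_nat] at h1 h2
    rw [size_nat, show (fun n : ℕ => n + 1) = Nat.succ from rfl, Nat.succ_iterate]
    omega
  refine (congrArg (PT O) (funext fun a => ?_)).mp this
  rw [show (fun n : ℕ => n + 1) = Nat.succ from rfl, Nat.succ_iterate]

@[fun_prop] theorem PT.mul {f g : α → ℕ} (hf : PT O f) (hg : PT O g) : PT O fun a => f a * g a := by
  obtain ⟨P, hP⟩ := hf.size_le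
  obtain ⟨Q, hQ⟩ := hg.size_le
  have key : ∀ k i : ℕ, (fun x : ℕ × ℕ => (x.1, x.2 + x.1))^[i] (k, 0) = (k, k * i) := by
    intro k i
    induction i with
    | zero => simp
    | succ i ih => rw [Function.iterate_succ_apply', ih, mul_add, mul_one]
  have : PT O fun a => ((fun x : ℕ × ℕ => (x.1, x.2 + x.1))^[g a] (f a, 0)).2 := by
    refine PT.snd (PT.iterate hg (by fun_prop) (by fun_prop) ((PolyBound.eval P).add
      ((PolyBound.eval P).mul (PolyBound.eval Q))) fun a i hi => ?_)
    have h1 := hP a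
    have h2 := hQ a
    rw [size_nat] at h1 h2
    rw [key, size_prod, size_nat, size_nat]
    exact add_le_add h1 (Nat.mul_le_mul h1 (hi.trans h2))
  simpa only [key] using this

@[fun_prop] theorem PT.pow {f : α → ℕ} (hf : PT O f) (k : ℕ) : PT O fun a => f a ^ k := by
  induction k with
  | zero => simpa using PT.const 1
  | succ k ih => simpa only [pow_succ] using ih.mul hf

@[fun_prop] theorem PT.polyEval {f : α → ℕ} (P : Polynomial ℕ) (hf : PT O f) :
    PT O fun a => P.eval (f a) := by
  induction P using Polynomial.induction_on' with
  | add p q hp hq => simpa using hp.add hq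
  | monomial k c => simpa using (PT.const c).mul (hf.pow k)

@[fun_prop] theorem PT.tail {f : α → List Sym} (hf : PT O f) : PT O fun a => (f a).tail := by
  have : PT O fun a => ToyModel.listCase (f a) ([] : List Sym) fun _ l => l := by fun_prop
  refine (congrArg (PT O) (funext fun a => ?_)).mp this
  cases f a <;> rfl

theorem PT.pred {f : α → ℕ} (hf : PT O f) : PT O fun a => f a - 1 := by
  have : PT O fun a => (List.replicate (f a) none : List Sym).tail.length := by fun_prop
  simpa using this

@[fun_prop] theorem PT.sub {f g : α → ℕ} (hf : PT O f) (hg : PT O g) : PT O fun a => f a - g a := by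
  obtain ⟨P, hP⟩ := hf.size_le
  have key : ∀ n i : ℕ, (fun n : ℕ => n - 1)^[i] n = n - i := by
    intro n i
    induction i with
    | zero => rfl
    | succ i ih => rw [Function.iterate_succ_apply', ih]; omega
  have : PT O fun a => (fun n : ℕ => n - 1)^[g a] (f a) := by
    refine PT.iterate hg hf (PT.pred PT.id) (PolyBound.eval P) fun a i hi => ?_
    have h1 := hP a
    rw [size_nat] at h1
    rw [key, size_nat]
    omega
  simpa only [key] using this

@[fun_prop] theorem PT.ifZero {n : α → ℕ} {x y : α → β} (hn : PT O n) (hx : PT O x) (hy : PT O y) :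
    PT O fun a => if n a = 0 then x a else y a := by
  have : PT O fun a => ToyModel.listCase (List.replicate (n a) (none : Sym)) (x a) fun _ _ => y a := by
    fun_prop
  refine (congrArg (PT O) (funext fun a => ?_)).mp this
  cases n a <;> simp [List.replicate_succ]

@[fun_prop] theorem PT.append {f g : α → List Sym} (hf : PT O f) (hg : PT O g) :
    PT O fun a => f a ++ g a := by
  obtain ⟨P, hP⟩ := hf.size_le
  obtain ⟨Q, hQ⟩ := hg.size_le
  let step : List Sym × List Sym → List Sym × List Sym := fun x =>
    ToyModel.listCase x.1 x fun s l => (l, s :: x.2)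
  have hstep : PT O step := by fun_prop
  have key : ∀ l m : List Sym, step^[l.length] (l, m) = ([], l.reverse ++ m) := by
    intro l
    induction l with
    | nil => intro m; rfl
    | cons s l ih =>
      intro m
      rw [List.length_cons, Function.iterate_succ_apply]
      simp [step, ih]
  have hsize : ∀ x, size (step x) = size x := by
    rintro ⟨l, m⟩
    cases l <;> simp [step]; omega
  have hsize' : ∀ i x, size (step^[i] x) = size x := by
    intro i x
    induction i with
    | zero => rfl
    | succ i ih => rw [Function.iterate_succ_apply', hsize, ih]
  have : PT O fun a => (step^[(f a).reverse.length] ((f a).reverse, g a)).2 := by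
    refine PT.snd (PT.iterate (by fun_prop) (by fun_prop) hstep
      ((PolyBound.eval P).add (PolyBound.eval Q)) fun a i hi => ?_)
    have h1 := hP a
    have h2 := hQ a
    rw [size_list] at h1 h2
    rw [hsize', size_prod, size_list, size_list, List.length_reverse]
    exact add_le_add h1 h2
  simpa only [key, List.reverse_reverse] using this

/-- The strings `h (next^[i] r)` for `i < n`, appended. -/
def accumulate (n : ℕ) (r : ρ) (next : ρ → ρ) (h : ρ → List Sym) : List Sym :=
  (List.range n).flatMap fun i => h (next^[i] r)

/-- A loop with output: the parameter, the current state and the string written so far are iterated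
together. The string grows by a polynomial amount per round, and there are polynomially many rounds
because `n a` is unary. -/
theorem PT.accumulate {n : α → ℕ} {e : α → γ} {r : α → ρ} {next : γ → ρ → ρ}
    {h : γ → ρ → List Sym} (hn : PT O n) (he : PT O e) (hr : PT O r)
    (hnext : PT O fun x : γ × ρ => next x.1 x.2) (hh : PT O fun x : γ × ρ => h x.1 x.2)
    {S : ℕ → ℕ} (hS : PolyBound S) (hb : ∀ a, ∀ i ≤ n a, size ((next (e a))^[i] (r a)) ≤ S (size a)) :
    PT O fun a => ToyModel.accumulate (n a) (r a) (next (e a)) (h (e a)) := by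
  obtain ⟨N, hN⟩ := hn.size_le
  obtain ⟨P, hP⟩ := he.size_le
  obtain ⟨Q, hQ⟩ := hh.size_le
  obtain ⟨S', hS'⟩ := hS
  let step : (γ × ρ) × List Sym → (γ × ρ) × List Sym := fun x =>
    ((x.1.1, next x.1.1 x.1.2), x.2 ++ h x.1.1 x.1.2)
  have hstep : PT O step := by
    have h1 : PT O fun x : (γ × ρ) × List Sym => next x.1.1 x.1.2 := PT.comp hnext PT.fst'
    have h2 : PT O fun x : (γ × ρ) × List Sym => h x.1.1 x.1.2 := PT.comp hh PT.fst'
    fun_prop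
  have key : ∀ e r i, step^[i] ((e, r), []) =
      ((e, (next e)^[i] r), ToyModel.accumulate i r (next e) (h e)) := by
    intro e r i
    induction i with
    | zero => rfl
    | succ i ih =>
      rw [Function.iterate_succ_apply', ih]
      simp only [step, ToyModel.accumulate, List.range_succ, List.flatMap_append,
        Function.iterate_succ_apply']
      simp
  have : PT O fun a => (step^[n a] ((e a, r a), [])).2 := by
    refine PT.snd (PT.iterate hn (by fun_prop) hstep
      (T := fun s => P.eval s + S'.eval s + N.eval s * Q.eval (P.eval s + S'.eval s))
      (((PolyBound.eval P).add (PolyBound.eval S')).add ((PolyBound.eval N).mul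
        (PolyBound.comp Q ((PolyBound.eval P).add (PolyBound.eval S'))))) fun a i hi => ?_)
    rw [key]
    simp only [size_prod]
    refine add_le_add (add_le_add (hP a) ((hb a i hi).trans (hS' _))) ?_
    have hN' := hN a
    rw [size_nat] at hN'
    have hlen : ∀ j ≤ i, (ToyModel.accumulate j (r a) (next (e a)) (h (e a))).length ≤
        j * Q.eval (P.eval (size a) + S'.eval (size a)) := by
      intro j
      induction j with
      | zero => intro _; simp [ToyModel.accumulate]
      | succ j ih =>
        intro hj
        have h1 := ih (by omega)
        have h2 := hQ (e a, (next (e a))^[j] (r a))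
        rw [size_list, size_prod] at h2
        have h3 := h2.trans (eval_mono Q (add_le_add (hP a) ((hb a j (by omega)).trans (hS' _))))
        simp only [ToyModel.accumulate, List.range_succ, List.flatMap_append, List.length_append] at h1 ⊢
        rw [add_mul]
        refine add_le_add h1 ?_
        simpa using h3
    rw [size_list]
    exact (hlen i le_rfl).trans (Nat.mul_le_mul_right _ (hi.trans hN'))
  simpa only [key] using this

/-! ### Conversion from unary to binary -/

/-- The quotient and the remainder of a division by two. -/
def halve (n : ℕ) : ℕ × ℕ :=
  (fun x : ℕ × ℕ => if x.2 = 0 then (x.1, 1) else (x.1 + 1, 0))^[n] (0, 0)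

theorem halve_eq (n : ℕ) : halve n = (n / 2, n % 2) := by
  induction n with
  | zero => rfl
  | succ n ih =>
    unfold halve at ih ⊢
    rw [Function.iterate_succ_apply', ih]
    rcases Nat.mod_two_eq_zero_or_one n with h | h
    · simp only [h, if_true]; ext <;> simp only <;> omega
    · simp only [h]; ext <;> simp <;> omega

theorem PT.halve : PT O ToyModel.halve := by
  unfold ToyModel.halve
  refine PT.iterate (by fun_prop) (by fun_prop) (by fun_prop)
    (PolyBound.id.add (PolyBound.const 1)) fun n i hi => ?_
  have := halve_eq i
  unfold ToyModel.halve at this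
  rw [this, size_prod, size_nat, size_nat, size_nat]
  dsimp only
  omega

/-- `encodeNat` is defined by recursion on `PosNum`; this is the recursion by halving that the
conversion program follows. -/
theorem encodeNat_bit (n : ℕ) (hn : n ≠ 0) :
    encodeNat n = decide (n % 2 = 1) :: encodeNat (n / 2) := by
  obtain ⟨m, hm⟩ : ∃ m : Num, (m : ℕ) = n := ⟨n, by simp⟩
  subst hm
  unfold encodeNat
  have h2 : ∀ m : PosNum, ((m : ℕ) : Num) = Num.pos m := fun m => by
    rw [← Num.cast_pos, Num.of_to_nat]
  cases m with
  | zero => simp at hn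
  | pos m =>
    cases m with
    | one => rfl
    | bit0 m =>
      have e : ((Num.pos (PosNum.bit0 m) : Num) : ℕ) = 2 * (m : ℕ) := by
        simp [PosNum.cast_bit0]; ring
      have e2 : ((Num.pos (PosNum.bit0 m) : Num) : ℕ) / 2 = (m : ℕ) := by rw [e]; omega
      rw [e2, h2]
      have e3 : ((((Num.pos (PosNum.bit0 m) : Num) : ℕ)) : Num) = Num.pos (PosNum.bit0 m) :=
        Num.of_to_nat _
      rw [e3]
      simp [encodeNum, encodePosNum, e]
    | bit1 m =>
      have e : ((Num.pos (PosNum.bit1 m) : Num) : ℕ) = 2 * (m : ℕ) + 1 := by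
        simp [PosNum.cast_bit1]; ring
      have e2 : ((Num.pos (PosNum.bit1 m) : Num) : ℕ) / 2 = (m : ℕ) := by rw [e]; omega
      rw [e2, h2]
      have e3 : ((((Num.pos (PosNum.bit1 m) : Num) : ℕ)) : Num) = Num.pos (PosNum.bit1 m) :=
        Num.of_to_nat _
      rw [e3]
      simp [encodeNum, encodePosNum, e]

/-- The binary digits of a number, as symbols. -/
def binary (n : ℕ) : List Sym := (encodeNat n).map some

@[fun_prop] theorem PT.binary {f : α → ℕ} (hf : PT O f) : PT O fun a => ToyModel.binary (f a) := by
  refine PT.comp (g := ToyModel.binary) ?_ hf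
  let step : ℕ × List Sym → ℕ × List Sym := fun x =>
    if x.1 = 0 then x else ((ToyModel.halve x.1).1, if (ToyModel.halve x.1).2 = 0 then some false :: x.2
      else some true :: x.2)
  have hstep : PT O step := by
    have h : PT O fun x : ℕ × List Sym => ToyModel.halve x.1 := PT.comp PT.halve PT.fst'
    fun_prop
  -- Once the number is zero the state is fixed, so superfluous rounds are harmless and `n` rounds
  -- always suffice.
  have key : ∀ n k, n ≤ k → ∀ l, step^[k] (n, l) = (0, (ToyModel.binary n).reverse ++ l) := by
    intro n
    induction n using Nat.strong_induction_on with
    | _ n ih =>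
      intro k hk l
      by_cases hn : n = 0
      · subst hn
        exact Function.iterate_fixed (by simp [step]) k
      · obtain ⟨k, rfl⟩ : ∃ j, k = j + 1 := ⟨k - 1, by omega⟩
        rw [Function.iterate_succ_apply]
        have hs : step (n, l) = (n / 2, some (decide (n % 2 = 1)) :: l) := by
          simp only [step, halve_eq, if_neg hn]
          rcases Nat.mod_two_eq_zero_or_one n with h | h <;> simp [h]
        rw [hs, ih _ (by omega) k (by omega)]
        simp [ToyModel.binary, encodeNat_bit n hn]
  have hsize : ∀ x, size (step x) ≤ size x := by
    rintro ⟨n, l⟩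
    by_cases hn : n = 0
    · simp [step, hn]
    · simp only [step, halve_eq, if_neg hn]
      split_ifs <;> simp <;> omega
  have hsize' : ∀ i x, size (step^[i] x) ≤ size x := by
    intro i x
    induction i with
    | zero => exact le_rfl
    | succ i ih => rw [Function.iterate_succ_apply']; exact (hsize _).trans ih
  have : PT O fun n : ℕ => (step^[n] (n, [])).2.reverse := by
    refine PT.reverse (PT.snd (PT.iterate (by fun_prop) (by fun_prop) hstep PolyBound.id
      fun n i hi => (hsize' i _).trans ?_))
    simp
  refine (congrArg (PT O) (funext fun n => ?_)).mp this
  rw [key n n le_rfl]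
  simp

end Arith

end ToyModel

end

/-! ### Binary subtraction, division with a bounded quotient, and parsing -/

noncomputable section

namespace ToyModel

open Computability Turing

section Strings

variable {α β : Type} [Reg α] [Reg β] {O : Oracle}

theorem size_iterate_le {f : β → β} (h : ∀ x, size (f x) ≤ size x) (i : ℕ) (x : β) :
    size (f^[i] x) ≤ size x := by
  induction i with
  | zero => exact le_rfl
  | succ i ih => rw [Function.iterate_succ_apply']; exact (h _).trans ih

/-! ### Arithmetic in binary -/

/-- Whether a symbol is the digit one. -/
def isOne (s : Sym) : Bool := decide (s = some true)

/-- The number with the given binary digits, least significant digit first. -/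
def val : List Sym → ℕ
  | [] => 0
  | s :: l => (isOne s).toNat + 2 * val l

@[simp] theorem val_nil : val [] = 0 := rfl

@[simp] theorem val_cons (s : Sym) (l : List Sym) : val (s :: l) = (isOne s).toNat + 2 * val l := rfl

theorem val_append (l m : List Sym) : val (l ++ m) = val l + 2 ^ l.length * val m := by
  induction l with
  | nil => simp
  | cons s l ih => simp only [List.cons_append, val_cons, ih, List.length_cons, pow_succ]; ring

theorem val_lt (l : List Sym) : val l < 2 ^ l.length := by
  induction l with
  | nil => simp
  | cons s l ih =>
    have := Bool.toNat_le (isOne s)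
    simp only [val_cons, List.length_cons, pow_succ]
    omega

@[simp] theorem val_replicate_false (n : ℕ) : val (List.replicate n (some false)) = 0 := by
  induction n with
  | zero => rfl
  | succ n ih => simp [List.replicate_succ, ih, isOne]

theorem val_binary (n : ℕ) : val (binary n) = n := by
  induction n using Nat.strong_induction_on with
  | _ n ih =>
    by_cases hn : n = 0
    · subst hn; rfl
    · have := ih (n / 2) (by omega)
      unfold binary at this ⊢
      rw [encodeNat_bit n hn, List.map_cons, val_cons, this]
      rcases Nat.mod_two_eq_zero_or_one n with h | h <;> simp [isOne, h] <;> omega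

theorem lt_two_pow_length_binary (n : ℕ) : n < 2 ^ (binary n).length := by
  simpa only [val_binary] using val_lt (binary n)

/-- Together with `lt_two_pow_length_binary` this yields a power of two that exceeds `n` and is at
most `2 * n + 1`. The precision of the reduction is chosen in this way, since scaling by a power of
two only shifts binary digits. -/
theorem two_pow_length_binary_le (n : ℕ) : 2 ^ (binary n).length ≤ 2 * n + 1 := by
  induction n using Nat.strong_induction_on with
  | _ n ih =>
    by_cases hn : n = 0
    · subst hn; exact le_rfl
    · have := ih (n / 2) (by omega)
      unfold binary at this ⊢
      rw [encodeNat_bit n hn, List.map_cons, List.length_cons, pow_succ]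
      by_cases h : n / 2 = 0
      · rw [h]
        have : (encodeNat 0).map some = ([] : List Sym) := rfl
        rw [this]
        simp; omega
      · obtain ⟨k, hk⟩ : ∃ k, 2 ^ (List.map some (encodeNat (n / 2)) : List Sym).length = 2 * k := by
          rw [encodeNat_bit _ h, List.map_cons, List.length_cons, pow_succ]
          exact ⟨_, mul_comm _ _⟩
        omega

-- Repeated doubling is harmless in unary here because the exponent is logarithmic in `f a`.
@[fun_prop] theorem PT.twoPow {f : α → ℕ} (hf : PT O f) : PT O fun a => 2 ^ (ToyModel.binary (f a)).length := by
  obtain ⟨P, hP⟩ := hf.size_le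
  have key : ∀ i : ℕ, (fun n : ℕ => n + n)^[i] 1 = 2 ^ i := by
    intro i
    induction i with
    | zero => rfl
    | succ i ih => rw [Function.iterate_succ_apply', ih, pow_succ]; ring
  have : PT O fun a => (fun n : ℕ => n + n)^[(ToyModel.binary (f a)).length] 1 := by
    refine PT.iterate (by fun_prop) (by fun_prop) (by fun_prop)
      (((PolyBound.const 2).mul (PolyBound.eval P)).add (PolyBound.const 1)) fun a i hi => ?_
    have h := hP a
    rw [size_nat] at h
    rw [key, size_nat]
    have h1 := (Nat.pow_le_pow_right two_pos hi).trans (two_pow_length_binary_le (f a))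
    omega
  simpa only [key] using this

/-- The state of a subtraction: the remaining digits, the borrow, and the digits of the result. -/
abbrev SubState : Type := (List Sym × List Sym) × (ℕ × List Sym)

/-- Subtraction of two digits. -/
def subDigit (d d' : Bool) (x y : List Sym) (z : ℕ × List Sym) : SubState :=
  ((x, y), (if z.1 = 0 then (!d && d').toNat else (!d || d').toNat,
    if z.1 = 0 then some (xor d d') :: z.2 else some (!xor d d') :: z.2))

/-- A step of a subtraction. -/
def subStep (s : SubState) : SubState :=
  listCase s.1.1 (listCase s.1.2 s fun d y => subDigit false (isOne d) [] y s.2)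
    fun d x => listCase s.1.2 (subDigit (isOne d) false x [] s.2)
      fun d' y => subDigit (isOne d) (isOne d') x y s.2

theorem PT.subDigit (d d' : Bool) {x y : α → List Sym} {z : α → ℕ × List Sym} (hx : PT O x)
    (hy : PT O y) (hz : PT O z) : PT O fun a => subDigit d d' (x a) (y a) (z a) := by
  unfold ToyModel.subDigit
  fun_prop

theorem PT.subStep : PT O subStep := by
  unfold ToyModel.subStep
  refine PT.listCase (by fun_prop) (PT.listCase (by fun_prop) (by fun_prop) fun d => ?_) fun d =>
    PT.listCase (by fun_prop) ?_ fun d' => ?_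
  all_goals exact PT.subDigit _ _ (by fun_prop) (by fun_prop) (by fun_prop)

/-- The difference that remains to be computed. -/
def subInv (s : SubState) : ℤ :=
  val s.2.2.reverse + 2 ^ s.2.2.length * ((val s.1.1 : ℤ) - val s.1.2 - s.2.1)

theorem subInv_subDigit (d d' : Bool) (x y acc : List Sym) (b : ℕ) (hb : b ≤ 1) :
    subInv (subDigit d d' x y (b, acc)) = val acc.reverse + 2 ^ acc.length *
      (((d.toNat + 2 * val x : ℕ) : ℤ) - (d'.toNat + 2 * val y : ℕ) - b) ∧
      (subDigit d d' x y (b, acc)).2.1 ≤ 1 := by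
  interval_cases b <;> cases d <;> cases d' <;>
    simp [subInv, subDigit, val_append, isOne, pow_succ] <;> ring

/-- The loop invariant of schoolbook subtraction: the digits already produced, plus the shifted
difference of the remaining words minus the borrow. A word that has run out is read as zeros, so the
rounds needed are governed by the longer word. -/
theorem subStep_spec (s : SubState) (hb : s.2.1 ≤ 1) :
    subInv (subStep s) = subInv s ∧ (subStep s).2.1 ≤ 1 ∧
      max (subStep s).1.1.length (subStep s).1.2.length = max s.1.1.length s.1.2.length - 1 ∧
      max (subStep s).1.1.length (subStep s).1.2.length + (subStep s).2.2.length =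
        max s.1.1.length s.1.2.length + s.2.2.length := by
  obtain ⟨⟨x, y⟩, ⟨b, acc⟩⟩ := s
  have hl : ∀ d d' x y, (subDigit d d' x y (b, acc)).2.2.length = acc.length + 1 := by
    intro d d' x y
    simp only [subDigit]
    split_ifs <;> rfl
  have hx : ∀ d d' x y, (subDigit d d' x y (b, acc)).1 = (x, y) := fun _ _ _ _ => rfl
  dsimp only at hb
  cases x with
  | nil =>
    cases y with
    | nil => simp [subStep, hb]
    | cons d' y =>
      simp only [subStep, listCase_nil, listCase_cons, subInv_subDigit _ _ _ _ _ _ hb, hl, hx]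
      simp [subInv]; omega
  | cons d x =>
    cases y with
    | nil =>
      simp only [subStep, listCase_nil, listCase_cons, subInv_subDigit _ _ _ _ _ _ hb, hl, hx]
      simp [subInv]; omega
    | cons d' y =>
      simp only [subStep, listCase_nil, listCase_cons, subInv_subDigit _ _ _ _ _ _ hb, hl, hx]
      simp [subInv]; omega

theorem subStep_iterate_spec (x y : List Sym) (i : ℕ) :
    let s := subStep^[i] ((x, y), (0, []))
    subInv s = (val x : ℤ) - val y ∧ s.2.1 ≤ 1 ∧
      max s.1.1.length s.1.2.length = max x.length y.length - i ∧
      max s.1.1.length s.1.2.length + s.2.2.length = max x.length y.length := by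
  induction i with
  | zero => simp [subInv]
  | succ i ih =>
    obtain ⟨h1, h2, h3, h4⟩ := ih
    obtain ⟨h5, h6, h7, h8⟩ := subStep_spec _ h2
    simp only [Function.iterate_succ_apply']
    exact ⟨h5.trans h1, h6, by omega, by omega⟩

/-- The borrow and the digits of the difference. -/
def subtract (x y : List Sym) : ℕ × List Sym :=
  let s := subStep^[x.length + y.length] ((x, y), (0, []))
  (s.2.1, s.2.2.reverse)

/-- When both words are exhausted, the invariant says that the value of the result minus the borrow
times $2^\ell$ is the true difference, where $\ell$ is the length of the result. The result is below
$2^\ell$, so the borrow decides the comparison. -/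
theorem subtract_spec (x y : List Sym) : (subtract x y).2.length = max x.length y.length ∧
    ((subtract x y).1 = 0 ↔ val y ≤ val x) ∧
    (val y ≤ val x → val (subtract x y).2 = val x - val y) := by
  obtain ⟨h1, h2, h3, h4⟩ := subStep_iterate_spec x y (x.length + y.length)
  unfold subtract
  set s := subStep^[x.length + y.length] ((x, y), (0, []))
  have e1 : s.1.1 = [] := List.length_eq_zero_iff.mp (by omega)
  have e2 : s.1.2 = [] := List.length_eq_zero_iff.mp (by omega)
  simp only [e1, e2, subInv, val_nil, List.length_nil, max_self] at h1 h4
  have hlt := val_lt s.2.2.reverse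
  rw [List.length_reverse] at hlt
  have hlt' : (val s.2.2.reverse : ℤ) < 2 ^ s.2.2.length := by exact_mod_cast hlt
  refine ⟨by simp only [List.length_reverse]; omega, ?_⟩
  dsimp only
  generalize s.2.1 = b at *
  interval_cases b
  · simp only [Nat.cast_zero, sub_self, mul_zero, add_zero] at h1
    omega
  · simp only [Nat.cast_zero, Nat.cast_one, sub_self, zero_sub, mul_neg, mul_one] at h1
    omega

theorem PT.subtract {f g : α → List Sym} (hf : PT O f) (hg : PT O g) :
    PT O fun a => ToyModel.subtract (f a) (g a) := by
  obtain ⟨P, hP⟩ := hf.size_le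
  obtain ⟨Q, hQ⟩ := hg.size_le
  have : PT O fun a => ToyModel.subStep^[(f a).length + (g a).length] ((f a, g a), (0, [])) := by
    refine PT.iterate (by fun_prop) (by fun_prop) PT.subStep
      ((((PolyBound.const 3).mul (PolyBound.eval P)).add
      ((PolyBound.const 3).mul (PolyBound.eval Q))).add (PolyBound.const 1)) fun a i hi => ?_
    obtain ⟨h1, h2, h3, h4⟩ := subStep_iterate_spec (f a) (g a) i
    have h5 := hP a
    have h6 := hQ a
    rw [size_list] at h5 h6
    simp only [size_prod, size_list, size_nat]
    omega
  unfold ToyModel.subtract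
  fun_prop

/-- A step of a division by repeated subtraction. -/
def divStep (s : List Sym × (List Sym × ℕ)) : List Sym × (List Sym × ℕ) :=
  (s.1, if (subtract s.2.1 s.1).1 = 0 then ((subtract s.2.1 s.1).2, s.2.2 + 1) else s.2)

/-- The minimum of `B` and the quotient of `x` and `y`. -/
def quot (B : ℕ) (x y : List Sym) : ℕ := (divStep^[B] (y, (x, 0))).2.2

/-- Each round keeps remainder plus quotient times divisor equal to `val x`, and the quotient stops
growing once the remainder is smaller than the divisor. Repeated subtraction is affordable because
only `i` rounds are made, however large the true quotient. -/
theorem divStep_iterate_spec (x y : List Sym) (hy : 0 < val y) (i : ℕ) :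
    (divStep^[i] (y, (x, 0))).1 = y ∧
    (divStep^[i] (y, (x, 0))).2.1.length ≤ max x.length y.length ∧
    (divStep^[i] (y, (x, 0))).2.2 = min i (val x / val y) ∧
    val (divStep^[i] (y, (x, 0))).2.1 + min i (val x / val y) * val y = val x := by
  induction i with
  | zero => simp
  | succ i ih =>
    obtain ⟨h1, h2, h3, h4⟩ := ih
    rw [Function.iterate_succ_apply']
    generalize divStep^[i] (y, (x, 0)) = s at *
    obtain ⟨y', x', q⟩ := s
    dsimp only at h1 h2 h3 h4
    subst h1
    obtain ⟨e1, e2, e3⟩ := subtract_spec x' y'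
    simp only [divStep, e2]
    split_ifs with h
    · have h5 : min i (val x / val y') + 1 = min (i + 1) (val x / val y') := by
        have : min i (val x / val y') + 1 ≤ val x / val y' := by
          rw [Nat.le_div_iff_mul_le hy, add_mul]; omega
        omega
      refine ⟨trivial, by dsimp only; omega, by dsimp only; omega, ?_⟩
      dsimp only
      rw [e3 h, ← h5, add_mul]
      omega
    · have h5 : min (i + 1) (val x / val y') = min i (val x / val y') := by
        by_contra h6
        have : i < val x / val y' := by omega
        have h7 : i + 1 ≤ val x / val y' := this
        rw [Nat.le_div_iff_mul_le hy, add_mul] at h7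
        rw [min_eq_left this.le] at h4
        omega
      rw [h5]
      exact ⟨trivial, h2, h3, h4⟩

theorem quot_eq (B : ℕ) (x y : List Sym) (hy : 0 < val y) : quot B x y = min B (val x / val y) :=
  (divStep_iterate_spec x y hy B).2.2.1

/-- The divisor is not assumed positive here: the time bound has to hold on all strings, including
those that encode no fraction. -/
theorem divStep_iterate_size (x y : List Sym) (i : ℕ) :
    (divStep^[i] (y, (x, 0))).1 = y ∧
    (divStep^[i] (y, (x, 0))).2.1.length ≤ max x.length y.length ∧
    (divStep^[i] (y, (x, 0))).2.2 ≤ i := by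
  induction i with
  | zero => simp
  | succ i ih =>
    obtain ⟨h1, h2, h3⟩ := ih
    rw [Function.iterate_succ_apply']
    generalize divStep^[i] (y, (x, 0)) = s at *
    obtain ⟨y', x', q⟩ := s
    dsimp only at h1 h2 h3
    subst h1
    have := (subtract_spec x' y').1
    simp only [divStep]
    split_ifs
    · exact ⟨trivial, by dsimp only; omega, by dsimp only; omega⟩
    · exact ⟨trivial, h2, by dsimp only; omega⟩

@[fun_prop] theorem PT.quot {n : α → ℕ} {f g : α → List Sym} (hn : PT O n) (hf : PT O f) (hg : PT O g) :
    PT O fun a => quot (n a) (f a) (g a) := by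
  obtain ⟨R, hR⟩ := hn.size_le
  obtain ⟨P, hP⟩ := hf.size_le
  obtain ⟨Q, hQ⟩ := hg.size_le
  have hstep : PT O divStep := by
    have h : PT O fun s : List Sym × (List Sym × ℕ) => ToyModel.subtract s.2.1 s.1 :=
      PT.subtract (by fun_prop) (by fun_prop)
    unfold divStep
    fun_prop
  have : PT O fun a => divStep^[n a] (g a, (f a, 0)) := by
    refine PT.iterate hn (by fun_prop) hstep
      (((PolyBound.eval P).add ((PolyBound.const 2).mul (PolyBound.eval Q))).add (PolyBound.eval R))
      fun a i hi => ?_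
    obtain ⟨h1, h2, h3⟩ := divStep_iterate_size (f a) (g a) i
    have h4 := hR a
    have h5 := hP a
    have h6 := hQ a
    rw [size_list] at h5 h6
    rw [size_nat] at h4
    simp only [size_prod, size_list, size_nat, h1]
    omega
  unfold ToyModel.quot
  fun_prop

/-! ### Parsing -/

/-- A step of the parsing of a field. -/
def fieldStep (s : List Sym × (List Sym × ℕ)) : List Sym × (List Sym × ℕ) :=
  if s.2.2 = 0 then
    listCase s.1 s fun d l => d.elim (l, (s.2.1, 1)) fun b => (l, (some b :: s.2.1, 0))
  else s

/-- The first field of a string, and the rest of the string. -/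
def takeField (l : List Sym) : List Sym × List Sym :=
  let s := fieldStep^[l.length] (l, ([], 0))
  (s.2.1.reverse, s.1)

theorem size_fieldStep_le (s : List Sym × (List Sym × ℕ)) : size (fieldStep s) ≤ size s := by
  obtain ⟨l, acc, k⟩ := s
  unfold fieldStep
  split_ifs with h
  · rcases l with _ | ⟨_ | b, l⟩ <;> dsimp only at h <;> subst h <;> simp <;> omega
  · exact le_rfl

theorem size_takeField_le (l : List Sym) : size (takeField l) ≤ l.length := by
  have := size_iterate_le size_fieldStep_le l.length (l, ([], 0))
  simp only [size_prod, size_list, size_nat, List.length_nil] at this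
  simp only [takeField, size_prod, size_list, List.length_reverse]
  omega

theorem length_takeField_snd_le (l : List Sym) : (takeField l).2.length ≤ l.length := by
  have := size_takeField_le l
  simp only [size_prod, size_list] at this
  omega

@[fun_prop] theorem PT.takeField {f : α → List Sym} (hf : PT O f) :
    PT O fun a => takeField (f a) := by
  refine PT.comp (g := ToyModel.takeField) ?_ hf
  have hstep : PT O fieldStep := by
    unfold fieldStep
    refine PT.ifZero (by fun_prop) (PT.listCase (by fun_prop) (by fun_prop) ?_) (by fun_prop)
    rintro (_ | b) <;> dsimp only [Option.elim] <;> fun_prop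
  have : PT O fun l : List Sym => fieldStep^[l.length] (l, (([] : List Sym), 0)) := by
    refine PT.iterate (by fun_prop) (by fun_prop) hstep PolyBound.id
      fun l i hi => (size_iterate_le size_fieldStep_le i _).trans ?_
    simp
  unfold ToyModel.takeField
  fun_prop

/-- The flag is set at the first separator, and a state with the flag set is fixed. Hence running as
many rounds as the string has symbols extracts exactly one field. -/
theorem takeField_append (w : List Bool) (r : List Sym) :
    takeField (w.map some ++ none :: r) = (w.map some, r) := by
  have hfix : ∀ k (acc : List Sym), fieldStep^[k] (r, (acc, 1)) = (r, (acc, 1)) := fun k acc =>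
    Function.iterate_fixed (by simp [fieldStep]) k
  have key : ∀ (w : List Bool) (acc : List Sym) (k : ℕ),
      fieldStep^[w.length + 1 + k] (w.map some ++ none :: r, (acc, 0)) =
        (r, ((w.map some).reverse ++ acc, 1)) := by
    intro w
    induction w with
    | nil =>
      intro acc k
      rw [List.length_nil, zero_add, add_comm, Function.iterate_succ_apply]
      simpa [fieldStep] using hfix k acc
    | cons b w ih =>
      intro acc k
      rw [List.length_cons, show w.length + 1 + 1 + k = (w.length + 1 + k) + 1 by omega,
        Function.iterate_succ_apply]
      have := ih (some b :: acc) k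
      simpa [fieldStep] using this
  have := key w [] r.length
  unfold takeField
  rw [show (w.map some ++ none :: r).length = w.length + 1 + r.length by simp; omega, this]
  simp

theorem serialize_cons (w : List Bool) (l : List (List Bool)) :
    serialize (w :: l) = w.map some ++ none :: serialize l := by
  simp [serialize]

theorem serialize_append (l m : List (List Bool)) : serialize (l ++ m) = serialize l ++ serialize m := by
  simp [serialize]

@[simp] theorem takeField_serialize (w : List Bool) (l : List (List Bool)) :
    takeField (serialize (w :: l)) = (w.map some, serialize l) := by
  rw [serialize_cons, takeField_append]

end Strings

end ToyModel

end

noncomputable section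

namespace ToyModel

open Computability Turing

/-! ### The reduction -/

/-- The minimum of `T ^ 4` and the integer part of `T ^ 2 * |q|`. -/
def roundFrac (T : ℕ) (q : Frac) : ℕ := min (T ^ 4) (T ^ 2 * q.num.natAbs / q.den)

/-- An edge with an integral weight. -/
def natEdge {n : ℕ} (i j : Fin n) (h : i < j) (w : ℕ) (hw : 0 < w) : Edge n where
  fst := i
  snd := j
  fst_lt_snd := h
  weight := ⟨w, 1, one_pos⟩
  weight_pos := by simpa [Frac.val] using hw

/-- The rounded weight of an edge. -/
def edgeRound {n : ℕ} (T : ℕ) (e : Edge n) : ℕ := roundFrac T e.weight + 1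

/-- An edge that joins a qubit to an ancilla. -/
def ancillaEdge {n m : ℕ} (i : Fin n) (k : Fin m) (w : ℕ) (hw : 0 < w) : Edge (n + 2 * m) :=
  natEdge ⟨i, by omega⟩ ⟨n + 2 * k, by omega⟩ (by rw [Fin.lt_def]; dsimp only; omega) w hw

/-- The gadget that replaces an edge, with two ancillas. -/
def gadget {n m : ℕ} (T t : ℕ) (hT : 0 < T) (ht : 0 < t) (k : Fin m) (e : Edge n) :
    List (Edge (n + 2 * m)) :=
  have hu : 0 < edgeRound T e := Nat.succ_pos _
  -- With `u` the rounded weight and `N = T ^ 4`, the weights are `u * T ^ 2` for the direct edge,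
  -- `u * t * 2 * N` for the two couplings and `u * t * 2 * N ^ 2` for the ancilla pair, so that
  -- second-order perturbation theory mediates a singlet term of strength `u * t`.
  [natEdge ⟨e.fst, by omega⟩ ⟨e.snd, by omega⟩ e.fst_lt_snd (edgeRound T e * T ^ 2) (by positivity),
    ancillaEdge e.fst k (edgeRound T e * (2 * T ^ 4 * t)) (by positivity),
    ancillaEdge e.snd k (edgeRound T e * (2 * T ^ 4 * t)) (by positivity),
    natEdge ⟨n + 2 * k, by omega⟩ ⟨n + 2 * k + 1, by omega⟩ (by rw [Fin.lt_def]; dsimp only; omega)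
      (edgeRound T e * (2 * T ^ 8 * t)) (by positivity)]

/-- The edges of all the gadgets. -/
def gadgetEdges {n : ℕ} (T t : ℕ) (hT : 0 < T) (ht : 0 < t) (l : List (Edge n)) :
    List (Edge (n + 2 * l.length)) :=
  (List.finRange l.length).flatMap fun k => gadget T t hT ht k l[k]

/-- Every gadget has its own ancillas, which separates all edges that meet an ancilla. The direct
edges differ because the original graph is simple. -/
theorem gadgetEdges_simple {n : ℕ} (T t : ℕ) (hT : 0 < T) (ht : 0 < t) (l : List (Edge n))
    (hl : l.Pairwise fun e f => (e.fst, e.snd) ≠ (f.fst, f.snd)) :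
    (gadgetEdges T t hT ht l).Pairwise fun e f => (e.fst, e.snd) ≠ (f.fst, f.snd) := by
  unfold gadgetEdges
  rw [List.pairwise_flatMap]
  constructor
  · intro k _
    have : l[(k : ℕ)].fst < l[(k : ℕ)].snd := Edge.fst_lt_snd _
    simp [gadget, ancillaEdge, natEdge, Fin.ext_iff]
    omega
  · refine List.Pairwise.imp_of_mem ?_ (List.nodup_finRange l.length)
    intro k k' _ _ hk x hx y hy
    have h1 : (l[k].fst, l[k].snd) ≠ (l[k'].fst, l[k'].snd) := by
      rw [List.pairwise_iff_getElem] at hl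
      rcases lt_or_gt_of_ne hk with h | h
      · exact hl k k' k.2 k'.2 h
      · exact (hl k' k k'.2 k.2 h).symm
    have h2 := l[k].fst_lt_snd
    have h3 := l[k'].fst_lt_snd
    have h4 : (k : ℕ) ≠ k' := fun h => hk (Fin.ext h)
    simp only [Prod.mk.injEq, Ne, Fin.ext_iff, not_and] at h1 ⊢
    simp only [gadget, List.mem_cons, List.not_mem_nil, or_false] at hx hy
    rcases hx with rfl | rfl | rfl | rfl <;> rcases hy with rfl | rfl | rfl | rfl <;>
      simp only [ancillaEdge, natEdge] <;> omega

/-- The sum of the rounded weights. -/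
def sumRound {n : ℕ} (T : ℕ) (l : List (Edge n)) : ℕ := (l.map (edgeRound T)).sum

/-- The shift of the ground-state energy by the gadgets. -/
def gadgetShift {n : ℕ} (T t : ℕ) (l : List (Edge n)) : ℕ :=
  sumRound T l * t * (2 * T ^ 8 + T ^ 4 + 1)

/-- Minus the threshold of the reduced instance. -/
def threshold (T t : ℕ) (I : Inst) : ℕ :=
  T ^ 2 * (if I.lo.num < 0 then roundFrac T I.lo else 0) + gadgetShift T t I.edges - T ^ 3

/-- The instance in which every edge is replaced by a gadget. -/
def gadgetInst (T t : ℕ) (hT : 0 < T) (ht : 0 < t) (I : Inst) : Inst where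
  n := I.n + 2 * I.edges.length
  edges := gadgetEdges T t hT ht I.edges
  simple := gadgetEdges_simple T t hT ht I.edges I.simple
  lo := ⟨-(threshold T t I : ℤ), 1, one_pos⟩
  hi := ⟨1 - (threshold T t I : ℤ), 1, one_pos⟩

/-- The precision that is used for instances with `n` qubits. -/
def precision (R : Polynomial ℕ) (n : ℕ) : ℕ := 2 ^ (binary (R.eval n)).length

theorem precision_pos (R : Polynomial ℕ) (n : ℕ) : 0 < precision R n := Nat.two_pow_pos _

/-- The reduction, given approximations of the interaction strength. -/
def reduction (R : Polynomial ℕ) (r : ℕ → Frac) (I : Inst) : Inst :=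
  gadgetInst (precision R I.n) (roundFrac (precision R I.n) (r (precision R I.n ^ 2)) + 1)
    (precision_pos R I.n) (Nat.succ_pos _) I

/-! ### The reduction on strings -/

section Strings

variable {α β : Type} [Reg α] [Reg β] {O : Oracle}

/-- The string without the first `k` fields. -/
def rest (k : ℕ) (l : List Sym) : List Sym := (fun l => (takeField l).2)^[k] l

/-- The field with the given index. -/
def field (k : ℕ) (l : List Sym) : List Sym := (takeField (rest k l)).1

@[fun_prop] theorem PT.rest (k : ℕ) {f : α → List Sym} (hf : PT O f) : PT O fun a => rest k (f a) := by
  induction k with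
  | zero => exact hf
  | succ k ih =>
    simp only [ToyModel.rest, Function.iterate_succ_apply'] at ih ⊢
    fun_prop

@[fun_prop] theorem PT.field (k : ℕ) {f : α → List Sym} (hf : PT O f) : PT O fun a => field k (f a) := by
  unfold ToyModel.field
  fun_prop

theorem length_rest_le (k : ℕ) (l : List Sym) : (rest k l).length ≤ l.length := by
  induction k with
  | zero => exact le_rfl
  | succ k ih =>
    simp only [rest, Function.iterate_succ_apply'] at ih ⊢
    exact (length_takeField_snd_le _).trans ih

theorem rest_succ (k : ℕ) (w : List Bool) (l : List (List Bool)) :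
    rest (k + 1) (serialize (w :: l)) = rest k (serialize l) := by
  simp only [rest, Function.iterate_succ_apply, takeField_serialize]

theorem rest_zero (l : List Sym) : rest 0 l = l := rfl

theorem field_succ (k : ℕ) (w : List Bool) (l : List (List Bool)) :
    field (k + 1) (serialize (w :: l)) = field k (serialize l) := by
  simp only [field, rest_succ]

theorem field_zero (w : List Bool) (l : List (List Bool)) :
    field 0 (serialize (w :: l)) = w.map some := by
  simp only [field, rest_zero, takeField_serialize]

theorem rest_nil (k : ℕ) : rest k [] = [] := List.length_eq_zero_iff.mp
  (Nat.le_zero.mp (length_rest_le k []))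

/-- The string that represents a field in unary. -/
def unaryStr (n : ℕ) : List Sym := List.replicate n (some true) ++ [none]

/-- The string that represents an integer as a fraction: the number `k` is zero if the integer
is nonnegative. -/
def intStr (k n : ℕ) : List Sym :=
  (if k = 0 then [some false] else [some true]) ++ none :: (binary n ++ none :: (binary 1 ++ [none]))

/-- The string that represents an edge with an integral weight. -/
def edgeStr (i j w : ℕ) : List Sym := unaryStr i ++ (unaryStr j ++ intStr 0 w)

@[fun_prop] theorem PT.unaryStr {f : α → ℕ} (hf : PT O f) : PT O fun a => unaryStr (f a) := by
  unfold ToyModel.unaryStr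
  fun_prop

@[fun_prop] theorem PT.intStr {f g : α → ℕ} (hf : PT O f) (hg : PT O g) :
    PT O fun a => intStr (f a) (g a) := by
  unfold ToyModel.intStr
  fun_prop

@[fun_prop] theorem PT.edgeStr {f g h : α → ℕ} (hf : PT O f) (hg : PT O g) (hh : PT O h) :
    PT O fun a => edgeStr (f a) (g a) (h a) := by
  unfold ToyModel.edgeStr
  fun_prop

theorem unaryEncodeNat_eq (n : ℕ) : unaryEncodeNat n = List.replicate n true := by
  induction n with
  | zero => rfl
  | succ n ih => rw [List.replicate_succ, ← ih]; rfl

theorem unaryStr_append (n : ℕ) (l : List (List Bool)) :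
    unaryStr n ++ serialize l = serialize (unaryEncodeNat n :: l) := by
  simp [unaryStr, serialize_cons, unaryEncodeNat_eq]

theorem intStr_append (k : ℕ) (q : Frac) (hq : q.den = 1) (hk : k = 0 ↔ 0 ≤ q.num)
    (l : List (List Bool)) :
    intStr k q.num.natAbs ++ serialize l = serialize (q.fields ++ l) := by
  simp only [Frac.fields, List.cons_append, List.nil_append, serialize_cons, intStr, hq, binary]
  by_cases h : k = 0
  · simp [h, not_lt.mpr (hk.mp h)]
  · simp [h, not_le.mp (hk.not.mp h)]

theorem edgeStr_append {n : ℕ} (i j : Fin n) (hij : i < j) (w : ℕ) (hw : 0 < w)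
    (l : List (List Bool)) :
    edgeStr i j w ++ serialize l = serialize ((natEdge i j hij w hw).fields ++ l) := by
  have := intStr_append 0 ⟨w, 1, one_pos⟩ rfl (by simp) l
  rw [Int.natAbs_natCast] at this
  simp only [edgeStr, List.append_assoc, this, unaryStr_append, natEdge, Edge.fields,
    List.cons_append]

/-- The rounding of the fraction with the given numerator and denominator. -/
def roundStr (x : ℕ × ℕ) (num den : List Sym) : ℕ :=
  quot (x.1 ^ 4) (List.replicate (2 * x.2) (some false) ++ num) den

@[fun_prop] theorem PT.roundStr {x : α → ℕ × ℕ} {f g : α → List Sym} (hx : PT O x) (hf : PT O f)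
    (hg : PT O g) : PT O fun a => roundStr (x a) (f a) (g a) := by
  unfold ToyModel.roundStr
  fun_prop

/-- Digits are stored least significant first, so prepending `2 * J` zeros multiplies by the square
of `2 ^ J`; the clamp of `quot` is the minimum in `roundFrac`. -/
theorem roundStr_eq (J : ℕ) (q : Frac) :
    roundStr (2 ^ J, J) ((encodeNat q.num.natAbs).map some) ((encodeNat q.den).map some) =
      roundFrac (2 ^ J) q := by
  have h1 := val_binary q.num.natAbs
  have h2 := val_binary q.den
  unfold binary at h1 h2
  unfold roundStr roundFrac
  rw [quot_eq _ _ _ (by rw [h2]; exact q.den_pos), val_append, h1, h2]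
  rw [List.length_replicate, val_replicate_false, zero_add, mul_comm 2 J, pow_mul]

/-- The rounded weight of the first edge of a string. -/
def edgeRoundStr (x : ℕ × ℕ) (l : List Sym) : ℕ := roundStr x (field 3 l) (field 4 l) + 1

@[fun_prop] theorem PT.edgeRoundStr {x : α → ℕ × ℕ} {f : α → List Sym} (hx : PT O x) (hf : PT O f) :
    PT O fun a => edgeRoundStr (x a) (f a) := by
  unfold ToyModel.edgeRoundStr
  fun_prop

theorem edgeRoundStr_eq (J : ℕ) {n : ℕ} (e : Edge n) (l : List (List Bool)) :
    edgeRoundStr (2 ^ J, J) (serialize (e.fields ++ l)) = edgeRound (2 ^ J) e := by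
  simp only [Edge.fields, Frac.fields, List.cons_append, edgeRoundStr, edgeRound, field_succ,
    field_zero, roundStr_eq]

/-- Proceed to the next edge. -/
def nextEdge (x : List Sym × ℕ) : List Sym × ℕ := (rest 5 x.1, x.2 + 1)

theorem size_nextEdge_iterate (x : List Sym × ℕ) (i : ℕ) : size (nextEdge^[i] x) ≤ size x + i := by
  induction i with
  | zero => exact le_rfl
  | succ i ih =>
    rw [Function.iterate_succ_apply']
    have := length_rest_le 5 (nextEdge^[i] x).1
    simp only [size_prod, size_list, size_nat, nextEdge] at ih this ⊢
    omega

/-- The strings for the edges, appended. -/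
def edgesStr (l : List Sym) (h : List Sym × ℕ → List Sym) : List Sym :=
  accumulate l.length (l, 0) nextEdge fun x => listCase x.1 [] fun _ _ => h x

theorem PT.edgesStr {e : α → β} {f : α → List Sym} {h : β → List Sym × ℕ → List Sym} (he : PT O e)
    (hf : PT O f) (hh : PT O fun x : β × (List Sym × ℕ) => h x.1 x.2) :
    PT O fun a => edgesStr (f a) (h (e a)) := by
  obtain ⟨P, hP⟩ := hf.size_le
  unfold ToyModel.edgesStr
  refine PT.accumulate (γ := β) (next := fun _ => nextEdge)
    (h := fun b x => ToyModel.listCase x.1 [] fun _ _ => h b x) (by fun_prop) he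
    (by fun_prop) ?_ ?_ ((PolyBound.eval P).add (PolyBound.eval P)) fun a i hi => ?_
  · unfold nextEdge
    fun_prop
  · exact PT.listCase (by fun_prop) (by fun_prop) fun _ => PT.comp hh PT.fst'
  · have h1 := hP a
    rw [size_list] at h1
    refine (size_nextEdge_iterate _ i).trans ?_
    rw [size_prod, size_list, size_nat]
    dsimp only
    omega

theorem length_serialize (l : List (List Bool)) : l.length ≤ (serialize l).length := by
  induction l with
  | nil => exact le_rfl
  | cons w l ih => rw [serialize_cons]; simp; omega

/-- The number of edges need not be known: past the last edge the remaining string is empty and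
stays empty, and nothing is written. Any upper bound `k` on the number of edges will do, such as the
length of the string. -/
theorem accumulate_edges {n : ℕ} (h : List Sym × ℕ → List Sym) (H : Edge n → ℕ → List Sym)
    (hH : ∀ e l i, h (serialize (e.fields ++ l), i) = H e i) (l : List (Edge n)) (k : ℕ)
    (hk : l.length ≤ k) (i : ℕ) :
    accumulate k (serialize (l.flatMap Edge.fields), i) nextEdge
      (fun x => listCase x.1 [] fun _ _ => h x) = (l.zipIdx i).flatMap fun x => H x.1 x.2 := by
  have hnil : ∀ k i, (nextEdge^[k] ([], i)).1 = [] := by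
    intro k
    induction k with
    | zero => intro i; rfl
    | succ k ih => intro i; rw [Function.iterate_succ_apply, nextEdge, rest_nil, ih]
  induction l generalizing k i with
  | nil =>
    simp only [accumulate, List.flatMap_nil, List.zipIdx_nil]
    rw [List.flatMap_eq_nil_iff]
    intro j _
    rw [show serialize [] = [] from rfl, hnil, listCase_nil]
  | cons e l ih =>
    obtain ⟨k, rfl⟩ : ∃ k', k = k' + 1 := ⟨k - 1, by simp at hk; omega⟩
    have h1 : nextEdge (serialize (e.fields ++ l.flatMap Edge.fields), i) =
        (serialize (l.flatMap Edge.fields), i + 1) := by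
      simp only [nextEdge, Edge.fields, Frac.fields, List.cons_append, List.nil_append, rest_succ,
        rest_zero]
    have h2 : ∃ s l', serialize (e.fields ++ l.flatMap Edge.fields) = s :: l' := by
      rw [← List.ne_nil_iff_exists_cons]
      intro h3
      have := length_serialize (e.fields ++ l.flatMap Edge.fields)
      rw [h3] at this
      simp [Edge.fields] at this
    obtain ⟨s, l', h2⟩ := h2
    have h3 := ih k (by simpa using hk) (i + 1)
    unfold accumulate at h3 ⊢
    rw [List.range_succ_eq_map, List.flatMap_cons, List.flatMap_map, List.flatMap_cons]
    simp only [Function.iterate_succ_apply, h1, h3, List.zipIdx_cons, List.flatMap_cons,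
      Function.iterate_zero, id_eq]
    rw [← hH e (l.flatMap Edge.fields) i, h2, listCase_cons]

theorem edgesStr_eq {n : ℕ} (h : List Sym × ℕ → List Sym) (H : Edge n → ℕ → List Sym)
    (hH : ∀ e l i, h (serialize (e.fields ++ l), i) = H e i) (l : List (Edge n)) :
    edgesStr (serialize (l.flatMap Edge.fields)) h = (l.zipIdx 0).flatMap fun x => H x.1 x.2 := by
  refine accumulate_edges h H hH l _ ((?_ : l.length ≤ _).trans (length_serialize _)) 0
  induction l with
  | nil => exact le_rfl
  | cons e l ih => simp [Edge.fields]; omega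

end Strings

end ToyModel

end

/-! ### The string program computes the encoding of the reduced instance -/

noncomputable section

namespace ToyModel

open Computability Turing

section Strings

variable {α β : Type} [Reg α] [Reg β] {O : Oracle}

/-- The parameters of the gadgets: precision, its logarithm, number of qubits, and interaction
strength. -/
abbrev Env : Type := (ℕ × ℕ) × (ℕ × ℕ)

/-- The string of the gadget for the first edge of a string. -/
def gadgetStr (y : Env) (x : List Sym × ℕ) : List Sym :=
  edgeStr (field 0 x.1).length (field 1 x.1).length (edgeRoundStr y.1 x.1 * y.1.1 ^ 2) ++
    (edgeStr (field 0 x.1).length (y.2.1 + 2 * x.2)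
      (edgeRoundStr y.1 x.1 * (2 * y.1.1 ^ 4 * y.2.2)) ++
    (edgeStr (field 1 x.1).length (y.2.1 + 2 * x.2)
      (edgeRoundStr y.1 x.1 * (2 * y.1.1 ^ 4 * y.2.2)) ++
    edgeStr (y.2.1 + 2 * x.2) (y.2.1 + 2 * x.2 + 1)
      (edgeRoundStr y.1 x.1 * (2 * y.1.1 ^ 8 * y.2.2))))

theorem PT.gadgetStr : PT O fun x : Env × (List Sym × ℕ) => gadgetStr x.1 x.2 := by
  unfold ToyModel.gadgetStr
  fun_prop

/-- The threshold of the reduced instance. -/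
def thresholdStr (y : Env) (l : List Sym) : ℕ :=
  y.1.1 ^ 2 * (listCase (field 1 l) 0 fun d _ =>
      if isOne d then roundStr y.1 (field 2 l) (field 3 l) else 0) +
    (edgesStr (rest 7 l) fun x => List.replicate (edgeRoundStr y.1 x.1) none).length * y.2.2 *
      (2 * y.1.1 ^ 8 + y.1.1 ^ 4 + 1) - y.1.1 ^ 3

@[fun_prop] theorem PT.thresholdStr {y : α → Env} {f : α → List Sym} (hy : PT O y) (hf : PT O f) :
    PT O fun a => thresholdStr (y a) (f a) := by
  have h1 : PT O fun x : Env × List Sym => ToyModel.edgesStr (ToyModel.rest 7 x.2)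
      fun z => List.replicate (ToyModel.edgeRoundStr x.1.1 z.1) none :=
    PT.edgesStr (e := fun x : Env × List Sym => x.1) (f := fun x => ToyModel.rest 7 x.2)
      (h := fun y z => List.replicate (ToyModel.edgeRoundStr y.1 z.1) none)
      (by fun_prop) (by fun_prop) (by fun_prop)
  have h2 : PT O fun x : Env × List Sym => ToyModel.listCase (ToyModel.field 1 x.2) 0 fun d _ =>
      if isOne d then ToyModel.roundStr x.1.1 (ToyModel.field 2 x.2) (ToyModel.field 3 x.2) else 0 := by
    refine PT.listCase (by fun_prop) (by fun_prop) fun d => ?_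
    split_ifs <;> fun_prop
  have h3 : PT O fun x : Env × List Sym => ToyModel.thresholdStr x.1 x.2 := by
    exact PT.sub (PT.add (PT.mul (by fun_prop) h2) (PT.mul (PT.mul (PT.length h1) (by fun_prop))
      (by fun_prop))) (by fun_prop)
  exact PT.comp h3 (hy.prodMk hf)

/-- The string of the reduced instance. -/
def instStr (y : Env) (l : List Sym) : List Sym :=
  unaryStr (y.2.1 + 2 * (edgesStr (rest 7 l) fun _ => [none]).length) ++
    (intStr (thresholdStr y l) (thresholdStr y l) ++
    (intStr (thresholdStr y l - 1) (if thresholdStr y l = 0 then 1 else thresholdStr y l - 1) ++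
    edgesStr (rest 7 l) (gadgetStr y)))

theorem PT.instStr : PT O fun x : Env × List Sym => instStr x.1 x.2 := by
  have h1 : PT O fun x : Env × List Sym => ToyModel.edgesStr (ToyModel.rest 7 x.2)
      fun _ => [none] :=
    PT.edgesStr (e := fun x : Env × List Sym => x.1) (f := fun x => ToyModel.rest 7 x.2)
      (h := fun _ _ => [none]) (by fun_prop) (by fun_prop) (by fun_prop)
  have h2 : PT O fun x : Env × List Sym => ToyModel.edgesStr (ToyModel.rest 7 x.2)
      (ToyModel.gadgetStr x.1) :=
    PT.edgesStr (e := fun x : Env × List Sym => x.1) (f := fun x => ToyModel.rest 7 x.2)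
      (h := ToyModel.gadgetStr) (by fun_prop) (by fun_prop) PT.gadgetStr
  exact PT.append (PT.unaryStr (PT.add (by fun_prop) (PT.mul (by fun_prop) (PT.length h1))))
    (PT.append (by fun_prop) (PT.append (by fun_prop) h2))

/-- The precision and its logarithm. -/
def precisionStr (R : Polynomial ℕ) (l : List Sym) : ℕ × ℕ :=
  (2 ^ (binary (R.eval (field 0 l).length)).length, (binary (R.eval (field 0 l).length)).length)

/-- The parameters of the gadgets for an instance, given approximations of the interaction
strength. -/
def envStr (R : Polynomial ℕ) (out : ℕ → List Sym) (l : List Sym) : Env :=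
  (precisionStr R l, ((field 0 l).length, roundStr (precisionStr R l)
    (field 1 (out ((precisionStr R l).1 ^ 2))) (field 2 (out ((precisionStr R l).1 ^ 2))) + 1))

@[fun_prop] theorem PT.precisionStr (R : Polynomial ℕ) : PT O (precisionStr R) := by
  unfold ToyModel.precisionStr
  fun_prop

theorem PT.envStr (R : Polynomial ℕ) : PT O (envStr R O.out) := by
  have h : PT O fun l => O.out ((ToyModel.precisionStr R l).1 ^ 2) :=
    PT.comp PT.oracle (by fun_prop)
  unfold ToyModel.envStr
  fun_prop

/-- The reduction on strings. -/
def reductionStr (R : Polynomial ℕ) (out : ℕ → List Sym) (l : List Sym) : List Sym :=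
  instStr (envStr R out l) l

theorem PT.reductionStr (R : Polynomial ℕ) : PT O (reductionStr R O.out) :=
  PT.comp (g := fun x : Env × List Sym => ToyModel.instStr x.1 x.2) (f := fun l => (ToyModel.envStr R O.out l, l))
    PT.instStr ((PT.envStr R).prodMk PT.id)

theorem zipIdx_eq_map_finRange {γ : Type} (l : List γ) :
    l.zipIdx 0 = (List.finRange l.length).map fun k : Fin l.length => (l[k], (k : ℕ)) := by
  refine List.ext_getElem (by simp) fun i h1 h2 => by simp

theorem serialize_flatMap {γ : Type} (l : List γ) (f : γ → List (List Bool)) :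
    serialize (l.flatMap f) = l.flatMap fun x => serialize (f x) := by
  induction l with
  | nil => rfl
  | cons x l ih => simp only [List.flatMap_cons, serialize_append, ih]

theorem length_map_unaryEncodeNat (n : ℕ) : ((unaryEncodeNat n).map some).length = n := by
  simp [unaryEncodeNat_eq]

theorem gadgetStr_eq {n m : ℕ} (J t : ℕ) (ht : 0 < t) (e : Edge n) (l : List (List Bool))
    (k : Fin m) :
    gadgetStr ((2 ^ J, J), (n, t)) (serialize (e.fields ++ l), k) =
      serialize ((gadget (2 ^ J) t (Nat.two_pow_pos J) ht k e).flatMap Edge.fields) := by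
  have h0 : field 0 (serialize (e.fields ++ l)) = (unaryEncodeNat e.fst).map some := by
    simp only [Edge.fields, List.cons_append, field_zero]
  have h1 : field 1 (serialize (e.fields ++ l)) = (unaryEncodeNat e.snd).map some := by
    simp only [Edge.fields, List.cons_append, field_succ, field_zero]
  simp only [gadgetStr, h0, h1, length_map_unaryEncodeNat, edgeRoundStr_eq, gadget, ancillaEdge,
    List.flatMap_cons, List.flatMap_nil]
  simp only [← edgeStr_append]
  simp [serialize]

theorem edgesStr_gadgetStr {n : ℕ} (J t : ℕ) (ht : 0 < t) (l : List (Edge n)) :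
    edgesStr (serialize (l.flatMap Edge.fields)) (gadgetStr ((2 ^ J, J), (n, t))) =
      serialize ((gadgetEdges (2 ^ J) t (Nat.two_pow_pos J) ht l).flatMap Edge.fields) := by
  -- `edgesStr_eq` asks for an output at every natural number `i`, whereas a gadget has an index in
  -- some `Fin m`. `Fin.last i` is an index with value `i`, and the encoding depends on the value
  -- only.
  have hex : ∀ (e : Edge n) (l : List (List Bool)) (i : ℕ),
      gadgetStr ((2 ^ J, J), (n, t)) (serialize (e.fields ++ l), i) =
        serialize ((gadget (2 ^ J) t (Nat.two_pow_pos J) ht (Fin.last i) e).flatMap Edge.fields) :=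
    fun e l i => gadgetStr_eq J t ht e l (Fin.last i)
  rw [edgesStr_eq _ _ hex, zipIdx_eq_map_finRange, List.flatMap_map, gadgetEdges,
    List.flatMap_assoc, serialize_flatMap]
  refine List.flatMap_congr fun k _ => ?_
  dsimp only
  rw [← gadgetStr_eq J t ht l[k] [] k, ← hex l[k] [] k]

/-- Sums over the edges are computed in unary, as the length of a string to which each edge
contributes: the number of edges and the sum of the rounded weights arise in this way. -/
theorem length_edgesStr {n : ℕ} (h : List Sym × ℕ → List Sym) (H : Edge n → List Sym)
    (hH : ∀ e l i, h (serialize (e.fields ++ l), i) = H e) (l : List (Edge n)) :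
    (edgesStr (serialize (l.flatMap Edge.fields)) h).length = (l.map fun e => (H e).length).sum := by
  rw [edgesStr_eq h (fun e _ => H e) hH, List.length_flatMap]
  congr 1
  rw [show (fun x : Edge n × ℕ => (H x.1).length) = (fun e => (H e).length) ∘ Prod.fst from rfl,
    ← List.map_map, List.zipIdx_map_fst]

theorem thresholdStr_eq (J n t : ℕ) (I : Inst) :
    thresholdStr ((2 ^ J, J), (n, t)) I.encode = threshold (2 ^ J) t I := by
  have h1 : field 1 I.encode = [some (decide (I.lo.num < 0))] := by
    simp only [Inst.encode, Inst.fields, Frac.fields, List.cons_append, field_succ, field_zero]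
    rfl
  have h2 : field 2 I.encode = (encodeNat I.lo.num.natAbs).map some := by
    simp only [Inst.encode, Inst.fields, Frac.fields, List.cons_append, field_succ, field_zero]
  have h3 : field 3 I.encode = (encodeNat I.lo.den).map some := by
    simp only [Inst.encode, Inst.fields, Frac.fields, List.cons_append, field_succ, field_zero]
  have h7 : rest 7 I.encode = serialize (I.edges.flatMap Edge.fields) := by
    simp only [Inst.encode, Inst.fields, Frac.fields, List.cons_append, List.nil_append, rest_succ,
      rest_zero]
  have h8 := length_edgesStr (n := I.n)
    (fun x => List.replicate (edgeRoundStr (2 ^ J, J) x.1) none)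
    (fun e => List.replicate (edgeRound (2 ^ J) e) none)
    (fun e l i => by simp only [edgeRoundStr_eq]) I.edges
  simp only [thresholdStr, h1, h2, h3, h7, h8, threshold, gadgetShift, sumRound, listCase_cons,
    roundStr_eq, List.length_replicate, isOne]
  simp

theorem instStr_eq (J t : ℕ) (ht : 0 < t) (I : Inst) :
    instStr ((2 ^ J, J), (I.n, t)) I.encode =
      (gadgetInst (2 ^ J) t (Nat.two_pow_pos J) ht I).encode := by
  have h7 : rest 7 I.encode = serialize (I.edges.flatMap Edge.fields) := by
    simp only [Inst.encode, Inst.fields, Frac.fields, List.cons_append, List.nil_append, rest_succ,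
      rest_zero]
  have h8 := length_edgesStr (n := I.n) (fun _ => [none]) (fun _ => [none]) (fun e l i => rfl) I.edges
  simp only [List.length_singleton, List.map_const', List.sum_replicate, smul_eq_mul, mul_one] at h8
  unfold instStr
  rw [thresholdStr_eq, h7, h8, edgesStr_gadgetStr _ _ ht]
  have h9 := intStr_append (threshold (2 ^ J) t I) (gadgetInst (2 ^ J) t (Nat.two_pow_pos J) ht I).lo
    rfl (by simp [gadgetInst])
  -- The upper threshold is one minus `threshold`, hence nonnegative exactly if the truncated
  -- difference `threshold - 1` vanishes. Its absolute value is that difference, except that it is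
  -- one if `threshold` is zero.
  have h10 := intStr_append (threshold (2 ^ J) t I - 1)
    (gadgetInst (2 ^ J) t (Nat.two_pow_pos J) ht I).hi rfl (by simp [gadgetInst]; omega)
  have h11 : (gadgetInst (2 ^ J) t (Nat.two_pow_pos J) ht I).lo.num.natAbs = threshold (2 ^ J) t I := by
    simp [gadgetInst]
  have h12 : (gadgetInst (2 ^ J) t (Nat.two_pow_pos J) ht I).hi.num.natAbs =
      if threshold (2 ^ J) t I = 0 then 1 else threshold (2 ^ J) t I - 1 := by
    simp only [gadgetInst]
    split_ifs <;> omega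
  rw [h11] at h9
  rw [h12] at h10
  rw [h10, h9, unaryStr_append]
  rfl

theorem reductionStr_eq (R : Polynomial ℕ) (r : ℕ → Frac) (out : ℕ → List Sym)
    (hout : ∀ k, out k = (r k).encode) (I : Inst) :
    reductionStr R out I.encode = (reduction R r I).encode := by
  have h0 : field 0 I.encode = (unaryEncodeNat I.n).map some := by
    simp only [Inst.encode, Inst.fields, List.cons_append, field_zero]
  have hy : envStr R out I.encode = ((precision R I.n, (binary (R.eval I.n)).length),
      (I.n, roundFrac (precision R I.n) (r (precision R I.n ^ 2)) + 1)) := by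
    simp only [envStr, precisionStr, h0, length_map_unaryEncodeNat, hout, Frac.encode, Frac.fields,
      field_succ, field_zero, roundStr_eq, precision]
  unfold reductionStr
  rw [hy]
  exact instStr_eq _ _ (Nat.succ_pos _) I

end Strings

end ToyModel

end

noncomputable section

namespace ToyModel

/-! ### The triplet and singlet projections of a pair of qubits -/

theorem ofReal_inv_sqrt_two_sq : ((1 / √2 : ℝ) : ℂ) * ((1 / √2 : ℝ) : ℂ) = 1 / 2 := by
  rw [← Complex.ofReal_mul, div_mul_div_comm, Real.mul_self_sqrt (by norm_num)]
  norm_num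

theorem proj_psiPlus_apply (a b c d : Fin 2) :
    proj psiPlus (a, b) (c, d) = if a ≠ b ∧ c ≠ d then 1 / 2 else 0 := by
  rw [← ofReal_inv_sqrt_two_sq]
  fin_cases a <;> fin_cases b <;> fin_cases c <;> fin_cases d <;>
    simp [proj, psiPlus, ket, Matrix.vecMulVec_apply]

theorem proj_psiMinus_apply (a b c d : Fin 2) :
    proj psiMinus (a, b) (c, d) =
      if a ≠ b ∧ c ≠ d then (if a = c then 1 / 2 else -(1 / 2)) else 0 := by
  rw [← ofReal_inv_sqrt_two_sq]
  fin_cases a <;> fin_cases b <;> fin_cases c <;> fin_cases d <;>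
    simp [proj, psiMinus, ket, Matrix.vecMulVec_apply]

variable {n : ℕ}

theorem onPair_mulVec {i j : Fin n} (hij : i ≠ j) (K : TwoQubitOp) (x : (Fin n → Fin 2) → ℂ)
    (s : Fin n → Fin 2) : (onPair i j K).mulVec x s =
      ∑ p : Fin 2 × Fin 2, K (s i, s j) p *
        x (Function.update (Function.update s i p.1) j p.2) := by
  classical
  simp only [Matrix.mulVec, dotProduct, onPair, Matrix.of_apply, ite_mul, zero_mul]
  rw [← Finset.sum_filter]
  refine Finset.sum_bij' (fun y _ => (y i, y j))
    (fun p _ => Function.update (Function.update s i p.1) j p.2) (by simp) ?_ ?_ ?_ ?_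
  · intro p _
    simp only [Finset.mem_filter, Finset.mem_univ, true_and]
    intro k hi hj
    simp [hi, hj]
  · intro y hy
    simp only [Finset.mem_filter, Finset.mem_univ, true_and] at hy
    funext k
    by_cases hj : k = j
    · subst hj; simp
    · by_cases hi : k = i
      · subst hi; simp [hj]
      · simp [hi, hj, hy k hi hj]
  · intro p _
    simp [hij]
  · intro y hy
    simp only [Finset.mem_filter, Finset.mem_univ, true_and] at hy
    congr 2
    funext k
    by_cases hj : k = j
    · subst hj; simp
    · by_cases hi : k = i
      · subst hi; simp [hj]
      · simp [hi, hj, hy k hi hj]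

/-- The configuration in which the values of two qubits are exchanged. -/
def flip (i j : Fin n) (s : Fin n → Fin 2) : Fin n → Fin 2 := fun k => s (Equiv.swap i j k)

theorem flip_eq_update {i j : Fin n} (s : Fin n → Fin 2) :
    flip i j s = Function.update (Function.update s i (s j)) j (s i) := by
  funext k
  unfold flip
  by_cases hj : k = j
  · subst hj; simp
  · by_cases hi : k = i
    · subst hi; simp [hj]
    · simp [hi, hj, Equiv.swap_apply_of_ne_of_ne]

@[simp] theorem flip_flip (i j : Fin n) (s : Fin n → Fin 2) : flip i j (flip i j s) = s := by
  funext k; simp [flip]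

@[simp] theorem flip_left (i j : Fin n) (s : Fin n → Fin 2) : flip i j s i = s j := by simp [flip]

@[simp] theorem flip_right (i j : Fin n) (s : Fin n → Fin 2) : flip i j s j = s i := by simp [flip]

theorem flip_of_ne {i j k : Fin n} (hi : k ≠ i) (hj : k ≠ j) (s : Fin n → Fin 2) :
    flip i j s k = s k := by simp [flip, Equiv.swap_apply_of_ne_of_ne hi hj]

theorem update_self_self (i j : Fin n) (s : Fin n → Fin 2) :
    Function.update (Function.update s i (s i)) j (s j) = s := by simp

/-- Four configurations agree with `s` off `i` and `j`. The matrix elements of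
$|\psi^+\rangle\langle\psi^+|$ vanish where the two values are equal, which leaves `s` and its
exchange, with equal coefficients. -/
theorem onPair_psiPlus_mulVec {i j : Fin n} (hij : i ≠ j) (x : (Fin n → Fin 2) → ℂ)
    (s : Fin n → Fin 2) : (onPair i j (proj psiPlus)).mulVec x s =
      if s i ≠ s j then (x s + x (flip i j s)) / 2 else 0 := by
  have h1 := update_self_self i j s
  have h2 := flip_eq_update (i := i) (j := j) s
  rw [onPair_mulVec hij]
  simp only [proj_psiPlus_apply, Fintype.sum_prod_type, Fin.sum_univ_two]
  generalize s i = a at *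
  generalize s j = b at *
  fin_cases a <;> fin_cases b <;> simp at h1 h2 ⊢ <;> rw [h1, h2] <;> ring

theorem onPair_psiMinus_mulVec {i j : Fin n} (hij : i ≠ j) (x : (Fin n → Fin 2) → ℂ)
    (s : Fin n → Fin 2) : (onPair i j (proj psiMinus)).mulVec x s =
      if s i ≠ s j then (x s - x (flip i j s)) / 2 else 0 := by
  have h1 := update_self_self i j s
  have h2 := flip_eq_update (i := i) (j := j) s
  rw [onPair_mulVec hij]
  simp only [proj_psiMinus_apply, Fintype.sum_prod_type, Fin.sum_univ_two]
  generalize s i = a at *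
  generalize s j = b at *
  fin_cases a <;> fin_cases b <;> simp at h1 h2 ⊢ <;> rw [h1, h2] <;> ring

/-- The Hilbert space of `n` qubits. -/
abbrev Qubits (n : ℕ) : Type := EuclideanSpace ℂ (Fin n → Fin 2)

/-- The projection `|ψ⁺⟩⟨ψ⁺|` of a pair of qubits. -/
def triplet (i j : Fin n) : Qubits n →ₗ[ℂ] Qubits n :=
  Matrix.toEuclideanLin (onPair i j (proj psiPlus))

/-- The projection `|ψ⁻⟩⟨ψ⁻|` of a pair of qubits. -/
def singlet (i j : Fin n) : Qubits n →ₗ[ℂ] Qubits n :=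
  Matrix.toEuclideanLin (onPair i j (proj psiMinus))

theorem triplet_apply {i j : Fin n} (hij : i ≠ j) (x : Qubits n) (s : Fin n → Fin 2) :
    triplet i j x s = if s i ≠ s j then (x s + x (flip i j s)) / 2 else 0 :=
  onPair_psiPlus_mulVec hij _ s

theorem singlet_apply {i j : Fin n} (hij : i ≠ j) (x : Qubits n) (s : Fin n → Fin 2) :
    singlet i j x s = if s i ≠ s j then (x s - x (flip i j s)) / 2 else 0 :=
  onPair_psiMinus_mulVec hij _ s

theorem onPair_isHermitian (i j : Fin n) {K : TwoQubitOp} (hK : K.IsHermitian) :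
    (onPair i j K).IsHermitian := by
  ext x y
  have := hK.apply (x i, x j) (y i, y j)
  simp only [onPair, Matrix.conjTranspose_apply, Matrix.of_apply]
  by_cases h : ∀ k, k ≠ i → k ≠ j → x k = y k
  · rw [if_pos h, if_pos fun k hi hj => (h k hi hj).symm]
    exact this
  · rw [if_neg h, if_neg fun h' => h fun k hi hj => (h' k hi hj).symm, star_zero]

theorem proj_isHermitian (ψ : Fin 2 × Fin 2 → ℂ) : (proj ψ).IsHermitian := by
  ext x y
  simp [proj, Matrix.vecMulVec_apply, mul_comm]

theorem triplet_isSymmetric (i j : Fin n) : (triplet i j).IsSymmetric :=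
  Matrix.isSymmetric_toEuclideanLin_iff.mpr (onPair_isHermitian i j (proj_isHermitian _))

theorem singlet_isSymmetric (i j : Fin n) : (singlet i j).IsSymmetric :=
  Matrix.isSymmetric_toEuclideanLin_iff.mpr (onPair_isHermitian i j (proj_isHermitian _))

theorem triplet_triplet {i j : Fin n} (hij : i ≠ j) (x : Qubits n) :
    triplet i j (triplet i j x) = triplet i j x := by
  ext s
  by_cases h : s i = s j
  · simp [triplet_apply hij, h]
  · simp [triplet_apply hij, h, Ne.symm h]; ring

theorem singlet_singlet {i j : Fin n} (hij : i ≠ j) (x : Qubits n) :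
    singlet i j (singlet i j x) = singlet i j x := by
  ext s
  by_cases h : s i = s j
  · simp [singlet_apply hij, h]
  · simp [singlet_apply hij, h, Ne.symm h]; ring

theorem flip_comm {i j a b : Fin n} (hia : i ≠ a) (hib : i ≠ b) (hja : j ≠ a) (hjb : j ≠ b)
    (s : Fin n → Fin 2) : flip i j (flip a b s) = flip a b (flip i j s) := by
  have : Equiv.Perm.Disjoint (Equiv.swap i j) (Equiv.swap a b) := by
    intro k
    by_cases h : k = i ∨ k = j
    · right
      rcases h with rfl | rfl
      · exact Equiv.swap_apply_of_ne_of_ne hia hib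
      · exact Equiv.swap_apply_of_ne_of_ne hja hjb
    · push Not at h
      left
      exact Equiv.swap_apply_of_ne_of_ne h.1 h.2
  funext k
  have := congrArg (fun σ : Equiv.Perm (Fin n) => s (σ k)) this.commute.eq
  exact this.symm

theorem triplet_comm_triplet {i j a b : Fin n} (hij : i ≠ j) (hab : a ≠ b) (hia : i ≠ a)
    (hib : i ≠ b) (hja : j ≠ a) (hjb : j ≠ b) (x : Qubits n) :
    triplet a b (triplet i j x) = triplet i j (triplet a b x) := by
  ext s
  simp only [triplet_apply hij, triplet_apply hab, flip_of_ne hia hib, flip_of_ne hja hjb,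
    flip_of_ne hia.symm hja.symm, flip_of_ne hib.symm hjb.symm, flip_comm hia hib hja hjb]
  split_ifs <;> ring

theorem triplet_comm_singlet {i j a b : Fin n} (hij : i ≠ j) (hab : a ≠ b) (hia : i ≠ a)
    (hib : i ≠ b) (hja : j ≠ a) (hjb : j ≠ b) (x : Qubits n) :
    triplet a b (singlet i j x) = singlet i j (triplet a b x) := by
  ext s
  simp only [singlet_apply hij, triplet_apply hab, flip_of_ne hia hib, flip_of_ne hja hjb,
    flip_of_ne hia.symm hja.symm, flip_of_ne hib.symm hjb.symm, flip_comm hia hib hja hjb]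
  split_ifs <;> ring

section FourQubits

variable {i j a b : Fin n}

/-- The configuration with prescribed values at four qubits. -/
def setFour (i j a b : Fin n) (s : Fin n → Fin 2) (p q c d : Fin 2) : Fin n → Fin 2 := fun k =>
  if k = i then p else if k = j then q else if k = a then c else if k = b then d else s k

theorem setFour_self (s : Fin n → Fin 2) : setFour i j a b s (s i) (s j) (s a) (s b) = s := by
  funext k
  unfold setFour
  split_ifs <;> simp_all

/-- Four different qubits. -/
structure Distinct (i j a b : Fin n) : Prop where
  ij : i ≠ j
  ia : i ≠ a
  ib : i ≠ b
  ja : j ≠ a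
  jb : j ≠ b
  ab : a ≠ b

theorem Distinct.symm (h : Distinct i j a b) : Distinct j i a b :=
  ⟨h.ij.symm, h.ja, h.jb, h.ia, h.ib, h.ab⟩

theorem setFour_apply (h : Distinct i j a b) (s : Fin n → Fin 2) (p q c d : Fin 2) :
    setFour i j a b s p q c d i = p ∧ setFour i j a b s p q c d j = q ∧
      setFour i j a b s p q c d a = c ∧ setFour i j a b s p q c d b = d := by
  simp [setFour, h.ij.symm, h.ia.symm, h.ib.symm, h.ja.symm, h.jb.symm, h.ab.symm]

theorem flip_setFour (h : Distinct i j a b) (s : Fin n → Fin 2) (p q c d : Fin 2) :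
    flip i j (setFour i j a b s p q c d) = setFour i j a b s q p c d ∧
    flip i a (setFour i j a b s p q c d) = setFour i j a b s c q p d ∧
    flip j a (setFour i j a b s p q c d) = setFour i j a b s p c q d ∧
    flip a b (setFour i j a b s p q c d) = setFour i j a b s p q d c := by
  obtain ⟨h1, h2, h3, h4, h5, h6⟩ := h
  refine ⟨?_, ?_, ?_, ?_⟩ <;> funext k <;> simp only [flip, setFour, Equiv.swap_apply_def] <;>
    split_ifs <;> simp_all

theorem singlet_setFour (h : Distinct i j a b) (x : Qubits n) (s : Fin n → Fin 2)
    (p q c d : Fin 2) : singlet i j x (setFour i j a b s p q c d) = if p ≠ q then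
      (x (setFour i j a b s p q c d) - x (setFour i j a b s q p c d)) / 2 else 0 := by
  rw [singlet_apply h.ij, (flip_setFour h s p q c d).1, (setFour_apply h s p q c d).1,
    (setFour_apply h s p q c d).2.1]

theorem triplet_setFour (h : Distinct i j a b) (x : Qubits n) (s : Fin n → Fin 2)
    (p q c d : Fin 2) :
    (triplet i a x (setFour i j a b s p q c d) = if p ≠ c then
      (x (setFour i j a b s p q c d) + x (setFour i j a b s c q p d)) / 2 else 0) ∧
    (triplet j a x (setFour i j a b s p q c d) = if q ≠ c then
      (x (setFour i j a b s p q c d) + x (setFour i j a b s p c q d)) / 2 else 0) ∧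
    (triplet a b x (setFour i j a b s p q c d) = if c ≠ d then
      (x (setFour i j a b s p q c d) + x (setFour i j a b s p q d c)) / 2 else 0) := by
  obtain ⟨e1, e2, e3, e4⟩ := setFour_apply h s p q c d
  obtain ⟨f1, f2, f3, f4⟩ := flip_setFour h s p q c d
  rw [triplet_apply h.ia, triplet_apply h.ja, triplet_apply h.ab, f2, f3, f4, e1, e2, e3, e4]
  exact ⟨rfl, rfl, rfl⟩

/-- Compression of one coupling to the triplet state of the ancillas. -/
theorem triplet_compress (h : Distinct i j a b) (x : Qubits n) :
    triplet a b (triplet i a (triplet a b x)) = (1 / 4 : ℂ) • triplet a b x := by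
  ext s
  rw [PiLp.smul_apply, ← setFour_self (i := i) (j := j) (a := a) (b := b) s]
  generalize s i = p
  generalize s j = q
  generalize s a = c
  generalize s b = d
  simp only [(triplet_setFour h _ _ _ _ _ _).1, (triplet_setFour h _ _ _ _ _ _).2.2]
  fin_cases p <;> fin_cases c <;> fin_cases d <;> simp <;> ring

/-- Compression of the product of two couplings to the triplet state of the ancillas. -/
theorem triplet_compress_mul (h : Distinct i j a b) (x : Qubits n) :
    triplet a b (triplet i a (triplet j a (triplet a b x))) +
      triplet a b (triplet j a (triplet i a (triplet a b x))) =
      (1 / 4 : ℂ) • (triplet a b x - (2 : ℂ) • singlet i j (triplet a b x)) := by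
  -- In Pauli terms each coupling is $\frac14(1+XX+YY-ZZ)$. In the anticommutator distinct Pauli
  -- matrices on `a` cancel, and terms with a single one are killed by the maximally mixed half of
  -- the Bell pair. What remains is $\frac18(1+XX+YY+ZZ)$ on `i`, `j`, a quarter of the swap, or
  -- $\frac14(1-2|\psi^-\rangle\langle\psi^-|)$. The verification below is by cases on the four
  -- qubits.
  ext s
  rw [PiLp.smul_apply, PiLp.add_apply, PiLp.sub_apply, PiLp.smul_apply,
    ← setFour_self (i := i) (j := j) (a := a) (b := b) s]
  generalize s i = p
  generalize s j = q
  generalize s a = c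
  generalize s b = d
  simp only [(triplet_setFour h _ _ _ _ _ _).1, (triplet_setFour h _ _ _ _ _ _).2.1,
    (triplet_setFour h _ _ _ _ _ _).2.2, singlet_setFour h]
  fin_cases p <;> fin_cases q <;> fin_cases c <;> fin_cases d <;> simp <;> ring

end FourQubits

end ToyModel

end

noncomputable section

namespace ToyModel

open RCLike
open scoped InnerProductSpace

/-! ### Second-order perturbation theory of the gadgets -/

section Perturbation

variable {E : Type*} [NormedAddCommGroup E] [InnerProductSpace ℂ E]

/-- The quadratic form of an operator. -/
def form (T : E →ₗ[ℂ] E) (x : E) : ℝ := re ⟪x, T x⟫_ℂ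

theorem form_add (T : E →ₗ[ℂ] E) (hT : T.IsSymmetric) (x y : E) :
    form T (x + y) = form T x + 2 * re ⟪y, T x⟫_ℂ + form T y := by
  have h : re ⟪x, T y⟫_ℂ = re ⟪y, T x⟫_ℂ := by
    rw [← hT x y, ← inner_conj_symm, conj_re]
  simp only [form, map_add, inner_add_left, inner_add_right]
  rw [h]
  ring

theorem form_map_add (T S : E →ₗ[ℂ] E) (x : E) : form (T + S) x = form T x + form S x := by
  simp [form]

theorem form_smul (c : ℝ) (T : E →ₗ[ℂ] E) (x : E) : form ((c : ℂ) • T) x = c * form T x := by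
  simp [form]

/-- Orthogonal projections. -/
structure IsProj (P : E →ₗ[ℂ] E) : Prop where
  symm : P.IsSymmetric
  idem : ∀ x, P (P x) = P x

namespace IsProj

variable {P : E →ₗ[ℂ] E}

theorem inner_eq_zero (hP : IsProj P) {x y : E} (hx : P x = 0) (hy : P y = y) : ⟪x, y⟫_ℂ = 0 := by
  rw [← hy, ← hP.symm, hx, inner_zero_left]

theorem map_sub (hP : IsProj P) (x : E) : P (x - P x) = 0 := by rw [_root_.map_sub, hP.idem, sub_self]

theorem form_eq (hP : IsProj P) (x : E) : form P x = ‖P x‖ ^ 2 := by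
  rw [form, ← hP.idem, ← hP.symm, hP.idem, inner_self_eq_norm_sq (𝕜 := ℂ)]

theorem norm_sq_eq (hP : IsProj P) (x : E) : ‖x‖ ^ 2 = ‖P x‖ ^ 2 + ‖x - P x‖ ^ 2 := by
  have h : ⟪P x, x - P x⟫_ℂ = 0 := by
    rw [← inner_conj_symm, hP.inner_eq_zero (hP.map_sub x) (hP.idem x), map_zero]
  have := norm_add_sq_eq_norm_sq_add_norm_sq_of_inner_eq_zero _ _ h
  rw [add_sub_cancel] at this
  linarith

theorem form_nonneg (hP : IsProj P) (x : E) : 0 ≤ form P x := by rw [hP.form_eq]; positivity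

theorem form_le (hP : IsProj P) (x : E) : form P x ≤ ‖x‖ ^ 2 := by
  rw [hP.form_eq, hP.norm_sq_eq x]
  nlinarith [sq_nonneg ‖x - P x‖]

end IsProj

/-- The couplings of two qubits to a pair of ancillas: `P` is the projection to the ground state of
the ancillas, and `B` is the interaction between the two qubits that the couplings mediate. -/
structure IsGadget (P A₁ A₂ B : E →ₗ[ℂ] E) : Prop where
  proj : IsProj P
  proj₁ : IsProj A₁
  proj₂ : IsProj A₂
  projB : IsProj B
  comm : ∀ x, P (B x) = B (P x)
  compress₁ : ∀ x, P (A₁ (P x)) = (1 / 4 : ℂ) • P x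
  compress₂ : ∀ x, P (A₂ (P x)) = (1 / 4 : ℂ) • P x
  compress₁₂ : ∀ x, P (A₁ (A₂ (P x))) + P (A₂ (A₁ (P x))) = (1 / 4 : ℂ) • (P x - (2 : ℂ) • B (P x))

namespace IsGadget

variable {P A₁ A₂ B : E →ₗ[ℂ] E}

theorem map_coupling (h : IsGadget P A₁ A₂ B) {u : E} (hu : P u = u) : P ((A₁ + A₂) u) = (1 / 2 : ℂ) • u := by
  have h1 := h.compress₁ u
  have h2 := h.compress₂ u
  rw [hu] at h1 h2
  rw [LinearMap.add_apply, map_add, h1, h2, ← add_smul]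
  norm_num

theorem coupling_symm (h : IsGadget P A₁ A₂ B) : (A₁ + A₂).IsSymmetric := h.proj₁.symm.add h.proj₂.symm

theorem form_coupling (h : IsGadget P A₁ A₂ B) {u : E} (hu : P u = u) : form (A₁ + A₂) u = 1 / 2 * ‖u‖ ^ 2 := by
  have h1 : ⟪u, (A₁ + A₂) u⟫_ℂ = ⟪u, P ((A₁ + A₂) u)⟫_ℂ := by
    rw [← h.proj.symm, hu]
  rw [form, h1, h.map_coupling hu, inner_smul_right, show (1 / 2 : ℂ) = ((1 / 2 : ℝ) : ℂ) by norm_num,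
    ← inner_self_eq_norm_sq (𝕜 := ℂ) u]
  exact Complex.re_ofReal_mul _ _

/-- The source of the second-order energy. As `A₁` and `A₂` are idempotent, the square of `A₁ + A₂`
is `A₁ + A₂ + A₁ A₂ + A₂ A₁`, and the compression identities evaluate it on `u`. Subtracting the
squared norm $\frac14\|u\|^2$ of the part that stays in the range of `P` leaves the excited part. -/
theorem norm_coupling_sub (h : IsGadget P A₁ A₂ B) {u : E} (hu : P u = u) :
    ‖(A₁ + A₂) u - P ((A₁ + A₂) u)‖ ^ 2 = 1 / 2 * (‖u‖ ^ 2 - form B u) := by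
  have h1 := h.proj.norm_sq_eq ((A₁ + A₂) u)
  have h2 : ‖P ((A₁ + A₂) u)‖ ^ 2 = 1 / 4 * ‖u‖ ^ 2 := by
    rw [h.map_coupling hu, norm_smul, mul_pow]
    norm_num
  have h3 : ‖(A₁ + A₂) u‖ ^ 2 = form (A₁ + A₂) u + re ⟪u, A₁ (A₂ u) + A₂ (A₁ u)⟫_ℂ := by
    rw [← inner_self_eq_norm_sq (𝕜 := ℂ), h.coupling_symm, form, ← map_add, ← inner_add_right]
    simp only [LinearMap.add_apply, map_add, h.proj₁.idem, h.proj₂.idem]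
    congr 2
    abel
  have h4 : re ⟪u, A₁ (A₂ u) + A₂ (A₁ u)⟫_ℂ = 1 / 4 * (‖u‖ ^ 2 - 2 * form B u) := by
    have h5 := h.compress₁₂ u
    rw [hu, ← map_add] at h5
    have h6 : ⟪u, A₁ (A₂ u) + A₂ (A₁ u)⟫_ℂ = ⟪u, P (A₁ (A₂ u) + A₂ (A₁ u))⟫_ℂ := by
      rw [← h.proj.symm, hu]
    rw [h6, h5, inner_smul_right, inner_sub_right, inner_smul_right, form]
    rw [show (1 / 4 : ℂ) = ((1 / 4 : ℝ) : ℂ) by norm_num, show (2 : ℂ) = ((2 : ℝ) : ℂ) by norm_num]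
    have := inner_self_eq_norm_sq (𝕜 := ℂ) u
    simp only [re_to_complex, Complex.re_ofReal_mul, Complex.sub_re] at this ⊢
    rw [this]
  rw [h.form_coupling hu] at h3
  linarith

theorem form_coupling_le (h : IsGadget P A₁ A₂ B) (x : E) : form (A₁ + A₂) x ≤ 2 * ‖x‖ ^ 2 := by
  rw [form_map_add]
  linarith [h.proj₁.form_le x, h.proj₂.form_le x]

theorem form_coupling_nonneg (h : IsGadget P A₁ A₂ B) (x : E) : 0 ≤ form (A₁ + A₂) x := by
  rw [form_map_add]
  linarith [h.proj₁.form_nonneg x, h.proj₂.form_nonneg x]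

/-- The lower bound of perturbation theory, for one gadget. -/
theorem lower_bound (h : IsGadget P A₁ A₂ B) {N : ℝ} (hN : 3 ≤ N) (x : E) :
    form B x - (N + 1 + 3 / N) * ‖x‖ ^ 2 ≤
      2 * N ^ 2 * (‖x‖ ^ 2 - form P x) - 2 * N * form (A₁ + A₂) x := by
  have hu : P (P x) = P x := h.proj.idem x
  have hv := h.proj.map_sub x
  have hx : P x + (x - P x) = x := add_sub_cancel _ _
  have e1 := form_add _ h.coupling_symm (P x) (x - P x)
  have e2 := form_add _ h.projB.symm (P x) (x - P x)
  rw [hx] at e1 e2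
  -- `B` commutes with `P`, so its form has no cross term. In the cross term of the couplings only
  -- the part that leaves the range of `P` contributes.
  have e3 : ⟪x - P x, B (P x)⟫_ℂ = 0 :=
    h.proj.inner_eq_zero hv (by rw [h.comm, hu])
  rw [e3, map_zero, mul_zero, add_zero] at e2
  have e4 : ⟪x - P x, (A₁ + A₂) (P x)⟫_ℂ =
      ⟪x - P x, (A₁ + A₂) (P x) - P ((A₁ + A₂) (P x))⟫_ℂ := by
    rw [inner_sub_right, h.proj.inner_eq_zero hv (h.proj.idem _), sub_zero]
  have e5 := re_inner_le_norm (𝕜 := ℂ) (x - P x) ((A₁ + A₂) (P x) - P ((A₁ + A₂) (P x)))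
  rw [← e4] at e5
  have e6 := h.norm_coupling_sub hu
  have e7 := h.form_coupling hu
  have e8 := h.form_coupling_le (x - P x)
  have e9 := h.projB.form_le (x - P x)
  have e10 := h.projB.form_nonneg (P x)
  have e11 := h.proj.norm_sq_eq x
  rw [h.proj.form_eq, e1, e2, e7, e11]
  set W := ‖(A₁ + A₂) (P x) - P ((A₁ + A₂) (P x))‖
  set V := ‖x - P x‖
  set a := ‖P x‖ ^ 2
  set r := re ⟪x - P x, (A₁ + A₂) (P x)⟫_ℂ
  have hN0 : 0 < N := by linarith
  -- After all substitutions this is what has to be shown. Without `- 3 * N` the first three terms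
  -- would be $2(NV-W)^2$. The coefficient collects $-4N$ from the couplings on the excited part and
  -- $+N$ from the energy shift there. The deficit is paid by the term $3/N$, as $2W^2\le a$; the
  -- remaining square completion needs $6N-18\ge 0$.
  have key : 0 ≤ (2 * N ^ 2 - 3 * N) * V ^ 2 - 4 * N * (V * W) + 2 * W ^ 2 + 3 / N * a := by
    have h1 : 2 * W ^ 2 ≤ a := by linarith
    have h2 : 3 / N * (2 * W ^ 2) ≤ 3 / N * a := mul_le_mul_of_nonneg_left h1 (by positivity)
    have h3 : 0 ≤ (2 * N ^ 2 - 3 * N) * V ^ 2 - 4 * N * (V * W) + 2 * W ^ 2 + 3 / N * (2 * W ^ 2) := by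
      have h4 : (2 * N ^ 2 - 3 * N) * V ^ 2 - 4 * N * (V * W) + 2 * W ^ 2 + 3 / N * (2 * W ^ 2) =
          (((2 * N - 3) * (N * V) - 2 * N * W) ^ 2 + (6 * N - 18) * W ^ 2) / (N * (2 * N - 3)) := by
        have : 2 * N - 3 ≠ 0 := by linarith
        field_simp
        ring
      rw [h4]
      have : 0 < 2 * N - 3 := by linarith
      have : 0 ≤ 6 * N - 18 := by linarith
      positivity
    linarith
  have h5 : 4 * N * r ≤ 4 * N * (V * W) := mul_le_mul_of_nonneg_left e5 (by positivity)
  have h6 : 2 * N * form (A₁ + A₂) (x - P x) ≤ 2 * N * (2 * V ^ 2) :=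
    mul_le_mul_of_nonneg_left e8 (by positivity)
  have h7 : 0 ≤ 3 / N * V ^ 2 := by positivity
  have h8 : form B (P x) = a - 2 * W ^ 2 := by linarith
  have h9 : 0 ≤ N * V ^ 2 := by positivity
  nlinarith

end IsGadget

/-- The upper bound of perturbation theory, for several gadgets. -/
theorem exists_trial_state {ι : Type*} [Fintype ι] {P A₁ A₂ B : ι → E →ₗ[ℂ] E} {X : E →ₗ[ℂ] E}
    (h : ∀ k, IsGadget (P k) (A₁ k) (A₂ k) (B k)) (hX : X.IsSymmetric) (hX0 : ∀ x, form X x ≤ 0)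
    {u : E} (hu : ∀ k, P k u = u) (hXu : ∀ k, P k (X u) = X u)
    (hcomm : ∀ k l, k ≠ l → ∀ x, P l ((A₁ k + A₂ k) x) = (A₁ k + A₂ k) (P l x))
    (hPP : ∀ k l x, P l (P k x) = P k (P l x)) {g : ι → ℝ} (hg : ∀ k, 0 ≤ g k) {N : ℝ} (hN : 0 < N) :
    ∃ y : E, ‖u‖ ^ 2 ≤ ‖y‖ ^ 2 ∧ ‖y‖ ^ 2 ≤ (1 + Fintype.card ι / (2 * N ^ 2)) * ‖u‖ ^ 2 ∧
      form X y + ∑ k, g k * (2 * N ^ 2 * (‖y‖ ^ 2 - form (P k) y) - 2 * N * form (A₁ k + A₂ k) y) ≤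
        form X u + ∑ k, g k * (form (B k) u - (N + 1) * ‖u‖ ^ 2) := by
  classical
  let C k := A₁ k + A₂ k
  let w k := C k u - P k (C k u)
  -- First-order correction of the state: coupling `2 * N` divided by excitation energy `2 * N ^ 2`.
  let v : E := ((1 / N : ℝ) : ℂ) • ∑ k, w k
  have hCu : ∀ k l, k ≠ l → P l (C k u) = C k u := fun k l hkl => by
    rw [hcomm k l hkl, hu]
  have hw : ∀ k, P k (w k) = 0 := fun k => (h k).proj.map_sub _
  -- Exciting gadget `k` leaves the ancillas of every other gadget in their ground state. Hence the
  -- corrections are mutually orthogonal, and no interaction between gadgets arises at this order.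
  have hw' : ∀ k l, k ≠ l → P l (w k) = w k := fun k l hkl => by
    simp only [w, map_sub, hCu k l hkl, hPP k l]
  have hortho : ∀ l z, P l z = z → ⟪w l, z⟫_ℂ = 0 := fun l z hz => (h l).proj.inner_eq_zero (hw l) hz
  have hwC : ∀ k l, ⟪w l, C k u⟫_ℂ = if l = k then ((‖w k‖ ^ 2 : ℝ) : ℂ) else 0 := by
    intro k l
    split_ifs with hkl
    · subst hkl
      have : C l u = w l + P l (C l u) := (sub_add_cancel _ _).symm
      rw [this, inner_add_right, hortho l _ ((h l).proj.idem _), add_zero,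
        inner_self_eq_norm_sq_to_K]
      norm_cast
    · exact hortho l _ (hCu k l (Ne.symm hkl))
  have hww : ∀ k l, ⟪w l, w k⟫_ℂ = if l = k then ((‖w k‖ ^ 2 : ℝ) : ℂ) else 0 := by
    intro k l
    split_ifs with hkl
    · subst hkl
      rw [inner_self_eq_norm_sq_to_K]
      norm_cast
    · exact hortho l _ (hw' k l (Ne.symm hkl))
  have hv : ∀ z, re ⟪v, z⟫_ℂ = 1 / N * ∑ k, re ⟪w k, z⟫_ℂ := by
    intro z
    simp only [v, inner_smul_left, sum_inner, Complex.conj_ofReal, re_to_complex,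
      Complex.re_ofReal_mul, Complex.re_sum]
  have hnormv : ‖v‖ ^ 2 = 1 / N ^ 2 * ∑ k, ‖w k‖ ^ 2 := by
    rw [← inner_self_eq_norm_sq (𝕜 := ℂ), hv, Finset.mul_sum, Finset.mul_sum]
    refine Finset.sum_congr rfl fun k _ => ?_
    simp only [v, inner_smul_right, inner_sum, hww]
    simp [-Complex.ofReal_pow]
    ring
  have hwn : ∀ k, ‖w k‖ ^ 2 = 1 / 2 * (‖u‖ ^ 2 - form (B k) u) := fun k =>
    (h k).norm_coupling_sub (hu k)
  have hwle : ∀ k, ‖w k‖ ^ 2 ≤ 1 / 2 * ‖u‖ ^ 2 := fun k => by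
    have := (h k).projB.form_nonneg u
    rw [hwn]
    linarith
  have hortho_uv : ⟪u, v⟫_ℂ = 0 := by
    simp only [v, inner_smul_right, inner_sum]
    rw [Finset.sum_eq_zero, mul_zero]
    intro k _
    rw [← inner_conj_symm, hortho k u (hu k), map_zero]
  have hnorm : ‖u + v‖ ^ 2 = ‖u‖ ^ 2 + ‖v‖ ^ 2 := by
    have := norm_add_sq_eq_norm_sq_add_norm_sq_of_inner_eq_zero _ _ hortho_uv
    linarith
  -- The cross term vanishes because `X u` stays in the range of every `P k`, and the energy of `v`
  -- can be dropped because `X` is nonpositive.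
  have hXv : form X (u + v) ≤ form X u := by
    have h1 : re ⟪v, X u⟫_ℂ = 0 := by
      rw [hv, Finset.sum_eq_zero, mul_zero]
      intro k _
      rw [hortho k _ (hXu k), map_zero]
    rw [form_add X hX, h1]
    linarith [hX0 v]
  have hPv : ∀ k, P k (u + v) = u + v - ((1 / N : ℝ) : ℂ) • w k := by
    intro k
    have h1 : P k (∑ l, w l) = ∑ l, w l - w k := by
      rw [map_sum, ← Finset.add_sum_erase _ _ (Finset.mem_univ k), hw, zero_add,
        ← Finset.add_sum_erase _ w (Finset.mem_univ k), add_sub_cancel_left]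
      exact Finset.sum_congr rfl fun l hl => hw' l k (Finset.ne_of_mem_erase hl)
    rw [map_add, hu, map_smul, h1, smul_sub]
    simp only [v]
    abel
  have hPform : ∀ k, ‖u + v‖ ^ 2 - form (P k) (u + v) = 1 / N ^ 2 * ‖w k‖ ^ 2 := by
    intro k
    have h1 := (h k).proj.norm_sq_eq (u + v)
    rw [(h k).proj.form_eq]
    have h2 : u + v - P k (u + v) = ((1 / N : ℝ) : ℂ) • w k := by rw [hPv]; abel
    rw [h2, norm_smul, mul_pow] at h1
    have h3 : ‖((1 / N : ℝ) : ℂ)‖ ^ 2 = 1 / N ^ 2 := by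
      rw [Complex.norm_real, Real.norm_eq_abs, sq_abs]
      ring
    rw [h3] at h1
    linarith
  -- The contribution of `v` alone is nonnegative and is dropped. Multiplied by `- 2 * N`, the cross
  -- term gives $-4\|w_k\|^2$ against an excitation cost of $2\|w_k\|^2$, a net second-order energy
  -- of $-2\|w_k\|^2$.
  have hCform : ∀ k, 1 / 2 * ‖u‖ ^ 2 + 2 / N * ‖w k‖ ^ 2 ≤ form (C k) (u + v) := by
    intro k
    rw [form_add _ (h k).coupling_symm, (h k).form_coupling (hu k), hv]
    have h1 : ∑ l, re ⟪w l, C k u⟫_ℂ = ‖w k‖ ^ 2 := by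
      rw [Finset.sum_eq_single k]
      · rw [hwC, if_pos rfl]; simp only [re_to_complex, Complex.ofReal_re]
      · intro l _ hl
        rw [hwC, if_neg hl, map_zero]
      · simp
    have h2 := (h k).form_coupling_nonneg v
    have h3 : 2 * (1 / N * ∑ l, re ⟪w l, C k u⟫_ℂ) = 2 / N * ‖w k‖ ^ 2 := by rw [h1]; ring
    simp only [C] at h3 ⊢
    linarith
  refine ⟨u + v, ?_, ?_, ?_⟩
  · rw [hnorm]
    nlinarith [sq_nonneg ‖v‖]
  · have h1 : ∑ k, ‖w k‖ ^ 2 ≤ Fintype.card ι * (1 / 2 * ‖u‖ ^ 2) := by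
      refine (Finset.sum_le_sum fun k _ => hwle k).trans ?_
      simp
    have h2 : 1 / N ^ 2 * ∑ k, ‖w k‖ ^ 2 ≤ 1 / N ^ 2 * (Fintype.card ι * (1 / 2 * ‖u‖ ^ 2)) :=
      mul_le_mul_of_nonneg_left h1 (by positivity)
    rw [hnorm, hnormv, add_mul, one_mul]
    refine add_le_add_right (h2.trans (le_of_eq ?_)) _
    field_simp
  · refine add_le_add hXv (Finset.sum_le_sum fun k _ => mul_le_mul_of_nonneg_left ?_ (hg k))
    have h1 := hCform k
    have h2 : 2 * N * (1 / 2 * ‖u‖ ^ 2 + 2 / N * ‖w k‖ ^ 2) ≤ 2 * N * form (C k) (u + v) :=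
      mul_le_mul_of_nonneg_left h1 (by positivity)
    have h3 : 2 * N * (1 / 2 * ‖u‖ ^ 2 + 2 / N * ‖w k‖ ^ 2) = N * ‖u‖ ^ 2 + 4 * ‖w k‖ ^ 2 := by
      field_simp
      ring
    have h4 : 2 * N ^ 2 * (1 / N ^ 2 * ‖w k‖ ^ 2) = 2 * ‖w k‖ ^ 2 := by
      field_simp
    have h5 := hwn k
    rw [hPform, h4]
    simp only [C] at h2 h3
    linarith

end Perturbation

end ToyModel

end

/-! ### Variational characterisation of energies, and spectator qubits -/

noncomputable section

namespace ToyModel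

open RCLike
open scoped InnerProductSpace

/-! ### Ground-state energies -/

/-- In finite dimension the infimum of the Rayleigh quotient is an eigenvalue. To compare it with a
particular vector, the quotients must be known to be bounded below; minus the operator norm is a
lower bound. -/
theorem exists_least_eigenvalue {E : Type*} [NormedAddCommGroup E] [InnerProductSpace ℂ E]
    [FiniteDimensional ℂ E] [Nontrivial E] {T : E →ₗ[ℂ] E} (hT : T.IsSymmetric) :
    ∃ μ : ℝ, Module.End.HasEigenvalue T (μ : ℂ) ∧ ∀ x, μ * ‖x‖ ^ 2 ≤ form T x := by
  refine ⟨_, hT.hasEigenvalue_iInf_of_finiteDimensional, fun x => ?_⟩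
  by_cases hx : x = 0
  · simp [hx, form]
  · have hpos : 0 < ‖x‖ ^ 2 := by positivity
    rw [← le_div_iff₀ hpos]
    have hb : BddBelow (Set.range fun x : {x : E // x ≠ 0} => re ⟪T x, (x : E)⟫_ℂ / ‖(x : E)‖ ^ 2) := by
      refine ⟨-‖LinearMap.toContinuousLinearMap T‖, ?_⟩
      rintro _ ⟨⟨y, hy⟩, rfl⟩
      have hpos : 0 < ‖y‖ ^ 2 := by positivity
      dsimp only
      rw [le_div_iff₀ hpos]
      have h1 := (abs_le.mp (abs_re_le_norm ⟪T y, y⟫_ℂ)).1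
      have h2 := norm_inner_le_norm (𝕜 := ℂ) (T y) y
      have h3 := (LinearMap.toContinuousLinearMap T).le_opNorm y
      rw [LinearMap.coe_toContinuousLinearMap'] at h3
      have h4 := mul_le_mul_of_nonneg_right h3 (norm_nonneg y)
      nlinarith
    refine (ciInf_le hb ⟨x, hx⟩).trans (le_of_eq ?_)
    rw [form, hT]

theorem form_eigenvector {E : Type*} [NormedAddCommGroup E] [InnerProductSpace ℂ E]
    {T : E →ₗ[ℂ] E} {μ : ℝ} {x : E} (h : T x = (μ : ℂ) • x) : form T x = μ * ‖x‖ ^ 2 := by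
  rw [form, h, inner_smul_right, ← inner_self_eq_norm_sq (𝕜 := ℂ) x]
  exact Complex.re_ofReal_mul _ _

theorem exists_of_hasEigenvalue {E : Type*} [NormedAddCommGroup E] [InnerProductSpace ℂ E]
    {T : E →ₗ[ℂ] E} {μ : ℝ} (h : Module.End.HasEigenvalue T (μ : ℂ)) :
    ∃ x, x ≠ 0 ∧ T x = (μ : ℂ) • x := by
  obtain ⟨x, hx⟩ := h.exists_hasEigenvector
  exact ⟨x, hx.2, Module.End.mem_eigenspace_iff.mp hx.1⟩

theorem hasEigenvalue_toLin'_iff {ι : Type} [Fintype ι] [DecidableEq ι] (H : Matrix ι ι ℂ) (c : ℂ) :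
    Module.End.HasEigenvalue (Matrix.toLin' H) c ↔
      Module.End.HasEigenvalue (Matrix.toEuclideanLin H) c := by
  constructor
  · intro h
    obtain ⟨x, hx⟩ := h.exists_hasEigenvector
    refine Module.End.hasEigenvalue_of_hasEigenvector (x := WithLp.toLp 2 x) ⟨?_, ?_⟩
    · rw [Module.End.mem_eigenspace_iff]
      exact congrArg (WithLp.toLp 2) (Module.End.mem_eigenspace_iff.mp hx.1)
    · intro h0
      exact hx.2 (congrArg WithLp.ofLp h0)
  · intro h
    obtain ⟨x, hx⟩ := h.exists_hasEigenvector
    refine Module.End.hasEigenvalue_of_hasEigenvector (x := x.ofLp) ⟨?_, ?_⟩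
    · rw [Module.End.mem_eigenspace_iff]
      exact congrArg WithLp.ofLp (Module.End.mem_eigenspace_iff.mp hx.1)
    · intro h0
      exact hx.2 (congrArg (WithLp.toLp 2) h0)

/-- Replaces the infimum over eigenvalues by its two useful properties: it is attained by an
eigenvector, and it bounds the quadratic form from below. The energy estimates of the reduction rest
on these. -/
theorem groundEnergy_spec {ι : Type} [Fintype ι] [DecidableEq ι] [Nonempty ι] {H : Matrix ι ι ℂ}
    (hH : H.IsHermitian) :
    (∃ x, x ≠ 0 ∧ Matrix.toEuclideanLin H x = (groundEnergy H : ℂ) • x) ∧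
      ∀ x, groundEnergy H * ‖x‖ ^ 2 ≤ form (Matrix.toEuclideanLin H) x := by
  obtain ⟨μ, h1, h2⟩ := exists_least_eigenvalue (Matrix.isSymmetric_toEuclideanLin_iff.mpr hH)
  have h3 : IsLeast {E : ℝ | Module.End.HasEigenvalue (Matrix.toLin' H) (E : ℂ)} μ := by
    refine ⟨(hasEigenvalue_toLin'_iff H _).mpr h1, fun c hc => ?_⟩
    obtain ⟨x, hx, hx'⟩ := exists_of_hasEigenvalue ((hasEigenvalue_toLin'_iff H _).mp hc)
    have h4 := h2 x
    rw [form_eigenvector hx'] at h4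
    exact le_of_mul_le_mul_right h4 (by positivity)
  have h4 : groundEnergy H = μ := h3.csInf_eq
  rw [h4]
  exact ⟨exists_of_hasEigenvalue h1, h2⟩

/-! ### The Hamiltonians -/

theorem onPair_J {n : ℕ} (i j : Fin n) (s : ℝ) :
    Matrix.toEuclideanLin (onPair i j (J s)) = ((-s : ℝ) : ℂ) • singlet i j - triplet i j := by
  have : onPair i j (J s) = ((-s : ℝ) : ℂ) • onPair i j (proj psiMinus) - onPair i j (proj psiPlus) := by
    ext x y
    simp only [onPair, J, Matrix.of_apply, Matrix.sub_apply, Matrix.smul_apply, smul_eq_mul]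
    split_ifs <;> simp
  rw [this, map_sub, map_smul]
  rfl

theorem J_isHermitian (s : ℝ) : (J s).IsHermitian := by
  unfold J
  refine Matrix.IsHermitian.sub ?_ (proj_isHermitian _)
  have := proj_isHermitian psiMinus
  ext x y
  have h := this.apply x y
  simp only [Matrix.conjTranspose_apply, Matrix.smul_apply, star_smul, h]
  simp

theorem hamiltonian_isHermitian (I : Inst) {K : TwoQubitOp} (hK : K.IsHermitian) :
    (I.hamiltonian K).IsHermitian := by
  unfold Inst.hamiltonian
  induction I.edges with
  | nil => exact Matrix.isHermitian_zero
  | cons e l ih =>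
    rw [List.map_cons, List.sum_cons]
    refine Matrix.IsHermitian.add ?_ ih
    ext x y
    have h := (onPair_isHermitian e.fst e.snd hK).apply x y
    simp only [Matrix.conjTranspose_apply, Matrix.smul_apply, star_smul, h]
    simp

theorem form_hamiltonian (I : Inst) (s : ℝ) (x : Qubits I.n) :
    form (Matrix.toEuclideanLin (I.hamiltonian (J s))) x = (I.edges.map fun e =>
      (e.weight.val : ℝ) * (-s * form (singlet e.fst e.snd) x - form (triplet e.fst e.snd) x)).sum := by
  unfold Inst.hamiltonian
  induction I.edges with
  | nil => simp [form]
  | cons e l ih =>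
    rw [List.map_cons, List.sum_cons, List.map_cons, List.sum_cons, map_add, form_map_add, ih,
      map_smul, onPair_J]
    congr 1
    have h : ((e.weight.val : ℚ) : ℂ) = (((e.weight.val : ℚ) : ℝ) : ℂ) := by norm_cast
    rw [h, form_smul, sub_eq_add_neg, form_map_add, form_smul]
    have h2 : form (-triplet e.fst e.snd) x = -form (triplet e.fst e.snd) x := by
      simp [form]
    rw [h2]
    ring

/-! ### Qubits that are not acted upon -/

section Slice

variable {n r : ℕ}

/-- The state of the first `n` qubits for a given configuration of the other qubits. -/
def slice (z : Fin r → Fin 2) : Qubits (n + r) →ₗ[ℂ] Qubits n where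
  toFun x := WithLp.toLp 2 fun s => x (Fin.append s z)
  map_add' _ _ := rfl
  map_smul' _ _ := rfl

theorem slice_apply (z : Fin r → Fin 2) (x : Qubits (n + r)) (s : Fin n → Fin 2) :
    slice z x s = x (Fin.append s z) := rfl

theorem ext_slice {x y : Qubits (n + r)} (h : ∀ z : Fin r → Fin 2, slice z x = slice z y) : x = y := by
  ext s
  have := congrArg (fun v : Qubits n => v fun i => s (Fin.castAdd r i)) (h fun i => s (Fin.natAdd n i))
  simpa only [slice_apply, Fin.append_castAdd_natAdd] using this

/-- The slices split the space into an orthogonal sum of copies of the space of the first `n`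
qubits. An operator on those qubits acts on each copy separately, so adding spectators does not
lower its ground-state energy. -/
theorem inner_eq_sum_slice (x y : Qubits (n + r)) :
    ⟪x, y⟫_ℂ = ∑ z : Fin r → Fin 2, ⟪slice z x, slice z y⟫_ℂ := by
  simp only [PiLp.inner_apply, slice_apply]
  rw [← (Fin.appendEquiv n r).sum_comp, Fintype.sum_prod_type, Finset.sum_comm]
  rfl

theorem form_eq_sum_slice {T' : Qubits (n + r) →ₗ[ℂ] Qubits (n + r)} {T : Qubits n →ₗ[ℂ] Qubits n}
    (h : ∀ z x, slice z (T' x) = T (slice z x)) (x : Qubits (n + r)) :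
    form T' x = ∑ z, form T (slice z x) := by
  simp only [form, inner_eq_sum_slice x, h, map_sum]

theorem norm_sq_eq_sum_slice (x : Qubits (n + r)) :
    ‖x‖ ^ 2 = ∑ z : Fin r → Fin 2, ‖slice z x‖ ^ 2 := by
  simp only [← inner_self_eq_norm_sq (𝕜 := ℂ), inner_eq_sum_slice x, map_sum]

theorem flip_append (i j : Fin n) (s : Fin n → Fin 2) (z : Fin r → Fin 2) :
    flip (Fin.castAdd r i) (Fin.castAdd r j) (Fin.append s z) = Fin.append (flip i j s) z := by
  funext k
  refine Fin.addCases (fun k => ?_) (fun k => ?_) k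
  · rw [Fin.append_left, flip, flip, Equiv.swap_apply_def, Equiv.swap_apply_def]
    simp only [Fin.ext_iff, Fin.val_castAdd]
    split_ifs <;> rw [Fin.append_left]
  · rw [Fin.append_right, flip, Equiv.swap_apply_of_ne_of_ne, Fin.append_right]
    · simp [Fin.ext_iff]; omega
    · simp [Fin.ext_iff]; omega

theorem slice_triplet {i j : Fin n} (hij : i ≠ j) (z : Fin r → Fin 2) (x : Qubits (n + r)) :
    slice z (triplet (Fin.castAdd r i) (Fin.castAdd r j) x) = triplet i j (slice z x) := by
  ext s
  rw [slice_apply, triplet_apply (by simpa [Fin.ext_iff] using hij), triplet_apply hij, flip_append,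
    Fin.append_left, Fin.append_left]
  rfl

theorem slice_singlet {i j : Fin n} (hij : i ≠ j) (z : Fin r → Fin 2) (x : Qubits (n + r)) :
    slice z (singlet (Fin.castAdd r i) (Fin.castAdd r j) x) = singlet i j (slice z x) := by
  ext s
  rw [slice_apply, singlet_apply (by simpa [Fin.ext_iff] using hij), singlet_apply hij, flip_append,
    Fin.append_left, Fin.append_left]
  rfl

end Slice

/-- The state in which all the qubits are in the state `|0⟩`. -/
def zeroState (n : ℕ) : Qubits n := EuclideanSpace.single (fun _ => 0) 1

theorem norm_zeroState (n : ℕ) : ‖zeroState n‖ = 1 := by simp [zeroState]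

theorem triplet_zeroState {n : ℕ} {i j : Fin n} (hij : i ≠ j) : triplet i j (zeroState n) = 0 := by
  ext s
  rw [triplet_apply hij]
  split_ifs with h
  · have h1 : s ≠ fun _ => 0 := by rintro rfl; exact h rfl
    have h2 : flip i j s ≠ fun _ => 0 := by
      intro h2
      have := congrFun h2 i
      have := congrFun h2 j
      simp_all
    simp [zeroState, h1, h2]
  · rfl

theorem singlet_zeroState {n : ℕ} {i j : Fin n} (hij : i ≠ j) : singlet i j (zeroState n) = 0 := by
  ext s
  rw [singlet_apply hij]
  split_ifs with h
  · have h1 : s ≠ fun _ => 0 := by rintro rfl; exact h rfl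
    have h2 : flip i j s ≠ fun _ => 0 := by
      intro h2
      have := congrFun h2 i
      have := congrFun h2 j
      simp_all
    simp [zeroState, h1, h2]
  · rfl

theorem triplet_isProj {n : ℕ} {i j : Fin n} (hij : i ≠ j) : IsProj (triplet i j) :=
  ⟨triplet_isSymmetric i j, triplet_triplet hij⟩

theorem singlet_isProj {n : ℕ} {i j : Fin n} (hij : i ≠ j) : IsProj (singlet i j) :=
  ⟨singlet_isSymmetric i j, singlet_singlet hij⟩

theorem Distinct.isGadget {n : ℕ} {i j a b : Fin n} (h : Distinct i j a b) :
    IsGadget (triplet a b) (triplet i a) (triplet j a) (singlet i j) where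
  proj := triplet_isProj h.ab
  proj₁ := triplet_isProj h.ia
  proj₂ := triplet_isProj h.ja
  projB := singlet_isProj h.ij
  comm := triplet_comm_singlet h.ij h.ab h.ia h.ib h.ja h.jb
  compress₁ := triplet_compress h
  compress₂ := triplet_compress h.symm
  compress₁₂ := triplet_compress_mul h

/-- Both projections annihilate the all-zero state. In consequence a nonnegative lower threshold is
always met, and the reduction may replace it by zero. -/
theorem groundEnergy_nonpos (I : Inst) (s : ℝ) : groundEnergy (I.hamiltonian (J s)) ≤ 0 := by
  have h := (groundEnergy_spec (hamiltonian_isHermitian I (J_isHermitian s))).2 (zeroState I.n)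
  rw [norm_zeroState, form_hamiltonian] at h
  have h0 : (I.edges.map fun e => (e.weight.val : ℝ) * (-s * form (singlet e.fst e.snd) (zeroState I.n) -
      form (triplet e.fst e.snd) (zeroState I.n))).sum = 0 := by
    refine List.sum_eq_zero fun c hc => ?_
    obtain ⟨e, _, rfl⟩ := List.mem_map.mp hc
    simp [form, triplet_zeroState e.fst_lt_snd.ne, singlet_zeroState e.fst_lt_snd.ne]
  linarith

end ToyModel

end

noncomputable section

namespace ToyModel

open RCLike
open scoped InnerProductSpace

/-! ### The ground-state energy of the reduced instance -/

theorem form_sum {E : Type*} [NormedAddCommGroup E] [InnerProductSpace ℂ E] {ι : Type*} [Fintype ι]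
    (T : ι → E →ₗ[ℂ] E) (x : E) : form (∑ k, T k) x = ∑ k, form (T k) x := by
  simp [form]

theorem isSymmetric_sum_smul {E : Type*} [NormedAddCommGroup E] [InnerProductSpace ℂ E] {ι : Type*}
    [Fintype ι] (T : ι → E →ₗ[ℂ] E) (hT : ∀ k, (T k).IsSymmetric) (c : ι → ℝ) :
    (∑ k, (c k : ℂ) • T k).IsSymmetric := by
  intro x y
  simp only [LinearMap.sum_apply, LinearMap.smul_apply, sum_inner, inner_sum, inner_smul_left,
    inner_smul_right, Complex.conj_ofReal]
  exact Finset.sum_congr rfl fun k _ => by rw [hT k]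

section Effective

variable {n N : ℕ}

/-- The direct interactions. -/
def direct (T : ℕ) (l : List (Edge n)) (c : Fin n → Fin N) : Qubits N →ₗ[ℂ] Qubits N :=
  ∑ k : Fin l.length, ((-(edgeRound T l[k] * T ^ 2 : ℝ) : ℝ) : ℂ) • triplet (c l[k].fst) (c l[k].snd)

/-- The mediated interactions. -/
def mediated (T t : ℕ) (l : List (Edge n)) (c : Fin n → Fin N) : Qubits N →ₗ[ℂ] Qubits N :=
  ∑ k : Fin l.length, ((edgeRound T l[k] * t : ℝ) : ℂ) • singlet (c l[k].fst) (c l[k].snd)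

theorem direct_isSymmetric (T : ℕ) (l : List (Edge n)) (c : Fin n → Fin N) :
    (direct T l c).IsSymmetric :=
  isSymmetric_sum_smul _ (fun _ => triplet_isSymmetric _ _) _

theorem mediated_isSymmetric (T t : ℕ) (l : List (Edge n)) (c : Fin n → Fin N) :
    (mediated T t l c).IsSymmetric := by
  exact isSymmetric_sum_smul _ (fun k : Fin l.length => singlet_isSymmetric (c l[k].fst) (c l[k].snd)) _

theorem form_direct (T : ℕ) (l : List (Edge n)) (c : Fin n → Fin N) (x : Qubits N) :
    form (direct T l c) x =
      ∑ k : Fin l.length, -(edgeRound T l[k] * T ^ 2 : ℝ) * form (triplet (c l[k].fst) (c l[k].snd)) x := by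
  rw [direct, form_sum]
  exact Finset.sum_congr rfl fun k _ => form_smul _ _ _

theorem form_mediated (T t : ℕ) (l : List (Edge n)) (c : Fin n → Fin N) (x : Qubits N) :
    form (mediated T t l c) x =
      ∑ k : Fin l.length, (edgeRound T l[k] * t : ℝ) * form (singlet (c l[k].fst) (c l[k].snd)) x := by
  rw [mediated, form_sum]
  exact Finset.sum_congr rfl fun k _ => form_smul _ _ _

theorem direct_nonpos (T : ℕ) (l : List (Edge n)) {c : Fin n → Fin N} (hc : Function.Injective c)
    (x : Qubits N) : form (direct T l c) x ≤ 0 := by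
  rw [form_direct]
  refine Finset.sum_nonpos fun k _ => ?_
  have := (triplet_isProj (hc.ne (Edge.fst_lt_snd l[k]).ne)).form_nonneg x
  rw [neg_mul, neg_nonpos]
  positivity

theorem sumRound_eq (T : ℕ) (l : List (Edge n)) :
    (sumRound T l : ℝ) = ∑ k : Fin l.length, (edgeRound T l[k] : ℝ) := by
  rw [sumRound, ← Fin.sum_univ_fun_getElem]
  push_cast
  rfl

theorem neg_le_form_direct (T : ℕ) (l : List (Edge n)) {c : Fin n → Fin N} (hc : Function.Injective c)
    (x : Qubits N) : -(sumRound T l * T ^ 2 * ‖x‖ ^ 2) ≤ form (direct T l c) x := by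
  rw [form_direct, sumRound_eq, Finset.sum_mul, Finset.sum_mul, ← Finset.sum_neg_distrib]
  refine Finset.sum_le_sum fun k _ => ?_
  have := (triplet_isProj (hc.ne (Edge.fst_lt_snd l[k]).ne)).form_le x
  rw [neg_mul, neg_le_neg_iff]
  gcongr

theorem form_mediated_nonneg (T t : ℕ) (l : List (Edge n)) {c : Fin n → Fin N}
    (hc : Function.Injective c) (x : Qubits N) : 0 ≤ form (mediated T t l c) x := by
  rw [form_mediated]
  refine Finset.sum_nonneg fun k _ => ?_
  have := (singlet_isProj (hc.ne (Edge.fst_lt_snd l[k]).ne)).form_nonneg x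
  positivity

theorem slice_direct {r : ℕ} (T : ℕ) (l : List (Edge n)) (z : Fin r → Fin 2) (x : Qubits (n + r)) :
    slice z (direct T l (Fin.castAdd r) x) = direct T l id (slice z x) := by
  simp only [direct, LinearMap.sum_apply, LinearMap.smul_apply, map_sum, map_smul, id]
  exact Finset.sum_congr rfl fun k _ => by rw [slice_triplet (Edge.fst_lt_snd l[k]).ne]

theorem slice_mediated {r : ℕ} (T t : ℕ) (l : List (Edge n)) (z : Fin r → Fin 2)
    (x : Qubits (n + r)) :
    slice z (mediated T t l (Fin.castAdd r) x) = mediated T t l id (slice z x) := by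
  simp only [mediated, LinearMap.sum_apply, LinearMap.smul_apply, map_sum, map_smul, id]
  exact Finset.sum_congr rfl fun k _ => by rw [slice_singlet (Edge.fst_lt_snd l[k]).ne]

end Effective

section Gadget

variable {n m : ℕ}

/-- The first ancilla of a gadget. -/
def ancA (n : ℕ) (k : Fin m) : Fin (n + 2 * m) := ⟨n + 2 * k, by omega⟩

/-- The second ancilla of a gadget. -/
def ancB (n : ℕ) (k : Fin m) : Fin (n + 2 * m) := ⟨n + 2 * k + 1, by omega⟩

theorem distinct_gadget (e : Edge n) (k : Fin m) :
    Distinct (Fin.castAdd (2 * m) e.fst) (Fin.castAdd (2 * m) e.snd) (ancA n k) (ancB n k) := by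
  have := e.fst_lt_snd
  have := e.fst.2
  have := e.snd.2
  constructor <;> simp only [ancA, ancB, ne_eq, Fin.ext_iff, Fin.val_castAdd] <;> omega

theorem sum_map_flatMap {α β : Type*} (l : List α) (f : α → List β) (h : β → ℝ) :
    ((l.flatMap f).map h).sum = (l.map fun k => ((f k).map h).sum).sum := by
  induction l with
  | nil => rfl
  | cons k l ih => simp only [List.flatMap_cons, List.map_append, List.sum_append, ih, List.map_cons,
      List.sum_cons]

/-- For $s=0$ only triplet terms remain. They are grouped by gadget with `N = T ^ 4`, in the shape
of `IsGadget.lower_bound` and `exists_trial_state`. -/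
theorem form_gadgetInst (T t : ℕ) (hT : 0 < T) (ht : 0 < t) (I : Inst)
    (x : Qubits (I.n + 2 * I.edges.length)) :
    form (Matrix.toEuclideanLin ((gadgetInst T t hT ht I).hamiltonian (J 0))) x =
      form (direct T I.edges (Fin.castAdd _)) x -
      ∑ k : Fin I.edges.length, (edgeRound T I.edges[k] * t : ℝ) * (2 * (T ^ 4 : ℝ) ^ 2 *
        form (triplet (ancA I.n k) (ancB I.n k)) x + 2 * (T ^ 4 : ℝ) *
        form (triplet (Fin.castAdd _ I.edges[k].fst) (ancA I.n k) +
          triplet (Fin.castAdd _ I.edges[k].snd) (ancA I.n k)) x) := by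
  refine (form_hamiltonian (gadgetInst T t hT ht I) 0 x).trans ?_
  change ((gadgetEdges T t hT ht I.edges).map fun e : Edge (I.n + 2 * I.edges.length) =>
    (e.weight.val : ℝ) * (-0 * form (singlet e.fst e.snd) x - form (triplet e.fst e.snd) x)).sum = _
  rw [gadgetEdges, sum_map_flatMap, ← Fin.sum_univ_def, form_direct, ← Finset.sum_sub_distrib]
  refine Finset.sum_congr rfl fun k _ => ?_
  simp only [gadget, List.map_cons, List.map_nil, List.sum_cons, List.sum_nil, ancillaEdge, natEdge,
    Frac.val, form_map_add]
  push_cast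
  simp only [neg_zero, zero_mul, zero_sub, div_one]
  change _ * -form (triplet (Fin.castAdd _ I.edges[k].fst) (Fin.castAdd _ I.edges[k].snd)) x +
    (_ * -form (triplet (Fin.castAdd _ I.edges[k].fst) (ancA I.n k)) x +
    (_ * -form (triplet (Fin.castAdd _ I.edges[k].snd) (ancA I.n k)) x +
    (_ * -form (triplet (ancA I.n k) (ancB I.n k)) x + 0))) = _
  ring

/-- The state of the ancillas that has the ground-state energy of their interaction. -/
def ancillaAmplitude (m : ℕ) (z : Fin (2 * m) → Fin 2) : ℂ :=
  open Classical in
  if ∀ k : Fin m, z ⟨2 * k, by omega⟩ ≠ z ⟨2 * k + 1, by omega⟩ then 1 else 0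

/-- The state of all the qubits for a given state of the first `n` qubits. -/
def withAncillas (m : ℕ) (x : Qubits n) : Qubits (n + 2 * m) :=
  WithLp.toLp 2 fun s => ancillaAmplitude m (fun i => s (Fin.natAdd n i)) *
    x fun i => s (Fin.castAdd (2 * m) i)

theorem slice_withAncillas (x : Qubits n) (z : Fin (2 * m) → Fin 2) :
    slice z (withAncillas m x) = ancillaAmplitude m z • x := by
  ext s
  simp [slice_apply, withAncillas]

theorem withAncillas_ne_zero {x : Qubits n} (hx : x ≠ 0) : withAncillas m x ≠ 0 := by
  intro h
  -- In the alternating ancilla configuration every pair is antiparallel, so its amplitude is one.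
  have h1 := slice_withAncillas (m := m) x fun i => if (i : ℕ) % 2 = 0 then 0 else 1
  rw [h, map_zero, ancillaAmplitude, if_pos, one_smul] at h1
  · exact hx h1.symm
  · intro k
    simp

/-- The ancilla state is an unnormalised product of $\psi^+$ pairs: the amplitude is unchanged when
the two values of a pair are exchanged and vanishes when they are equal. -/
theorem triplet_withAncillas (x : Qubits n) (k : Fin m) :
    triplet (ancA n k) (ancB n k) (withAncillas m x) = withAncillas m x := by
  have hab : ancA n k ≠ ancB n k := by simp [ancA, ancB]
  ext s
  rw [triplet_apply hab]
  have hdata : ∀ i, flip (ancA n k) (ancB n k) s (Fin.castAdd (2 * m) i) = s (Fin.castAdd (2 * m) i) := by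
    intro i
    refine flip_of_ne ?_ ?_ s <;> simp [ancA, ancB, Fin.ext_iff] <;> omega
  split_ifs with h
  · have hz : ancillaAmplitude m (fun i => flip (ancA n k) (ancB n k) s (Fin.natAdd n i)) =
        ancillaAmplitude m fun i => s (Fin.natAdd n i) := by
      unfold ancillaAmplitude
      congr 1
      refine propext (forall_congr' fun l => ?_)
      beta_reduce
      by_cases hl : l = k
      · subst hl
        have h1 : flip (ancA n l) (ancB n l) s (Fin.natAdd n ⟨2 * l, by omega⟩) = s (ancB n l) :=
          flip_left _ _ _
        have h2 : flip (ancA n l) (ancB n l) s (Fin.natAdd n ⟨2 * l + 1, by omega⟩) = s (ancA n l) :=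
          flip_right _ _ _
        rw [h1, h2]
        exact ne_comm
      · have hl' : (l : ℕ) ≠ k := fun h' => hl (Fin.ext h')
        rw [flip_of_ne, flip_of_ne] <;> simp [ancA, ancB, Fin.ext_iff] <;> omega
    simp only [withAncillas, hdata, hz]
    ring
  · have hz : ancillaAmplitude m (fun i => s (Fin.natAdd n i)) = 0 := by
      unfold ancillaAmplitude
      rw [if_neg]
      intro h'
      exact h (h' k)
    simp [withAncillas, hz]

/-- The ground-state energy of the effective Hamiltonian. -/
structure IsEffectiveEnergy (T t : ℕ) (l : List (Edge n)) (μ : ℝ) : Prop where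
  exists_state : ∃ x : Qubits n, x ≠ 0 ∧ (direct T l id + mediated T t l id) x = (μ : ℂ) • x
  le_form : ∀ x : Qubits n, μ * ‖x‖ ^ 2 ≤ form (direct T l id + mediated T t l id) x

theorem exists_isEffectiveEnergy (T t : ℕ) (l : List (Edge n)) : ∃ μ, IsEffectiveEnergy T t l μ := by
  obtain ⟨μ, h1, h2⟩ := exists_least_eigenvalue
    ((direct_isSymmetric T l id).add (mediated_isSymmetric T t l id))
  exact ⟨μ, exists_of_hasEigenvalue h1, h2⟩

theorem slice_effective (T t : ℕ) (l : List (Edge n)) {r : ℕ} (z : Fin r → Fin 2)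
    (x : Qubits (n + r)) :
    slice z ((direct T l (Fin.castAdd r) + mediated T t l (Fin.castAdd r)) x) =
      (direct T l id + mediated T t l id) (slice z x) := by
  rw [LinearMap.add_apply, map_add, slice_direct, slice_mediated, LinearMap.add_apply]

theorem IsEffectiveEnergy.le_form_castAdd {T t : ℕ} {l : List (Edge n)} {μ : ℝ}
    (h : IsEffectiveEnergy T t l μ) {r : ℕ} (x : Qubits (n + r)) :
    μ * ‖x‖ ^ 2 ≤ form (direct T l (Fin.castAdd r)) x + form (mediated T t l (Fin.castAdd r)) x := by
  rw [← form_map_add, form_eq_sum_slice (slice_effective T t l), norm_sq_eq_sum_slice, Finset.mul_sum]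
  exact Finset.sum_le_sum fun z _ => h.le_form _

theorem IsEffectiveEnergy.nonpos {T t : ℕ} {l : List (Edge n)} {μ : ℝ}
    (h : IsEffectiveEnergy T t l μ) : μ ≤ 0 := by
  have h1 := h.le_form (zeroState n)
  rw [norm_zeroState, form_map_add, form_direct, form_mediated] at h1
  have h2 : ∀ k : Fin l.length, triplet l[k].fst l[k].snd (zeroState n) = 0 := fun k =>
    triplet_zeroState (Edge.fst_lt_snd l[k]).ne
  have h3 : ∀ k : Fin l.length, singlet l[k].fst l[k].snd (zeroState n) = 0 := fun k =>
    singlet_zeroState (Edge.fst_lt_snd l[k]).ne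
  simpa only [form, id, h2, h3, inner_zero_right, map_zero, mul_zero, Finset.sum_const_zero, add_zero,
    one_pow, mul_one] using h1

theorem IsEffectiveEnergy.neg_le {T t : ℕ} {l : List (Edge n)} {μ : ℝ}
    (h : IsEffectiveEnergy T t l μ) : -(sumRound T l * T ^ 2 : ℝ) ≤ μ := by
  obtain ⟨x, hx, hμ⟩ := h.exists_state
  have h1 := form_eigenvector hμ
  rw [form_map_add] at h1
  have h2 := neg_le_form_direct T l Function.injective_id x
  have h3 := form_mediated_nonneg T t l Function.injective_id x
  refine le_of_mul_le_mul_right (a := ‖x‖ ^ 2) ?_ (by positivity)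
  linarith

/-- The quadratic form of the reduced instance. -/
def gadgetForm (T t : ℕ) (l : List (Edge n)) (x : Qubits (n + 2 * l.length)) : ℝ :=
  form (direct T l (Fin.castAdd _)) x -
    ∑ k : Fin l.length, (edgeRound T l[k] * t : ℝ) * (2 * (T ^ 4 : ℝ) ^ 2 *
      form (triplet (ancA n k) (ancB n k)) x + 2 * (T ^ 4 : ℝ) *
      form (triplet (Fin.castAdd _ l[k].fst) (ancA n k) +
        triplet (Fin.castAdd _ l[k].snd) (ancA n k)) x)

theorem groundEnergy_gadgetInst (T t : ℕ) (hT : 0 < T) (ht : 0 < t) (I : Inst) :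
    (∃ x : Qubits (I.n + 2 * I.edges.length), x ≠ 0 ∧ gadgetForm T t I.edges x =
      groundEnergy ((gadgetInst T t hT ht I).hamiltonian (J 0)) * ‖x‖ ^ 2) ∧
    ∀ x : Qubits (I.n + 2 * I.edges.length),
      groundEnergy ((gadgetInst T t hT ht I).hamiltonian (J 0)) * ‖x‖ ^ 2 ≤ gadgetForm T t I.edges x := by
  obtain ⟨⟨x, hx, hx'⟩, h⟩ := groundEnergy_spec
    (hamiltonian_isHermitian (gadgetInst T t hT ht I) (J_isHermitian 0))
  exact ⟨⟨x, hx, (form_gadgetInst T t hT ht I x).symm.trans (form_eigenvector hx')⟩,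
    fun y => (h y).trans_eq (form_gadgetInst T t hT ht I y)⟩

/-- The ground-state energy of the reduced instance is bounded below. -/
theorem gadget_lower_bound (T t : ℕ) (hT : 2 ≤ T) (ht : 0 < t) (I : Inst) {μ : ℝ}
    (h : IsEffectiveEnergy T t I.edges μ) :
    μ - gadgetShift T t I.edges - 3 / (T ^ 4 : ℝ) * (sumRound T I.edges * t) ≤
      groundEnergy ((gadgetInst T t (by omega) ht I).hamiltonian (J 0)) := by
  obtain ⟨⟨x, hx, h1⟩, -⟩ := groundEnergy_gadgetInst T t (by omega) ht I
  rw [gadgetForm] at h1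
  have hN : (3 : ℝ) ≤ (T : ℝ) ^ 4 := by
    have : (2 : ℝ) ^ 4 ≤ (T : ℝ) ^ 4 := by gcongr; exact_mod_cast hT
    linarith
  have h2 := h.le_form_castAdd (r := 2 * I.edges.length) x
  rw [form_mediated] at h2
  -- The one-gadget inequality, multiplied by the nonnegative strength of the gadget. It holds on
  -- the whole space, so the gadgets can be summed although they share qubits.
  have h3 : ∀ k : Fin I.edges.length, (edgeRound T I.edges[k] * t : ℝ) *
      form (singlet (Fin.castAdd (2 * I.edges.length) I.edges[k].fst) (Fin.castAdd _ I.edges[k].snd)) x -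
      (edgeRound T I.edges[k] * t : ℝ) * ((2 * (T ^ 4 : ℝ) ^ 2 + T ^ 4 + 1 + 3 / T ^ 4) * ‖x‖ ^ 2) ≤
      -((edgeRound T I.edges[k] * t : ℝ) * (2 * (T ^ 4 : ℝ) ^ 2 *
        form (triplet (ancA I.n k) (ancB I.n k)) x + 2 * (T ^ 4 : ℝ) *
        form (triplet (Fin.castAdd _ I.edges[k].fst) (ancA I.n k) +
          triplet (Fin.castAdd _ I.edges[k].snd) (ancA I.n k)) x)) := by
    intro k
    have h4 := (distinct_gadget I.edges[k] k).isGadget.lower_bound hN x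
    have h5 : (0 : ℝ) ≤ edgeRound T I.edges[k] * t := by positivity
    have h6 := mul_le_mul_of_nonneg_left h4 h5
    linarith
  have h4 := Finset.sum_le_sum fun k (_ : k ∈ Finset.univ) => h3 k
  rw [Finset.sum_sub_distrib, Finset.sum_neg_distrib, ← Finset.sum_mul, ← Finset.sum_mul,
    ← sumRound_eq] at h4
  have h5 : 0 < ‖x‖ ^ 2 := by positivity
  refine le_of_mul_le_mul_right ?_ h5
  have h6 : (gadgetShift T t I.edges : ℝ) = sumRound T I.edges * t * (2 * (T ^ 4 : ℝ) ^ 2 + T ^ 4 + 1) := by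
    rw [gadgetShift]
    push_cast
    ring
  rw [← h1, h6]
  linarith

/-- The ground-state energy of the reduced instance is bounded above. -/
theorem gadget_upper_bound (T t : ℕ) (hT : 0 < T) (ht : 0 < t) (I : Inst) {μ : ℝ}
    (h : IsEffectiveEnergy T t I.edges μ) :
    groundEnergy ((gadgetInst T t hT ht I).hamiltonian (J 0)) ≤ μ - gadgetShift T t I.edges +
      2 * I.edges.length / (T ^ 4 : ℝ) * (sumRound T I.edges * t) := by
  obtain ⟨φ, hφ, hφ'⟩ := h.exists_state
  have hc : Function.Injective (Fin.castAdd (n := I.n) (2 * I.edges.length)) :=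
    Fin.castAdd_injective _ _
  set u : Qubits (I.n + 2 * I.edges.length) := withAncillas I.edges.length φ with hu
  have hu0 : u ≠ 0 := withAncillas_ne_zero hφ
  have hueff : (direct T I.edges (Fin.castAdd (2 * I.edges.length)) +
      mediated T t I.edges (Fin.castAdd (2 * I.edges.length))) u = (μ : ℂ) • u := by
    refine ext_slice fun z => ?_
    rw [slice_effective, hu, slice_withAncillas, map_smul, map_smul, slice_withAncillas, hφ',
      smul_comm]
  have hueff' := form_eigenvector hueff
  rw [form_map_add, form_mediated] at hueff'
  have hN : (0 : ℝ) < (T : ℝ) ^ 4 := by positivity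
  have hdist := fun k : Fin I.edges.length => distinct_gadget I.edges[k] k
  have hpair : ∀ k l : Fin I.edges.length, k ≠ l → ancA I.n k ≠ ancA I.n l ∧
      ancA I.n k ≠ ancB I.n l ∧ ancB I.n k ≠ ancA I.n l ∧ ancB I.n k ≠ ancB I.n l := by
    intro k l hkl
    have : (k : ℕ) ≠ l := fun h' => hkl (Fin.ext h')
    simp only [ancA, ancB, ne_eq, Fin.ext_iff]
    omega
  have hdata : ∀ (i : Fin I.n) (k : Fin I.edges.length),
      Fin.castAdd (2 * I.edges.length) i ≠ ancA I.n k ∧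
      Fin.castAdd (2 * I.edges.length) i ≠ ancB I.n k := by
    intro i k
    simp only [ancA, ancB, ne_eq, Fin.ext_iff, Fin.val_castAdd]
    omega
  have hXu : ∀ k, triplet (ancA I.n k) (ancB I.n k) (direct T I.edges (Fin.castAdd _) u) =
      direct T I.edges (Fin.castAdd _) u := by
    intro k
    rw [direct, LinearMap.sum_apply, map_sum]
    refine Finset.sum_congr rfl fun l _ => ?_
    rw [LinearMap.smul_apply, map_smul, triplet_comm_triplet (hdist l).ij (hdist k).ab (hdata _ _).1
      (hdata _ _).2 (hdata _ _).1 (hdata _ _).2, triplet_withAncillas]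
  have hcomm : ∀ k l, k ≠ l → ∀ x, triplet (ancA I.n l) (ancB I.n l)
      ((triplet (Fin.castAdd _ I.edges[k].fst) (ancA I.n k) +
        triplet (Fin.castAdd _ I.edges[k].snd) (ancA I.n k)) x) =
      (triplet (Fin.castAdd _ I.edges[k].fst) (ancA I.n k) +
        triplet (Fin.castAdd _ I.edges[k].snd) (ancA I.n k)) (triplet (ancA I.n l) (ancB I.n l) x) := by
    intro k l hkl x
    rw [LinearMap.add_apply, map_add, triplet_comm_triplet (hdist k).ia (hdist l).ab (hdata _ _).1
      (hdata _ _).2 (hpair k l hkl).1 (hpair k l hkl).2.1, triplet_comm_triplet (hdist k).ja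
      (hdist l).ab (hdata _ _).1 (hdata _ _).2 (hpair k l hkl).1 (hpair k l hkl).2.1,
      LinearMap.add_apply]
  have hPP : ∀ (k l : Fin I.edges.length) x, triplet (ancA I.n l) (ancB I.n l) (triplet (ancA I.n k) (ancB I.n k) x) =
      triplet (ancA I.n k) (ancB I.n k) (triplet (ancA I.n l) (ancB I.n l) x) := by
    intro k l x
    by_cases hkl : k = l
    · rw [hkl]
    · obtain ⟨h1, h2, h3, h4⟩ := hpair k l hkl
      exact triplet_comm_triplet (hdist k).ab (hdist l).ab h1 h2 h3 h4 x
  obtain ⟨y, hy1, hy2, hy3⟩ := exists_trial_state (fun k => (hdist k).isGadget)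
    (direct_isSymmetric T I.edges (Fin.castAdd _)) (direct_nonpos T I.edges hc)
    (u := u) (fun k => triplet_withAncillas φ k) hXu hcomm hPP
    (g := fun k => (edgeRound T I.edges[k] * t : ℝ)) (fun k => by positivity) hN
  have h2 := (groundEnergy_gadgetInst T t hT ht I).2 y
  rw [gadgetForm] at h2
  have hμ0 := h.nonpos
  have hμ1 := h.neg_le
  rw [Fintype.card_fin] at hy2
  simp only [mul_sub, Finset.sum_sub_distrib] at hy3
  simp only [mul_add, Finset.sum_add_distrib] at h2
  rw [← Finset.sum_mul, ← Finset.sum_mul, ← Finset.sum_mul, ← Finset.sum_mul, ← sumRound_eq] at hy3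
  have h6 : (gadgetShift T t I.edges : ℝ) =
      sumRound T I.edges * t * (2 * (T ^ 4 : ℝ) ^ 2 + T ^ 4 + 1) := by
    rw [gadgetShift]
    push_cast
    ring
  rw [h6]
  set S : ℝ := (sumRound T I.edges : ℝ)
  set E := groundEnergy ((gadgetInst T t hT ht I).hamiltonian (J 0))
  have hS : 0 ≤ S := Nat.cast_nonneg _
  have hy0 : 0 < ‖y‖ ^ 2 := lt_of_lt_of_le (by positivity) hy1
  have h7 : (E + S * t * (2 * (T ^ 4 : ℝ) ^ 2)) * ‖y‖ ^ 2 ≤ (μ - S * t * (T ^ 4 + 1)) * ‖u‖ ^ 2 := by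
    linarith
  have hSt : S ≤ S * t := le_mul_of_one_le_right hS (by exact_mod_cast ht)
  have hT1 : (1 : ℝ) ≤ T := by exact_mod_cast hT
  have hT2 : (T : ℝ) ^ 2 ≤ (T : ℝ) ^ 4 := pow_le_pow_right₀ hT1 (by norm_num)
  have hT3 : (1 : ℝ) ≤ (T : ℝ) ^ 4 := one_le_pow₀ hT1
  generalize (T : ℝ) ^ 4 = N at *
  -- `δ` measures the norm excess of the trial state, so that $(1-\delta)\|y\|^2\le\|u\|^2$. The
  -- energy multiplying $\|u\|^2$ is nonpositive and at least $-4StN$, so passing to $\|y\|^2$ costs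
  -- at most $4\delta StN$, which is the stated error.
  set δ : ℝ := I.edges.length / (2 * N ^ 2)
  have hδ : 0 ≤ δ := by positivity
  have h8 : (1 - δ) * ‖y‖ ^ 2 ≤ ‖u‖ ^ 2 := by
    have := mul_le_mul_of_nonneg_left hy1 hδ
    linarith
  have h9 : 0 ≤ S * t * (N + 1) := by positivity
  have h10 : (μ - S * t * (N + 1)) * ‖u‖ ^ 2 ≤ (μ - S * t * (N + 1)) * ((1 - δ) * ‖y‖ ^ 2) :=
    mul_le_mul_of_nonpos_left h8 (by linarith)
  have h11 : E + S * t * (2 * N ^ 2) ≤ (μ - S * t * (N + 1)) * (1 - δ) := by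
    refine le_of_mul_le_mul_right ?_ hy0
    linarith
  have h12 : S * T ^ 2 ≤ S * t * N := mul_le_mul hSt hT2 (by positivity) (by positivity)
  have h13 : S * t ≤ S * t * N := le_mul_of_one_le_right (by positivity) hT3
  have h14 : δ * -(μ - S * t * (N + 1)) ≤ δ * (4 * (S * t * N)) :=
    mul_le_mul_of_nonneg_left (by linarith) hδ
  have h15 : δ * (4 * (S * t * N)) = 2 * I.edges.length / N * (S * t) := by
    simp only [δ]
    field_simp
    ring
  linarith

end Gadget

end ToyModel

end

noncomputable section

namespace ToyModel

open RCLike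

/-! ### Error analysis -/

theorem Frac.abs_val (q : Frac) : |(q.val : ℝ)| = (q.num.natAbs : ℝ) / q.den := by
  rw [Frac.val, Rat.cast_div, abs_div, Rat.cast_intCast, Rat.cast_natCast, Nat.abs_cast,
    Nat.cast_natAbs, Int.cast_abs]

theorem roundFrac_le (T : ℕ) (q : Frac) : (roundFrac T q : ℝ) ≤ T ^ 2 * |(q.val : ℝ)| := by
  have hq : (0 : ℝ) < q.den := by exact_mod_cast q.den_pos
  rw [Frac.abs_val, ← mul_div_assoc, le_div_iff₀ hq]
  have h1 : roundFrac T q ≤ T ^ 2 * q.num.natAbs / q.den := min_le_right _ _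
  have h2 := (Nat.mul_le_mul_right q.den h1).trans (Nat.div_mul_le_self _ _)
  exact_mod_cast h2

theorem roundFrac_le_pow (T : ℕ) (q : Frac) : roundFrac T q ≤ T ^ 4 := min_le_left _ _

/-- Weights and strength are small enough to escape the clamp, but the lower threshold of an
instance may be arbitrarily negative; `gadgetInst_no` treats both alternatives. -/
theorem lt_roundFrac_or (T : ℕ) (q : Frac) :
    (T ^ 2 * |(q.val : ℝ)| : ℝ) < roundFrac T q + 1 ∨ roundFrac T q = T ^ 4 := by
  rcases le_total (T ^ 4) (T ^ 2 * q.num.natAbs / q.den) with h | h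
  · exact Or.inr (min_eq_left h)
  · left
    have hq : (0 : ℝ) < q.den := by exact_mod_cast q.den_pos
    rw [Frac.abs_val, ← mul_div_assoc, div_lt_iff₀ hq, roundFrac, min_eq_right h]
    have h1 : T ^ 2 * q.num.natAbs < (T ^ 2 * q.num.natAbs / q.den + 1) * q.den := by
      rw [add_mul, one_mul]
      exact Nat.lt_div_mul_add q.den_pos
    exact_mod_cast h1

theorem lt_roundFrac {T : ℕ} {q : Frac} (h : |(q.val : ℝ)| ≤ T ^ 2) :
    (T ^ 2 * |(q.val : ℝ)| : ℝ) < roundFrac T q + 1 := by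
  rcases lt_roundFrac_or T q with h1 | h1
  · exact h1
  · rw [h1]
    have := mul_le_mul_of_nonneg_left h (by positivity : (0 : ℝ) ≤ (T : ℝ) ^ 2)
    push_cast
    linarith [show (T : ℝ) ^ 2 * (T : ℝ) ^ 2 = (T : ℝ) ^ 4 by ring]

/-- An approximation within $1/(T^2+1)$, scaled by $T^2$, is off by at most one; rounding down and
adding one contributes at most one more. The hypothesis `hT` excludes the clamp. -/
theorem abs_roundFrac_sub_le {T : ℕ} {q : Frac} {s : ℝ} (hs : s < 0)
    (hq : |s - (q.val : ℝ)| ≤ 1 / (((T ^ 2 : ℕ) : ℝ) + 1)) (hT : -s + 1 ≤ (T : ℝ) ^ 2) :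
    |((roundFrac T q + 1 : ℕ) : ℝ) - T ^ 2 * -s| ≤ 2 := by
  push_cast at hq ⊢
  have hD : (0 : ℝ) ≤ (T : ℝ) ^ 2 := by positivity
  generalize hDe : (T : ℝ) ^ 2 = D at *
  have h1 : 1 / (D + 1) ≤ 1 := by
    rw [div_le_one (by linarith)]; linarith
  have h2 : D * (1 / (D + 1)) ≤ 1 := by
    rw [mul_one_div, div_le_one (by linarith)]; linarith
  have h3 : |(|(q.val : ℝ)| - -s)| ≤ 1 / (D + 1) := by
    have := abs_abs_sub_abs_le (q.val : ℝ) s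
    rw [abs_of_neg hs, abs_sub_comm (q.val : ℝ)] at this
    exact this.trans hq
  obtain ⟨h4, h5⟩ := abs_le.mp h3
  have h6 := lt_roundFrac (T := T) (q := q) (by rw [hDe]; linarith)
  have h7 := roundFrac_le T q
  rw [hDe] at h6 h7
  have h8 : D * |(q.val : ℝ)| ≤ D * (-s + 1 / (D + 1)) := mul_le_mul_of_nonneg_left (by linarith) hD
  have h9 : D * (-s - 1 / (D + 1)) ≤ D * |(q.val : ℝ)| := mul_le_mul_of_nonneg_left (by linarith) hD
  rw [mul_add] at h8
  rw [mul_sub] at h9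
  rw [abs_le]
  constructor <;> linarith

theorem length_edges_le (I : Inst) : I.edges.length ≤ I.n ^ 2 := by
  have h : (I.edges.map fun e => (e.fst, e.snd)).Nodup := by
    rw [List.Nodup, List.pairwise_map]
    exact I.simple
  have := h.length_le_card
  rwa [List.length_map, Fintype.card_prod, Fintype.card_fin, ← sq] at this

theorem edgeRound_bounds {n T : ℕ} {e : Edge n} (h : (e.weight.val : ℝ) ≤ T ^ 2) :
    0 ≤ (edgeRound T e : ℝ) - T ^ 2 * e.weight.val ∧
      (edgeRound T e : ℝ) - T ^ 2 * e.weight.val ≤ 1 := by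
  have hw : (0 : ℝ) < e.weight.val := by exact_mod_cast e.weight_pos
  have h1 := roundFrac_le T e.weight
  have h2 := lt_roundFrac (T := T) (q := e.weight) (by rwa [abs_of_pos hw])
  rw [abs_of_pos hw] at h1 h2
  rw [edgeRound]
  push_cast
  constructor <;> linarith

/-- The assumptions on the precision `T`, for weights at most `p` and interaction strength `-s`. -/
structure IsPrecise (T m : ℕ) (p s : ℝ) : Prop where
  two_le : (2 : ℝ) ≤ T
  one_le : 1 ≤ p
  strength : -s + 1 ≤ T
  weight : 4 * p ≤ T
  clamp : m * p + 3 ≤ T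
  error : m * (2 * p - s + 3) + (3 + 2 * m) * m * (p + 1) * (2 - s) ≤ T

section Compare

variable {T t : ℕ} {p s : ℝ} {I : Inst}

theorem IsPrecise.le_sq {m : ℕ} (h : IsPrecise T m p s) : (T : ℝ) ≤ T ^ 2 := by
  nlinarith [h.two_le]

/-- The coefficients are of order $T^4$, while rounding `w` and `s` perturbs them by order $T^2$
only. Here `a` and `b` stand for the triplet and singlet forms and `X` for the squared norm. -/
theorem edge_error (hs : s < 0) (ht : |(t : ℝ) - T ^ 2 * -s| ≤ 2) (hp : 1 ≤ p)
    (hT : p ≤ (T : ℝ) ^ 2) {n : ℕ} {e : Edge n} (he : (e.weight.val : ℝ) ≤ p) {a b X : ℝ}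
    (ha : 0 ≤ a) (ha' : a ≤ X) (hb : 0 ≤ b) (hb' : b ≤ X) :
    |(-(edgeRound T e * T ^ 2 : ℝ) * a + (edgeRound T e * t : ℝ) * b) -
      (T ^ 2) ^ 2 * (e.weight.val * (-s * b - a))| ≤ T ^ 2 * (2 * p - s + 3) * X := by
  obtain ⟨h1, h2⟩ := edgeRound_bounds (T := T) (he.trans hT)
  have hw : (0 : ℝ) < e.weight.val := by exact_mod_cast e.weight_pos
  generalize (e.weight.val : ℝ) = w at *
  have hu : (0 : ℝ) ≤ edgeRound T e := Nat.cast_nonneg _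
  generalize (edgeRound T e : ℝ) = u at *
  generalize (T : ℝ) ^ 2 = D at *
  have hD : 1 ≤ D := hp.trans hT
  have hX : 0 ≤ X := ha.trans ha'
  have e1 : (-(u * D) * a + u * t * b) - D ^ 2 * (w * (-s * b - a)) =
      (u * (t - D * -s) + (u - D * w) * (D * -s)) * b + -(D * (u - D * w)) * a := by ring
  have hu' : u ≤ D * p + 1 := by
    have := mul_le_mul_of_nonneg_left he (by linarith : 0 ≤ D)
    linarith
  have e2 : |u * (t - D * -s) + (u - D * w) * (D * -s)| ≤ 2 * (D * p + 1) + D * -s := by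
    refine (abs_add_le _ _).trans (add_le_add ?_ ?_)
    · rw [abs_mul, abs_of_nonneg hu, mul_comm]
      exact mul_le_mul ht hu' hu (by norm_num)
    · have : 0 ≤ D * -s := mul_nonneg (by linarith) (by linarith)
      rw [abs_mul, abs_of_nonneg h1, abs_of_nonneg this]
      exact mul_le_of_le_one_left this h2
  have e3 : |-(D * (u - D * w))| ≤ D := by
    rw [abs_neg, abs_mul, abs_of_nonneg h1, abs_of_nonneg (by linarith)]
    exact mul_le_of_le_one_right (by linarith) h2
  rw [e1]
  refine (abs_add_le _ _).trans ?_
  rw [abs_mul, abs_mul, abs_of_nonneg ha, abs_of_nonneg hb]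
  have e4 := mul_le_mul e2 hb' hb ((abs_nonneg _).trans e2)
  have e5 := mul_le_mul e3 ha' ha ((abs_nonneg _).trans e3)
  nlinarith

theorem form_error (hs : s < 0) (ht : |(t : ℝ) - T ^ 2 * -s| ≤ 2)
    (h : IsPrecise T I.edges.length p s) (hw : ∀ e ∈ I.edges, (e.weight.val : ℝ) ≤ p)
    (x : Qubits I.n) :
    |form (direct T I.edges id + mediated T t I.edges id) x -
      (T ^ 2) ^ 2 * form (Matrix.toEuclideanLin (I.hamiltonian (J s))) x| ≤
      I.edges.length * (T ^ 2 * (2 * p - s + 3)) * ‖x‖ ^ 2 := by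
  have hp := h.one_le
  have hT : p ≤ (T : ℝ) ^ 2 := by linarith [h.weight, h.le_sq]
  rw [form_map_add, form_direct, form_mediated, form_hamiltonian, ← Fin.sum_univ_fun_getElem,
    ← Finset.sum_add_distrib, Finset.mul_sum, ← Finset.sum_sub_distrib]
  refine (Finset.abs_sum_le_sum_abs _ _).trans ?_
  refine (Finset.sum_le_sum fun k _ => edge_error hs ht hp hT (hw _ (List.getElem_mem k.2))
    ((triplet_isProj (Edge.fst_lt_snd _).ne).form_nonneg x)
    ((triplet_isProj (Edge.fst_lt_snd _).ne).form_le x)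
    ((singlet_isProj (Edge.fst_lt_snd _).ne).form_nonneg x)
    ((singlet_isProj (Edge.fst_lt_snd _).ne).form_le x)).trans (le_of_eq ?_)
  rw [Finset.sum_const, Finset.card_univ, Fintype.card_fin, nsmul_eq_mul]
  ring

theorem IsEffectiveEnergy.abs_sub_le (hs : s < 0) (ht : |(t : ℝ) - T ^ 2 * -s| ≤ 2)
    (h : IsPrecise T I.edges.length p s) (hw : ∀ e ∈ I.edges, (e.weight.val : ℝ) ≤ p) {μ : ℝ}
    (hμ : IsEffectiveEnergy T t I.edges μ) :
    |μ - (T ^ 2) ^ 2 * groundEnergy (I.hamiltonian (J s))| ≤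
      I.edges.length * (T ^ 2 * (2 * p - s + 3)) := by
  obtain ⟨⟨y, hy, hy'⟩, hle⟩ := groundEnergy_spec (hamiltonian_isHermitian I (J_isHermitian s))
  obtain ⟨x, hx, hx'⟩ := hμ.exists_state
  have h1 := form_eigenvector hx'
  have h2 := form_eigenvector hy'
  have h3 := hle x
  have h4 := hμ.le_form y
  have h5 := (abs_le.mp (form_error hs ht h hw x)).1
  have h6 := (abs_le.mp (form_error hs ht h hw y)).2
  rw [h1] at h5
  rw [h2] at h6
  have hx0 : 0 < ‖x‖ ^ 2 := by positivity
  have hy0 : 0 < ‖y‖ ^ 2 := by positivity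
  have h7 := mul_le_mul_of_nonneg_left h3 (by positivity : (0 : ℝ) ≤ ((T : ℝ) ^ 2) ^ 2)
  rw [abs_le]
  constructor
  · refine le_of_mul_le_mul_right ?_ hx0
    linarith
  · refine le_of_mul_le_mul_right ?_ hy0
    linarith

theorem sumRound_le (h : IsPrecise T I.edges.length p s)
    (hw : ∀ e ∈ I.edges, (e.weight.val : ℝ) ≤ p) :
    (sumRound T I.edges : ℝ) ≤ I.edges.length * (T ^ 2 * (p + 1)) := by
  have hT : p ≤ (T : ℝ) ^ 2 := by linarith [h.weight, h.le_sq, h.one_le]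
  rw [sumRound_eq]
  refine (Finset.sum_le_card_nsmul _ _ ((T : ℝ) ^ 2 * (p + 1)) fun k _ => ?_).trans (le_of_eq ?_)
  · have h1 := hw _ (List.getElem_mem k.2)
    have h2 := (edgeRound_bounds (T := T) (h1.trans hT)).2
    have h3 := mul_le_mul_of_nonneg_left h1 (by positivity : (0 : ℝ) ≤ (T : ℝ) ^ 2)
    have h4 : (1 : ℝ) ≤ (T : ℝ) ^ 2 := h.one_le.trans hT
    simp only [Fin.getElem_fin] at *
    linarith
  · rw [Finset.card_univ, Fintype.card_fin, nsmul_eq_mul]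

/-- The ground-state energies of the original and of the reduced instance. -/
theorem energy_error (hs : s < 0) (ht0 : 0 < t) (ht : |(t : ℝ) - T ^ 2 * -s| ≤ 2)
    (h : IsPrecise T I.edges.length p s) (hw : ∀ e ∈ I.edges, (e.weight.val : ℝ) ≤ p) (hT : 0 < T) :
    |groundEnergy ((gadgetInst T t hT ht0 I).hamiltonian (J 0)) + gadgetShift T t I.edges -
      (T ^ 2) ^ 2 * groundEnergy (I.hamiltonian (J s))| ≤ T ^ 3 := by
  obtain ⟨μ, hμ⟩ := exists_isEffectiveEnergy T t I.edges
  have hT2 : 2 ≤ T := by exact_mod_cast h.two_le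
  have h1 := gadget_lower_bound T t hT2 ht0 I hμ
  have h2 := gadget_upper_bound T t hT ht0 I hμ
  have h3 := hμ.abs_sub_le hs ht h hw
  have h4 := sumRound_le h hw
  have hD : (1 : ℝ) ≤ (T : ℝ) ^ 2 := by linarith [h.le_sq, h.two_le]
  have h5 : (t : ℝ) ≤ T ^ 2 * (2 - s) := by
    have := (abs_le.mp ht).2
    linarith
  have hm : (0 : ℝ) ≤ I.edges.length := Nat.cast_nonneg _
  have hp := h.one_le
  have h6 : (sumRound T I.edges * t : ℝ) ≤
      (T : ℝ) ^ 4 * (I.edges.length * (p + 1) * (2 - s)) := by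
    have := mul_le_mul h4 h5 (Nat.cast_nonneg _) (by positivity)
    linarith
  have hN : (0 : ℝ) < (T : ℝ) ^ 4 := by positivity
  have h7 : (sumRound T I.edges * t : ℝ) / T ^ 4 ≤ I.edges.length * (p + 1) * (2 - s) := by
    rw [div_le_iff₀ hN]
    linarith
  have h8 : (0 : ℝ) ≤ (sumRound T I.edges * t : ℝ) / T ^ 4 := by positivity
  have h9 : 3 / (T ^ 4 : ℝ) * (sumRound T I.edges * t) = 3 * ((sumRound T I.edges * t : ℝ) / T ^ 4) := by
    ring
  have h10 : 2 * I.edges.length / (T ^ 4 : ℝ) * (sumRound T I.edges * t) =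
      2 * I.edges.length * ((sumRound T I.edges * t : ℝ) / T ^ 4) := by ring
  rw [h9] at h1
  rw [h10] at h2
  have h11 : (3 + 2 * I.edges.length) * ((sumRound T I.edges * t : ℝ) / T ^ 4) ≤
      (3 + 2 * I.edges.length) * (I.edges.length * (p + 1) * (2 - s)) :=
    mul_le_mul_of_nonneg_left h7 (by positivity)
  -- Rounding contributes $T^2m(2p-s+3)$, with $m$ the number of edges, and perturbation theory at
  -- most $(3+2m)m(p+1)(2-s)$. The field `error` was chosen so that $T^2$ times the sum of the two
  -- brackets is at most $T^3$.
  have h12 := mul_le_mul_of_nonneg_left h.error (by positivity : (0 : ℝ) ≤ (T : ℝ) ^ 2)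
  have h13 : (0 : ℝ) ≤ (3 + 2 * I.edges.length) * I.edges.length * (p + 1) * (2 - s) := by
    have : 0 ≤ 2 - s := by linarith
    positivity
  have h14 := le_mul_of_one_le_left h13 hD
  have h15 : 0 ≤ 2 * I.edges.length * ((sumRound T I.edges * t : ℝ) / T ^ 4) := by positivity
  obtain ⟨h16, h17⟩ := abs_le.mp h3
  rw [abs_le]
  constructor <;> linarith

/-- For $s<0$ the singlet terms only raise the energy, and each triplet term lowers it by at most
its weight. This shows that a clamped threshold is still below every possible energy. -/
theorem neg_le_groundEnergy (hs : s < 0) (hw : ∀ e ∈ I.edges, (e.weight.val : ℝ) ≤ p) :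
    -(I.edges.length * p) ≤ groundEnergy (I.hamiltonian (J s)) := by
  obtain ⟨⟨y, hy, hy'⟩, -⟩ := groundEnergy_spec (hamiltonian_isHermitian I (J_isHermitian s))
  have h1 := form_eigenvector hy'
  rw [form_hamiltonian, ← Fin.sum_univ_fun_getElem] at h1
  have h2 : ∑ k : Fin I.edges.length, -(p * ‖y‖ ^ 2) ≤ groundEnergy (I.hamiltonian (J s)) * ‖y‖ ^ 2 := by
    rw [← h1]
    refine Finset.sum_le_sum fun k _ => ?_
    have h3 := hw _ (List.getElem_mem k.2)
    have h4 : (0 : ℝ) < I.edges[k].weight.val := by exact_mod_cast Edge.weight_pos _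
    have h5 := (triplet_isProj (Edge.fst_lt_snd I.edges[k]).ne).form_le y
    have h6 := (singlet_isProj (Edge.fst_lt_snd I.edges[k]).ne).form_nonneg y
    have h7 := mul_le_mul h3 h5 ((triplet_isProj (Edge.fst_lt_snd I.edges[k]).ne).form_nonneg y)
      (h4.le.trans h3)
    have h8 : 0 ≤ -s * form (singlet I.edges[k].fst I.edges[k].snd) y := mul_nonneg (by linarith) h6
    have h9 := mul_nonneg h4.le h8
    simp only [Fin.getElem_fin] at *
    linarith
  rw [Finset.sum_const, Finset.card_univ, Fintype.card_fin, nsmul_eq_mul] at h2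
  refine le_of_mul_le_mul_right ?_ (by positivity : 0 < ‖y‖ ^ 2)
  linarith

/-- `threshold` is a truncated difference of natural numbers; the second alternative is the
truncation to zero. -/
theorem threshold_cases (T t : ℕ) (I : Inst) :
    ((threshold T t I : ℝ) = T ^ 2 * (if I.lo.num < 0 then roundFrac T I.lo else 0 : ℕ) +
      gadgetShift T t I.edges - T ^ 3 ∧ (0 : ℝ) ≤ threshold T t I) ∨
    ((threshold T t I : ℝ) = 0 ∧ (T ^ 2 * (if I.lo.num < 0 then roundFrac T I.lo else 0 : ℕ) +
      gadgetShift T t I.edges : ℝ) ≤ T ^ 3) := by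
  unfold threshold
  generalize (if I.lo.num < 0 then roundFrac T I.lo else 0) = l
  rcases le_total (T ^ 3) (T ^ 2 * l + gadgetShift T t I.edges) with h | h
  · left
    rw [Nat.cast_sub h]
    push_cast
    have : ((T ^ 3 : ℕ) : ℝ) ≤ ((T ^ 2 * l + gadgetShift T t I.edges : ℕ) : ℝ) := by exact_mod_cast h
    push_cast at this
    exact ⟨rfl, by linarith⟩
  · right
    rw [Nat.sub_eq_zero_of_le h]
    exact ⟨Nat.cast_zero, by exact_mod_cast h⟩

theorem Frac.val_neg_iff (q : Frac) : (q.val : ℝ) < 0 ↔ q.num < 0 := by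
  have hq : (0 : ℚ) < q.den := by exact_mod_cast q.den_pos
  rw [Rat.cast_lt_zero, Frac.val, div_neg_iff]
  simp [hq, not_lt.mpr hq.le]

/-- The reduction preserves yes-instances. -/
theorem gadgetInst_yes (hs : s < 0) (ht0 : 0 < t) (ht : |(t : ℝ) - T ^ 2 * -s| ≤ 2)
    (h : IsPrecise T I.edges.length p s) (hw : ∀ e ∈ I.edges, (e.weight.val : ℝ) ≤ p) (hT : 0 < T)
    (hyes : groundEnergy (I.hamiltonian (J s)) ≤ I.lo.val) :
    groundEnergy ((gadgetInst T t hT ht0 I).hamiltonian (J 0)) ≤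
      ((gadgetInst T t hT ht0 I).lo.val : ℝ) := by
  have h1 := (abs_le.mp (energy_error hs ht0 ht h hw hT)).2
  have h2 : ((gadgetInst T t hT ht0 I).lo.val : ℝ) = -(threshold T t I : ℝ) := by
    simp [gadgetInst, Frac.val]
  have h0 : groundEnergy ((gadgetInst T t hT ht0 I).hamiltonian (J 0)) ≤ 0 := groundEnergy_nonpos _ _
  have h3 : ((T : ℝ) ^ 2) ^ 2 * groundEnergy (I.hamiltonian (J s)) ≤
      -((T : ℝ) ^ 2 * (if I.lo.num < 0 then roundFrac T I.lo else 0 : ℕ)) := by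
    split_ifs with hlo
    · have h4 := roundFrac_le T I.lo
      rw [abs_of_neg ((Frac.val_neg_iff _).mpr hlo)] at h4
      have h5 := mul_le_mul_of_nonneg_left h4 (by positivity : (0 : ℝ) ≤ (T : ℝ) ^ 2)
      have h6 := mul_le_mul_of_nonneg_left hyes (by positivity : (0 : ℝ) ≤ ((T : ℝ) ^ 2) ^ 2)
      linarith
    · have := mul_nonpos_of_nonneg_of_nonpos (by positivity : (0 : ℝ) ≤ ((T : ℝ) ^ 2) ^ 2)
        (groundEnergy_nonpos I s)
      simpa using this
  rw [h2]
  -- If the threshold was truncated, it is zero, and the nonpositivity `h0` suffices.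
  rcases threshold_cases T t I with ⟨h4, h5⟩ | ⟨h4, h5⟩ <;> rw [h4] <;> linarith

/-- The reduction preserves no-instances. -/
theorem gadgetInst_no (hs : s < 0) (ht0 : 0 < t) (ht : |(t : ℝ) - T ^ 2 * -s| ≤ 2)
    (h : IsPrecise T I.edges.length p s) (hw : ∀ e ∈ I.edges, (e.weight.val : ℝ) ≤ p) (hT : 0 < T)
    (hgap : 1 ≤ ((I.hi.val : ℝ) - I.lo.val) * p)
    (hno : (I.hi.val : ℝ) ≤ groundEnergy (I.hamiltonian (J s))) :
    ((gadgetInst T t hT ht0 I).hi.val : ℝ) ≤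
      groundEnergy ((gadgetInst T t hT ht0 I).hamiltonian (J 0)) := by
  have h1 := (abs_le.mp (energy_error hs ht0 ht h hw hT)).1
  have h2 : ((gadgetInst T t hT ht0 I).hi.val : ℝ) = 1 - (threshold T t I : ℝ) := by
    simp [gadgetInst, Frac.val]
  have hp : 0 < p := by linarith [h.one_le]
  have h3 := groundEnergy_nonpos I s
  have h4 := neg_le_groundEnergy hs hw
  have hT2 := h.two_le
  have hMnn : (0 : ℝ) ≤ gadgetShift T t I.edges := Nat.cast_nonneg _
  have hgap' : 1 / p ≤ (I.hi.val : ℝ) - I.lo.val := by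
    rwa [div_le_iff₀ hp]
  have hpT : 4 / (T : ℝ) ≤ 1 / p := by
    rw [div_le_div_iff₀ (by linarith) hp]
    linarith [h.weight]
  have hTpos : (0 : ℝ) < T := by linarith
  have hpT0 : 0 < 4 / (T : ℝ) := by positivity
  have hlo : (I.lo.val : ℝ) < 0 := by linarith
  -- The first part excludes truncation of the threshold. The second is the scaled gap: one error
  -- $T^3$ is built into the threshold, another comes from `energy_error`, and one is the new gap. A
  -- gap of $1/p\ge 4/T$ scales to at least $4T^3$, which also absorbs the rounding error $T^2$.
  have key : (T : ℝ) ^ 2 * roundFrac T I.lo ≥ T ^ 3 ∧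
      1 + 2 * (T : ℝ) ^ 3 - (T ^ 2) ^ 2 * groundEnergy (I.hamiltonian (J s)) ≤
        T ^ 2 * roundFrac T I.lo := by
    rcases lt_roundFrac_or T I.lo with h5 | h5
    · rw [abs_of_neg hlo] at h5
      have h6 : (T : ℝ) ^ 2 * (4 / T) = 4 * T := by field_simp
      have h7 : (T : ℝ) ^ 2 * (4 / T) ≤ (T : ℝ) ^ 2 * (groundEnergy (I.hamiltonian (J s)) - I.lo.val) :=
        mul_le_mul_of_nonneg_left (by linarith) (by positivity)
      have h8 : 4 * (T : ℝ) - T ^ 2 * groundEnergy (I.hamiltonian (J s)) - 1 ≤ roundFrac T I.lo := by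
        linarith
      have h9 := mul_le_mul_of_nonneg_left h8 (by positivity : (0 : ℝ) ≤ (T : ℝ) ^ 2)
      have h10 : 0 ≤ -((T : ℝ) ^ 2 * ((T : ℝ) ^ 2 * groundEnergy (I.hamiltonian (J s)))) := by
        have := mul_nonpos_of_nonneg_of_nonpos (by positivity : (0 : ℝ) ≤ (T : ℝ) ^ 2 * (T : ℝ) ^ 2) h3
        linarith
      constructor <;> nlinarith
    -- If `lo` is clamped, the left-hand side is $T^6$, which exceeds $T^4$ times the largest
    -- possible absolute energy by a sufficient margin.
    · rw [h5]
      push_cast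
      have h6 := h.clamp
      have h7 := mul_le_mul_of_nonneg_left h4 (by positivity : (0 : ℝ) ≤ ((T : ℝ) ^ 2) ^ 2)
      have h8 : (T : ℝ) ≤ T ^ 2 := h.le_sq
      have h9 : ((T : ℝ) ^ 2) ^ 2 * (I.edges.length * p + 3) ≤ ((T : ℝ) ^ 2) ^ 2 * T ^ 2 :=
        mul_le_mul_of_nonneg_left (by linarith) (by positivity)
      have h10 : (T : ℝ) ^ 3 ≤ (T : ℝ) ^ 4 := pow_le_pow_right₀ (by linarith) (by norm_num)
      have h11 : (T : ℝ) ^ 3 ≤ (T : ℝ) ^ 6 := pow_le_pow_right₀ (by linarith) (by norm_num)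
      have h12 : (1 : ℝ) ≤ (T : ℝ) ^ 4 := one_le_pow₀ (by linarith)
      constructor <;> nlinarith
  have hthr : (threshold T t I : ℝ) =
      T ^ 2 * roundFrac T I.lo + gadgetShift T t I.edges - T ^ 3 := by
    have := threshold_cases T t I
    rw [if_pos ((Frac.val_neg_iff _).mp hlo)] at this
    rcases this with ⟨h4, h5⟩ | ⟨h4, h5⟩ <;> linarith [key.1]
  rw [h2, hthr]
  linarith [key.2]

end Compare

end ToyModel

end

noncomputable section

namespace ToyModel

/-! ### Local unitary equivalence with the EPR problem -/

section Tensor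

variable {n : ℕ}

/-- The tensor product of one-qubit operators. -/
def tensor (M : Fin n → Matrix (Fin 2) (Fin 2) ℂ) : Matrix (Fin n → Fin 2) (Fin n → Fin 2) ℂ :=
  Matrix.of fun x y => ∏ k, M k (x k) (y k)

theorem tensor_mul (M M' : Fin n → Matrix (Fin 2) (Fin 2) ℂ) :
    tensor M * tensor M' = tensor fun k => M k * M' k := by
  ext x y
  simp only [tensor, Matrix.mul_apply, Matrix.of_apply, ← Finset.prod_mul_distrib]
  rw [Finset.prod_univ_sum, Fintype.piFinset_univ]

theorem tensor_one : tensor (fun _ : Fin n => 1) = 1 := by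
  ext x y
  simp only [tensor, Matrix.of_apply, Matrix.one_apply]
  rw [Finset.prod_ite_zero]
  simp [funext_iff]

/-- One-qubit operators on two of the qubits. -/
def twoSites (i j : Fin n) (E F : Matrix (Fin 2) (Fin 2) ℂ) : Fin n → Matrix (Fin 2) (Fin 2) ℂ :=
  fun k => if k = i then E else if k = j then F else 1

theorem tensor_twoSites {i j : Fin n} (hij : i ≠ j) (E F : Matrix (Fin 2) (Fin 2) ℂ) :
    tensor (twoSites i j E F) = onPair i j (Matrix.of fun p q => E p.1 q.1 * F p.2 q.2) := by
  ext x y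
  simp only [tensor, onPair, Matrix.of_apply]
  rw [← Finset.mul_prod_erase _ _ (Finset.mem_univ i),
    ← Finset.mul_prod_erase _ _ (Finset.mem_erase.mpr ⟨hij.symm, Finset.mem_univ j⟩)]
  have h1 : ∏ k ∈ (Finset.univ.erase i).erase j, twoSites i j E F k (x k) (y k) =
      ∏ k ∈ (Finset.univ.erase i).erase j, if x k = y k then 1 else 0 := by
    refine Finset.prod_congr rfl fun k hk => ?_
    simp only [Finset.mem_erase, Finset.mem_univ, and_true] at hk
    simp [twoSites, hk.1, hk.2, Matrix.one_apply]
  rw [h1, Finset.prod_ite_zero]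
  simp only [twoSites, if_pos, hij.symm, if_false, Finset.mem_erase, Finset.mem_univ, and_true]
  by_cases h : ∀ k, k ≠ i → k ≠ j → x k = y k
  · rw [if_pos h, if_pos fun k hk => h k hk.2 hk.1]
    simp
  · rw [if_neg h, if_neg fun h' => h fun k hi hj => h' k ⟨hj, hi⟩]
    simp

/-- Intertwining of products of one-qubit operators. -/
theorem tensor_intertwine (U : Matrix (Fin 2) (Fin 2) ℂ) (i j : Fin n)
    {E F E' F' : Matrix (Fin 2) (Fin 2) ℂ} (hE : U * E = E' * U) (hF : U * F = F' * U) :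
    tensor (fun _ => U) * tensor (twoSites i j E F) = tensor (twoSites i j E' F') * tensor fun _ => U := by
  rw [tensor_mul, tensor_mul]
  congr 1
  funext k
  unfold twoSites
  split_ifs <;> simp [hE, hF]

end Tensor

/-- The Pauli matrix `X`. -/
def pauliX : Matrix (Fin 2) (Fin 2) ℂ := !![0, 1; 1, 0]

/-- The Pauli matrix `Y`. -/
def pauliY : Matrix (Fin 2) (Fin 2) ℂ := !![0, -Complex.I; Complex.I, 0]

/-- The Pauli matrix `Z`. -/
def pauliZ : Matrix (Fin 2) (Fin 2) ℂ := !![1, 0; 0, -1]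

/-- A rotation that exchanges the Pauli matrices `Y` and `Z`, up to signs. -/
def rotation : Matrix (Fin 2) (Fin 2) ℂ :=
  ((1 / √2 : ℝ) : ℂ) • !![1, Complex.I; Complex.I, 1]

/-- The inverse of the rotation. -/
def rotationInv : Matrix (Fin 2) (Fin 2) ℂ :=
  ((1 / √2 : ℝ) : ℂ) • !![1, -Complex.I; -Complex.I, 1]

theorem rotationInv_mul_rotation : rotationInv * rotation = 1 := by
  rw [rotation, rotationInv, Matrix.smul_mul, Matrix.mul_smul, smul_smul, ofReal_inv_sqrt_two_sq]
  ext a b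
  fin_cases a <;> fin_cases b <;> simp <;> norm_num

theorem rotation_mul_rotationInv : rotation * rotationInv = 1 :=
  mul_eq_one_comm.mp rotationInv_mul_rotation

theorem rotation_pauliX : rotation * pauliX = pauliX * rotation := by
  rw [rotation, pauliX, Matrix.smul_mul, Matrix.mul_smul]
  congr 1
  ext a b
  fin_cases a <;> fin_cases b <;> simp [Matrix.mul_apply]

theorem rotation_pauliY : rotation * pauliY = (-pauliZ) * rotation := by
  rw [rotation, pauliY, pauliZ, Matrix.smul_mul, Matrix.mul_smul]
  congr 1
  ext a b
  fin_cases a <;> fin_cases b <;> simp [Matrix.mul_apply]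

theorem rotation_pauliZ : rotation * pauliZ = pauliY * rotation := by
  rw [rotation, pauliY, pauliZ, Matrix.smul_mul, Matrix.mul_smul]
  congr 1
  ext a b
  fin_cases a <;> fin_cases b <;> simp [Matrix.mul_apply]

section Pair

variable {n : ℕ} {i j : Fin n}

theorem proj_phiPlus_apply (a b c d : Fin 2) :
    proj phiPlus (a, b) (c, d) = if a = b ∧ c = d then 1 / 2 else 0 := by
  rw [← ofReal_inv_sqrt_two_sq]
  fin_cases a <;> fin_cases b <;> fin_cases c <;> fin_cases d <;>
    simp [proj, phiPlus, ket, Matrix.vecMulVec_apply]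

theorem onPair_psiPlus_eq (hij : i ≠ j) : onPair i j (proj psiPlus) = (1 / 4 : ℂ) •
    (tensor (twoSites i j 1 1) + tensor (twoSites i j pauliX pauliX) +
      tensor (twoSites i j pauliY pauliY) - tensor (twoSites i j pauliZ pauliZ)) := by
  simp only [tensor_twoSites hij]
  ext x y
  simp only [onPair, Matrix.of_apply, Matrix.smul_apply, Matrix.sub_apply, Matrix.add_apply,
    proj_psiPlus_apply]
  split_ifs with h1 h2
  all_goals
    generalize x i = a at *
    generalize x j = b at *
    generalize y i = c at *
    generalize y j = d at *
    fin_cases a <;> fin_cases b <;> fin_cases c <;> fin_cases d <;>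
      simp [pauliX, pauliY, pauliZ] at * <;> norm_num

theorem onPair_phiPlus_eq (hij : i ≠ j) : onPair i j (proj phiPlus) = (1 / 4 : ℂ) •
    (tensor (twoSites i j 1 1) + tensor (twoSites i j pauliX pauliX) +
      tensor (twoSites i j (-pauliZ) (-pauliZ)) - tensor (twoSites i j pauliY pauliY)) := by
  simp only [tensor_twoSites hij]
  ext x y
  simp only [onPair, Matrix.of_apply, Matrix.smul_apply, Matrix.sub_apply, Matrix.add_apply,
    proj_phiPlus_apply]
  split_ifs with h1 h2
  all_goals
    generalize x i = a at *
    generalize x j = b at *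
    generalize y i = c at *
    generalize y j = d at *
    fin_cases a <;> fin_cases b <;> fin_cases c <;> fin_cases d <;>
      simp [pauliX, pauliY, pauliZ] at * <;> norm_num

/-- Both projections are expanded in Pauli products, and the rotation is carried through factor by
factor. The expansion of $\phi^+$ is written with $(-Z)(-Z)$ because $Y$ is carried to $-Z$. -/
theorem rotation_onPair (hij : i ≠ j) :
    tensor (fun _ => rotation) * onPair i j (J 0) = onPair i j eprTerm * tensor fun _ => rotation := by
  have h1 : onPair i j (J 0) = -onPair i j (proj psiPlus) := by
    ext x y
    simp only [onPair, J, Matrix.of_apply, Matrix.neg_apply]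
    split_ifs <;> simp
  have h2 : onPair i j eprTerm = -onPair i j (proj phiPlus) := by
    ext x y
    simp only [onPair, eprTerm, Matrix.of_apply, Matrix.neg_apply]
    split_ifs <;> simp
  rw [h1, h2, mul_neg, neg_mul, onPair_psiPlus_eq hij, onPair_phiPlus_eq hij, Matrix.mul_smul,
    Matrix.smul_mul, mul_sub, sub_mul, mul_add, add_mul, mul_add, add_mul,
    tensor_intertwine rotation i j (by rw [mul_one, one_mul]) (by rw [mul_one, one_mul]),
    tensor_intertwine rotation i j rotation_pauliX rotation_pauliX,
    tensor_intertwine rotation i j rotation_pauliY rotation_pauliY,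
    tensor_intertwine rotation i j rotation_pauliZ rotation_pauliZ]

end Pair

theorem rotation_hamiltonian (I : Inst) :
    tensor (fun _ => rotation) * I.hamiltonian (J 0) =
      I.hamiltonian eprTerm * tensor fun _ => rotation := by
  unfold Inst.hamiltonian
  induction I.edges with
  | nil => simp
  | cons e l ih =>
    rw [List.map_cons, List.sum_cons, List.map_cons, List.sum_cons, mul_add, add_mul, ih,
      Matrix.mul_smul, Matrix.smul_mul, rotation_onPair e.fst_lt_snd.ne]

theorem hasEigenvalue_of_intertwine {ι : Type} [Fintype ι] [DecidableEq ι] {H H' W W' : Matrix ι ι ℂ}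
    (h : W * H = H' * W) (hW : W' * W = 1) {c : ℂ}
    (hc : Module.End.HasEigenvalue (Matrix.toLin' H) c) :
    Module.End.HasEigenvalue (Matrix.toLin' H') c := by
  obtain ⟨x, hx, hx0⟩ := hc.exists_hasEigenvector
  rw [Module.End.mem_eigenspace_iff, Matrix.toLin'_apply] at hx
  refine Module.End.hasEigenvalue_of_hasEigenvector (x := W.mulVec x) ⟨?_, fun h0 => hx0 ?_⟩
  · rw [Module.End.mem_eigenspace_iff, Matrix.toLin'_apply, Matrix.mulVec_mulVec, ← h,
      ← Matrix.mulVec_mulVec, hx, Matrix.mulVec_smul]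
  · have := congrArg W'.mulVec h0
    rwa [Matrix.mulVec_mulVec, hW, Matrix.one_mulVec, Matrix.mulVec_zero] at this

/-- The rotation of all the qubits is invertible and intertwines the two Hamiltonians, so
eigenvectors are carried over in both directions and the sets of eigenvalues agree. -/
theorem groundEnergy_epr (I : Inst) :
    groundEnergy (I.hamiltonian (J 0)) = groundEnergy (I.hamiltonian eprTerm) := by
  have h1 : tensor (fun _ : Fin I.n => rotationInv) * tensor (fun _ => rotation) = 1 := by
    rw [tensor_mul, rotationInv_mul_rotation, tensor_one]
  have h2 : tensor (fun _ : Fin I.n => rotation) * tensor (fun _ => rotationInv) = 1 := by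
    rw [tensor_mul, rotation_mul_rotationInv, tensor_one]
  have h3 : tensor (fun _ : Fin I.n => rotationInv) * I.hamiltonian eprTerm =
      I.hamiltonian (J 0) * tensor fun _ => rotationInv := by
    calc _ = tensor (fun _ => rotationInv) * (I.hamiltonian eprTerm *
          tensor fun _ => rotation) * tensor fun _ => rotationInv := by
          rw [mul_assoc, mul_assoc, h2, mul_one]
      _ = _ := by rw [← rotation_hamiltonian, ← mul_assoc, h1, one_mul]
  unfold groundEnergy
  congr 1
  ext E
  exact ⟨hasEigenvalue_of_intertwine (rotation_hamiltonian I) h1, hasEigenvalue_of_intertwine h3 h2⟩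

theorem toy_zero_eq_epr (p : Polynomial ℕ) : Toy 0 p = EPR p := by
  ext I <;> simp only [Toy, EPR, localHamiltonianProblem, groundEnergy_epr]

end ToyModel

end

noncomputable section

namespace ToyModel

open Computability Turing

/-! ### Correctness of the reduction -/

/-- A polynomial that bounds the precision that is needed from below. -/
def precisionPoly (p : Polynomial ℕ) (c : ℕ) : Polynomial ℕ :=
  4 * p + .X ^ 2 * (2 * p + .C c + 3) + (3 + 2 * .X ^ 2) * .X ^ 2 * (p + 1) * (.C c + 2) + .X ^ 2 * p +
    .C c + 10

theorem lt_precision (R : Polynomial ℕ) (n : ℕ) : R.eval n < precision R n :=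
  lt_two_pow_length_binary _

theorem precision_le (R : Polynomial ℕ) (n : ℕ) : precision R n ≤ 2 * R.eval n + 1 :=
  two_pow_length_binary_le _

/-- `T` exceeds the value of `precisionPoly`, whose summands dominate the individual requirements
once `m` is replaced by `n ^ 2` and `-s` by `c`. -/
theorem isPrecise_precision {p : Polynomial ℕ} {c n m : ℕ} {s : ℝ} (hs : -s ≤ c) (hp : 1 ≤ p.eval n)
    (hm : m ≤ n ^ 2) :
    IsPrecise (precision (precisionPoly p c) n) m (p.eval n : ℕ) s := by
  have h1 := lt_precision (precisionPoly p c) n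
  generalize precision (precisionPoly p c) n = T at *
  simp only [precisionPoly, Polynomial.eval_add, Polynomial.eval_mul, Polynomial.eval_pow,
    Polynomial.eval_X, Polynomial.eval_C, Polynomial.eval_ofNat, Polynomial.eval_one] at h1
  generalize p.eval n = P at *
  have e1 : m * (2 * P + c + 3) ≤ n ^ 2 * (2 * P + c + 3) := Nat.mul_le_mul_right _ hm
  have e2 : (3 + 2 * m) * m * (P + 1) * (c + 2) ≤ (3 + 2 * n ^ 2) * n ^ 2 * (P + 1) * (c + 2) := by
    gcongr
  have e3 : m * P ≤ n ^ 2 * P := Nat.mul_le_mul_right _ hm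
  refine ⟨?_, ?_, ?_, ?_, ?_, ?_⟩
  · exact_mod_cast (by omega : 2 ≤ T)
  · exact_mod_cast hp
  · have : ((c + 1 : ℕ) : ℝ) ≤ T := by exact_mod_cast (by omega : c + 1 ≤ T)
    push_cast at this
    linarith
  · exact_mod_cast (by omega : 4 * P ≤ T)
  · exact_mod_cast (by omega : m * P + 3 ≤ T)
  · have h2 : ((m * (2 * P + c + 3) + (3 + 2 * m) * m * (P + 1) * (c + 2) : ℕ) : ℝ) ≤ T := by
      exact_mod_cast (by omega)
    push_cast at h2
    have h3 : (m : ℝ) * (2 * P - s + 3) ≤ m * (2 * P + c + 3) := by gcongr; linarith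
    have h4 : ((3 + 2 * m) * m * (P + 1) * (2 - s) : ℝ) ≤ (3 + 2 * m) * m * (P + 1) * (c + 2) := by
      gcongr
      linarith
    linarith

/-- A polynomial that bounds the weights of the reduced instance. -/
def weightPoly (R : Polynomial ℕ) : Polynomial ℕ :=
  2 * ((2 * R + 1) ^ 4 + 1) ^ 2 * (2 * R + 1) ^ 8

theorem natEdge_val {n : ℕ} (i j : Fin n) (h : i < j) (w : ℕ) (hw : 0 < w) :
    (natEdge i j h w hw).weight.val = w := by
  simp [natEdge, Frac.val]

theorem gadgetEdges_weight_le {n : ℕ} (T t : ℕ) (hT : 0 < T) (ht : 0 < t) (ht' : t ≤ T ^ 4 + 1)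
    (l : List (Edge n)) (e : Edge (n + 2 * l.length)) (he : e ∈ gadgetEdges T t hT ht l) :
    e.weight.val ≤ ((2 * (T ^ 4 + 1) ^ 2 * T ^ 8 : ℕ) : ℚ) := by
  rw [gadgetEdges, List.mem_flatMap] at he
  obtain ⟨k, -, he⟩ := he
  have hu : edgeRound T l[k] ≤ T ^ 4 + 1 := Nat.add_le_add_right (roundFrac_le_pow _ _) 1
  have h48 : T ^ 4 ≤ T ^ 8 := Nat.pow_le_pow_right hT (by norm_num)
  have h28 : T ^ 2 ≤ T ^ 8 := Nat.pow_le_pow_right hT (by norm_num)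
  have w1 : edgeRound T l[k] * T ^ 2 ≤ 2 * (T ^ 4 + 1) ^ 2 * T ^ 8 := by
    refine Nat.mul_le_mul (hu.trans ?_) h28
    nlinarith [Nat.zero_le (T ^ 4)]
  have w2 : edgeRound T l[k] * (2 * T ^ 4 * t) ≤ 2 * (T ^ 4 + 1) ^ 2 * T ^ 8 :=
    calc _ ≤ (T ^ 4 + 1) * (2 * T ^ 8 * (T ^ 4 + 1)) := by gcongr
      _ = _ := by ring
  have w3 : edgeRound T l[k] * (2 * T ^ 8 * t) ≤ 2 * (T ^ 4 + 1) ^ 2 * T ^ 8 :=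
    calc _ ≤ (T ^ 4 + 1) * (2 * T ^ 8 * (T ^ 4 + 1)) := by gcongr
      _ = _ := by ring
  simp only [gadget, ancillaEdge, List.mem_cons, List.not_mem_nil, or_false] at he
  rcases he with rfl | rfl | rfl | rfl <;> rw [natEdge_val, Nat.cast_le]
  · exact w1
  · exact w2
  · exact w2
  · exact w3

/-- This needs no promise on `I`: the clamp in `roundFrac` bounds the new weights even if the old
ones are huge, and the new gap is exactly one. The bound in terms of the old number of qubits
carries over because the new number is larger or equal. -/
theorem reduction_promise (R : Polynomial ℕ) (r : ℕ → Frac) (I : Inst) :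
    (reduction R r I).Promise (weightPoly R) := by
  have hT := precision_le R I.n
  have hT0 := precision_pos R I.n
  have hq : (weightPoly R).eval I.n ≤ (weightPoly R).eval (reduction R r I).n :=
    eval_mono _ (Nat.le_add_right _ _)
  have hq' : (weightPoly R).eval I.n =
      2 * ((2 * R.eval I.n + 1) ^ 4 + 1) ^ 2 * (2 * R.eval I.n + 1) ^ 8 := by
    simp [weightPoly]
  have key : 2 * (precision R I.n ^ 4 + 1) ^ 2 * precision R I.n ^ 8 ≤ (weightPoly R).eval I.n := by
    rw [hq']
    gcongr
  have key := key.trans hq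
  constructor
  · intro e he
    exact (gadgetEdges_weight_le _ _ hT0 (Nat.succ_pos _)
      (Nat.add_le_add_right (roundFrac_le_pow _ _) 1) I.edges e he).trans (by exact_mod_cast key)
  · have h1 : (reduction R r I).hi.val - (reduction R r I).lo.val = 1 := by
      simp [reduction, gadgetInst, Frac.val]
    rw [h1, one_mul]
    have h2 : 1 ≤ 2 * (precision R I.n ^ 4 + 1) ^ 2 * precision R I.n ^ 8 := Nat.succ_le_of_lt (by positivity)
    exact_mod_cast h2.trans key

theorem one_le_of_promise {p : Polynomial ℕ} {I : Inst} (h : I.Promise p) : 1 ≤ p.eval I.n := by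
  by_contra h0
  have h1 : p.eval I.n = 0 := by omega
  have := h.2
  rw [h1] at this
  norm_num at this

theorem polyTimeReducible_toy {s : ℝ} (hs : s < 0) (happrox : PolyTimeApproximable s)
    (p : Polynomial ℕ) : ∃ q : Polynomial ℕ, PolyTimeReducible (Toy s p) (Toy 0 q) := by
  obtain ⟨r, ⟨M⟩, hr⟩ := happrox
  obtain ⟨O, hO, hout⟩ := exists_oracle M
  have hc := Nat.le_ceil (-s)
  set R := precisionPoly p ⌈-s⌉₊
  have key : ∀ I : Inst, I.Promise p →
      IsPrecise (precision R I.n) I.edges.length (p.eval I.n : ℕ) s ∧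
      |((roundFrac (precision R I.n) (r (precision R I.n ^ 2)) + 1 : ℕ) : ℝ) -
        (precision R I.n : ℝ) ^ 2 * -s| ≤ 2 ∧
      ∀ e ∈ I.edges, (e.weight.val : ℝ) ≤ (p.eval I.n : ℕ) := by
    intro I hI
    have h1 := isPrecise_precision hc (one_le_of_promise hI) (length_edges_le I)
    refine ⟨h1, abs_roundFrac_sub_le hs (hr _) (h1.strength.trans h1.le_sq), fun e he => ?_⟩
    exact_mod_cast hI.1 e he
  refine ⟨weightPoly R, reduction R r, PT.computable hO (PT.reductionStr R) _ _ _
    (reductionStr_eq R r O.out hout), ?_, ?_⟩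
  · rintro I ⟨hI, hyes⟩
    obtain ⟨h1, h2, h3⟩ := key I hI
    exact ⟨reduction_promise R r I, gadgetInst_yes hs (Nat.succ_pos _) h2 h1 h3 _ hyes⟩
  · rintro I ⟨hI, hno⟩
    obtain ⟨h1, h2, h3⟩ := key I hI
    refine ⟨reduction_promise R r I, gadgetInst_no hs (Nat.succ_pos _) h2 h1 h3 _ ?_ hno⟩
    exact_mod_cast hI.2

end ToyModel

end

theorem mainTheorem4 (s : ℝ) (hs : s < 0) (happrox : ToyModel.PolyTimeApproximable s) :
    (∀ p : Polynomial ℕ, ∃ q : Polynomial ℕ,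
      ToyModel.PolyTimeReducible (ToyModel.Toy s p) (ToyModel.Toy 0 q)) ∧
    (∀ p : Polynomial ℕ, ToyModel.Toy 0 p = ToyModel.EPR p) :=
  ⟨ToyModel.polyTimeReducible_toy hs happrox, ToyModel.toy_zero_eq_epr⟩
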